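/- **Setting.** Let $P,\mu,\lambda\in C^2((0,\infty))$, $\widetilde\rho>0$, $\widetilde P=P(\widetilde\rho)$, $\alpha\in(0,1)$, $T>0$, and $$f(\rho)=\int_{\widetilde\rho}^{\rho}\frac{2\mu(s)+\lambda(s)}{s}\,ds .$$ A *$C^{1+\alpha}$ domain* is an open, bounded, simply connected set $D\subset\mathbb R^2$ such that $D=\{\varphi>0\}$ for some $\varphi\in C^1(\mathbb R^2)$ with $\alpha$-Hölder gradient and $\inf_{\partial D}|\nabla\varphi|>0$; its outward unit normal is $n=-\nabla\varphi/|\nabla\varphi|$. For $\mathcal C=\partial D$, put $$\|g\|_{C^\alpha_{pw}}=\|g\|_{L^\infty(\mathbb R^2)}+\|g\|_{\dot C^\alpha(D)}+\|g\|_{\dot C^\alpha(\mathbb R^2\setminus\overline D)},\qquad [\![g]\!](\sigma)=\lim_{r\to0^+}\bigl[g(\sigma+rn(\sigma))-g(\sigma-rn(\sigma))\bigr]\quad(\sigma\in\mathcal C),$$ and let $L^p(\mathcal C)$ be taken with respect to arc length. Let $(\rho,u)$ be a local solution on $[0,T]$, in the sense of distributions on $(0,T)\times\mathbb R^2$, of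 $$\partial_t\rho+\operatorname{div}(\rho u)=0,\qquad \partial_t(\rho u)+\operatorname{div}(\rho u\otimes u)+\nabla P(\rho)=\operatorname{div}(2\mu(\rho)\mathbb D u)+\nabla(\lambda(\rho)\operatorname{div}u),\qquad \mathbb Du=\tfrac12(\nabla u+\nabla u^{\mathsf T}),$$ with initial data $\rho_0=\rho(0)$, $u_0=u(0)$, in the following class. The field $u$ is continuous on $[0,T]\times\mathbb R^2$ and has a flow $X$: $\partial_tX(t,x)=u(t,X(t,x))$, $X(0,x)=x$. There is a set $D(0)$ such that every $D(t)=X(t)D(0)$, $t\in[0,T]$, is a $C^{1+\alpha}$ domain; write $\mathcal C(t)=X(t)\,\partial D(0)$, and understand $C^\alpha_{pw}$ and jumps at time $t$ with respect to $D(t)$ and $\mathcal C(t)$. Moreover $\rho_0-\widetilde\rho\in L^2(\mathbb R^2)$; $P(\rho)-\widetilde P\in C([0,T],L^2(\mathbb R^2))$, and $P(\rho(t))-\widetilde P\in C^\alpha_{pw}$ for every $t\in[0,T]$; $u\in C([0,T],H^1(\mathbb R^2))$; $\dot u=\partial_tu+(u\cdot\nabla)u\in C([0,T],L^2(\mathbb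 R^2))$; and $\nabla u\in L^1((0,T),C^\alpha_{pw})$. Assume the density and viscosity bounds: for all $t\in[0,T]$ and $x\in\mathbb R^2$, $$0<\underline\rho\le\rho(t,x)\le\overline\rho,\qquad 0<\underline\mu\le\mu(\rho(t,x))\le\overline\mu,\qquad 0\le\underline\lambda\le\lambda(\rho(t,x))\le\overline\lambda,$$ and that $P'>0$, $\mu>0$, $\lambda\ge0$ on $[\underline\rho,\overline\rho]$. **Lemma.** There are constants $0<\underline\nu<\overline\nu$ and $C_*>0$ depending, for the given laws $P,\mu,\lambda$, only on $\underline\rho,\underline\mu,\overline\rho,\overline\mu,\overline\lambda$, such that $\int_0^T\|\nabla u(\tau)\|_{L^\infty(\mathbb R^2)}d\tau<\infty$ and, for all $t\in[0,T]$ and all $1\le p\le\infty$ (with $1/\infty=0$, and $|\nabla u|$ the operator norm), $$\|[\![f(\rho(t))]\!]\|_{L^p(\mathcal C(t))}\le\|[\![f(\rho_0)]\!]\|_{L^p(\mathcal C(0))}\exp\Bigl(-\underline\nu\,t+(6\overline\nu+1/p)\int_0^t\|\nabla u(\tau)\|_{L^\infty(\mathbb R^2)}d\tau\Bigr),$$ and,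 for all those $t\in[0,T]$ at which $\nabla u(t)\in C^\alpha_{pw}$ (in particular for almost every $t$), $$\|[\![\nabla u(t)]\!]\|_{L^p(\mathcal C(t))}\le C_*\|[\![f(\rho_0)]\!]\|_{L^p(\mathcal C(0))}\bigl(1+\|\nabla u(t)\|_{L^\infty(\mathbb R^2)}\bigr)\exp\Bigl(-\underline\nu\,t+(6\overline\nu+1/p)\int_0^t\|\nabla u(\tau)\|_{L^\infty(\mathbb R^2)}d\tau\Bigr).$$ -/

import Mathlib

open Set Filter Topology MeasureTheory
open scoped NNReal ENNReal

noncomputable section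

namespace CompressibleNS

/-- The plane, with its Euclidean norm. -/
abbrev Plane := EuclideanSpace ℝ (Fin 2)

/-! ### Interfaces, piecewise Hölder functions and jumps -/

/-- `D` is an open, bounded, simply connected domain of class `C^{1+α}`, with level-set function
`φ` of class `C^{1+α}`: `D = {φ > 0}` and `inf_{∂D} |∇φ| > 0`. -/
structure IsHolderDomain (α : ℝ≥0) (D : Set Plane) (φ : Plane → ℝ) : Prop where
  isOpen : IsOpen D
  isBounded : Bornology.IsBounded D
  isSimplyConnected : IsSimplyConnected D
  contDiff : ContDiff ℝ 1 φ
  holder_gradient : MemHolder α (gradient φ)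
  eq_superlevel : D = {x | 0 < φ x}
  gradient_bound : ∃ c : ℝ, 0 < c ∧ ∀ x ∈ frontier D, c ≤ ‖gradient φ x‖

/-- The outward unit normal of `{φ > 0}` at a boundary point. -/
def outwardNormal (φ : Plane → ℝ) (σ : Plane) : Plane :=
  -(‖gradient φ σ‖⁻¹ • gradient φ σ)

/-- The norm of `C^α_pw`: the `L^∞` norm plus the `α`-Hölder seminorms on the two sides `D` and
`ℝ² \ closure D` of the interface (infinite if `g` is not piecewise Hölder continuous). The values
of `g` on the interface itself do not matter. -/
def pwHolderNorm {F : Type*} [NormedAddCommGroup F] (α : ℝ≥0) (D : Set Plane) (g : Plane → F) :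
    ℝ≥0∞ :=
  eLpNorm g ∞ volume + (eHolderNorm α (D.domRestrict g) + eHolderNorm α ((closure D)ᶜ.domRestrict g))

/-- The jump `⟦g⟧(σ) = lim_{r → 0+} [g(σ + r n(σ)) - g(σ - r n(σ))]`. -/
def jump {F : Type*} [NormedAddCommGroup F] (n : Plane → Plane) (g : Plane → F) (σ : Plane) : F :=
  limUnder (𝓝[>] (0 : ℝ)) fun r => g (σ + r • n σ) - g (σ - r • n σ)

/-- The norm of `L^p(C)`, with respect to the length measure (one-dimensional Hausdorff measure) on
the curve `C`. -/
def curveNorm {F : Type*} [NormedAddCommGroup F] (p : ℝ≥0∞) (C : Set Plane) (g : Plane → F) :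
    ℝ≥0∞ :=
  eLpNorm g p ((Measure.hausdorffMeasure 1 : Measure Plane).restrict C)

/-! ### The system -/

/-- `f(r) = ∫_{ρ̃}^r (2 μ(s) + λ(s)) / s ds`. -/
def fLaw (μ lam : ℝ → ℝ) (ρt : ℝ) (r : ℝ) : ℝ :=
  ∫ s in ρt..r, (2 * μ s + lam s) / s

/-- The divergence of a velocity field, from its gradient `A`. -/
def divOf (A : Plane →L[ℝ] Plane) : ℝ :=
  ∑ i : Fin 2, A (EuclideanSpace.single i 1) i

/-- The symmetric part of the velocity gradient, from the gradient `A`. -/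
def symOf (A : Plane →L[ℝ] Plane) : Plane →L[ℝ] Plane :=
  (1 / 2 : ℝ) • (A + ContinuousLinearMap.adjoint A)

/-- Smooth scalar test functions with compact support in `(0, T) × ℝ²`. -/
def IsTest (T : ℝ) (ψ : ℝ × Plane → ℝ) : Prop :=
  ContDiff ℝ ((⊤ : ℕ∞) : WithTop ℕ∞) ψ ∧ HasCompactSupport ψ ∧ tsupport ψ ⊆ Ioo 0 T ×ˢ univ

/-- `∂_t ψ`. -/
def dt (ψ : ℝ × Plane → ℝ) (z : ℝ × Plane) : ℝ := fderiv ℝ ψ z (1, 0)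

/-- `v · ∇ψ`. -/
def dx (ψ : ℝ × Plane → ℝ) (z : ℝ × Plane) (v : Plane) : ℝ := fderiv ℝ ψ z (0, v)

/-- `G` is the weak gradient of `w` on `ℝ²` (`G x v` is the derivative of `w` in direction `v`). -/
def IsWeakGradient (w : Plane → Plane) (G : Plane → Plane →L[ℝ] Plane) : Prop :=
  ∀ η : Plane → ℝ, ContDiff ℝ ((⊤ : ℕ∞) : WithTop ℕ∞) η → HasCompactSupport η →
    ∀ v : Plane, ∫ x, η x • G x v = -∫ x, fderiv ℝ η x v • w x

/-- `g ∈ C([0, T], L²(ℝ²))`. -/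
def ContInL2 {F : Type*} [NormedAddCommGroup F] (T : ℝ) (g : ℝ → Plane → F) : Prop :=
  ∀ t ∈ Icc 0 T, MemLp (g t) 2 volume ∧
    Tendsto (fun s => eLpNorm (fun x => g s x - g t x) 2 volume) (𝓝[Icc 0 T] t) (𝓝 0)

/-- `(ρ, u)` is a local-in-time weak solution on `[0, T]` of the compressible Navier-Stokes system
`∂_t ρ + div(ρ u) = 0`, `∂_t(ρ u) + div(ρ u ⊗ u) + ∇P(ρ) = div(2 μ(ρ) 𝔻u) + ∇(λ(ρ) div u)`,
with initial data `ρ 0, u 0` and reference density `ρt`, whose interface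
`C(t) = X(t) ∂D₀ = ∂(X(t) D₀)` is transported by the flow `X` of `u`.
`G` is the velocity gradient, `V` the material derivative `∂_t u + (u · ∇) u`, and `φ t` is a
level-set function of the transported domain `D(t) = X(t) D₀`. -/
structure IsLocalSolution (P μ lam : ℝ → ℝ) (α : ℝ≥0) (ρt T : ℝ) (D₀ : Set Plane)
    (ρ : ℝ → Plane → ℝ) (u : ℝ → Plane → Plane) (G : ℝ → Plane → Plane →L[ℝ] Plane)
    (V : ℝ → Plane → Plane) (X : ℝ → Plane → Plane) (φ : ℝ → Plane → ℝ) : Prop where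
  measurable_ρ : AEStronglyMeasurable (Function.uncurry ρ)
    ((volume : Measure (ℝ × Plane)).restrict (Ioo 0 T ×ˢ univ))
  measurable_G : AEStronglyMeasurable (Function.uncurry G)
    ((volume : Measure (ℝ × Plane)).restrict (Ioo 0 T ×ˢ univ))
  measurable_V : AEStronglyMeasurable (Function.uncurry V)
    ((volume : Measure (ℝ × Plane)).restrict (Ioo 0 T ×ˢ univ))
  /-- `ρ₀ - ρ̃ ∈ L²`. -/
  initial_density : MemLp (fun x => ρ 0 x - ρt) 2 volume
  /-- `P(ρ) - P̃ ∈ C([0, T], L²)`. -/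
  pressure_cont : ContInL2 T fun t x => P (ρ t x) - P ρt
  /-- `P(ρ(t)) - P̃ ∈ C^α_pw` with respect to `C(t)`. -/
  pressure_pw : ∀ t ∈ Icc 0 T,
    pwHolderNorm α (X t '' D₀) (fun x => P (ρ t x) - P ρt) < ∞
  /-- `u` is continuous, and `u ∈ C([0, T], H¹)` with gradient `G`. -/
  u_continuous : ContinuousOn (Function.uncurry u) (Icc 0 T ×ˢ univ)
  u_cont : ContInL2 T u
  gradient : ∀ t ∈ Icc 0 T, IsWeakGradient (u t) (G t)
  gradient_cont : ContInL2 T G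
  /-- `∇u ∈ L¹((0, T), C^α_pw)`. -/
  gradient_pw_measurable :
    AEMeasurable (fun t => pwHolderNorm α (X t '' D₀) (G t)) (volume.restrict (Ioo 0 T))
  gradient_pw : ∫⁻ t in Ioo 0 T, pwHolderNorm α (X t '' D₀) (G t) < ∞
  /-- `V = ∂_t u + (u · ∇) u` in the sense of distributions, and `V ∈ C([0, T], L²)`. -/
  material : ∀ ψ : ℝ × Plane → ℝ, IsTest T ψ →
    ∫ z : ℝ × Plane, (ψ z • G z.1 z.2 (u z.1 z.2) - dt ψ z • u z.1 z.2)
      = ∫ z : ℝ × Plane, ψ z • V z.1 z.2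
  material_cont : ContInL2 T V
  /-- `X` is the flow of `u`. -/
  flow_zero : ∀ x, X 0 x = x
  flow : ∀ x, ∀ t ∈ Icc 0 T,
    HasDerivWithinAt (fun τ => X τ x) (u t (X t x)) (Icc 0 T) t
  /-- The transported domain stays a `C^{1+α}` domain. -/
  domain : ∀ t ∈ Icc 0 T, IsHolderDomain α (X t '' D₀) (φ t)
  /-- The mass equation. -/
  mass : ∀ ψ : ℝ × Plane → ℝ, IsTest T ψ →
    ∫ z : ℝ × Plane, ρ z.1 z.2 * (dt ψ z + dx ψ z (u z.1 z.2)) = 0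
  /-- The momentum equation, tested against the vector field `ψ e`. -/
  momentum : ∀ ψ : ℝ × Plane → ℝ, IsTest T ψ → ∀ e : Plane,
    ∫ z : ℝ × Plane,
      (ρ z.1 z.2 * inner ℝ (u z.1 z.2) e * (dt ψ z + dx ψ z (u z.1 z.2))
        + P (ρ z.1 z.2) * dx ψ z e
        - 2 * μ (ρ z.1 z.2) * dx ψ z (symOf (G z.1 z.2) e)
        - lam (ρ z.1 z.2) * divOf (G z.1 z.2) * dx ψ z e) = 0

/-- `‖g‖_{L^∞(ℝ²)}`, as a real number. -/
def supNorm {F : Type*} [NormedAddCommGroup F] (g : Plane → F) : ℝ :=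
  (eLpNorm g ∞ volume).toReal

end CompressibleNS

end

namespace CompressibleNS

/-! ### Absolutely continuous functions and Grönwall's inequality -/

/-! Along a particle path the density satisfies ρ' = -ρ div u, and f is chosen so that r f'(r) =
2μ(r) + λ(r); hence f(ρ) changes at the rate -(2μ + λ) div u. Comparing the traces from the two
sides of the interface at one particle, the jump of f(ρ) is driven by the jump of (2μ + λ) div u.
Two quantities do not jump: the tangential derivative of u, since a gradient has no curl
(`IsWeakGradient.traces_tangential`), and the normal stress, since the divergence of the stress is ρ
times the material derivative of u and so lies in L² (`inner_traces_eq`). Linear algebra in the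
normal/tangent frame then gives ⟦(2μ + λ) div u⟧ = ⟦P⟧ + 2⟦μ⟧κ, where κ is the tangential stretching
rate and |κ| ≤ ‖∇u‖_∞ (`jump_effective_flux`).

On the compact range of the density, P is an increasing function of f with slope bounded below, and
μ is a Lipschitz function of f (`exists_lawBounds`). The pressure therefore damps the jump at rate
at least νmin, and the κ term amplifies it at rate at most 2 νmax ‖∇u‖_∞. Grönwall's inequality for
the square of the jump gives a bound particle by particle (`abs_fLaw_sub_le`,
`IsLocalSolution.norm_jump_le`). Passing to L^p of the moving curve costs exp((1/p) ∫ ‖∇u‖_∞),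
because the flow stretches lengths by at most exp(∫ ‖∇u‖_∞) (`curveNorm_image_le`). The jump of ∇u
kills tangent vectors, so it has rank one, and the normal stress balance solves for it in terms of
⟦P⟧, ⟦μ⟧, ⟦λ⟧ and ∇u on one side (`norm_jump_gradient_le`).

The equations hold only as distributions, and most of the work is to extract these pointwise facts.
`integral_mul_material` rewrites the inertial terms as ρ times the material derivative, and
`IsLocalSolution.integral_stress` turns the momentum equation into a divergence identity at every
time; both jump conditions follow by blowing up at an interface point. For the density,
`IsLocalSolution.density_along_flow` tests the mass equation with a bump that travels with a
particle off the interface and shrinks to it, and `IsLocalSolution.trace_along_flow` lets such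
particles approach the interface from one side. -/

theorem _root_.LipschitzOnWith.comp_absolutelyContinuousOnInterval {X Y : Type*}
    [PseudoMetricSpace X] [PseudoMetricSpace Y] {φ : X → Y} {f : ℝ → X} {K : ℝ≥0} {a b : ℝ}
    (hφ : LipschitzOnWith K φ (f '' uIcc a b)) (hf : AbsolutelyContinuousOnInterval f a b) :
    AbsolutelyContinuousOnInterval (fun x => φ (f x)) a b := by
  rw [absolutelyContinuousOnInterval_iff] at hf ⊢
  intro ε hε
  obtain ⟨δ, hδ, h⟩ := hf (ε / (K + 1)) (by positivity)
  refine ⟨δ, hδ, fun E hE hlt => ?_⟩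
  have h1 := h E hE hlt
  calc ∑ i ∈ Finset.range E.1, dist (φ (f (E.2 i).1)) (φ (f (E.2 i).2))
      ≤ ∑ i ∈ Finset.range E.1, K * dist (f (E.2 i).1) (f (E.2 i).2) := by
        refine Finset.sum_le_sum fun i hi => ?_
        have := hE.1 i hi
        exact hφ.dist_le_mul _ (mem_image_of_mem f this.1) _ (mem_image_of_mem f this.2)
    _ = K * ∑ i ∈ Finset.range E.1, dist (f (E.2 i).1) (f (E.2 i).2) := by
        rw [Finset.mul_sum]
    _ ≤ K * (ε / (K + 1)) := by gcongr
    _ < ε := by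
        have hK : (0 : ℝ) ≤ K := K.2
        rw [mul_div_assoc', div_lt_iff₀ (by positivity)]
        nlinarith

theorem _root_.ContDiff.comp_absolutelyContinuousOnInterval {φ f : ℝ → ℝ} {a b : ℝ}
    (hφ : ContDiff ℝ 1 φ) (hf : AbsolutelyContinuousOnInterval f a b) :
    AbsolutelyContinuousOnInterval (fun x => φ (f x)) a b := by
  have hc : IsCompact (f '' uIcc a b) := isCompact_uIcc.image_of_continuousOn hf.continuousOn
  obtain ⟨R, hR⟩ := hc.isBounded.subset_closedBall 0
  obtain ⟨K, hK⟩ := hφ.contDiffOn.exists_lipschitzOnWith (by decide)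
    (convex_closedBall (0 : ℝ) R) (isCompact_closedBall (0 : ℝ) R)
  exact (hK.mono hR).comp_absolutelyContinuousOnInterval hf

/-- The product `g * exp (-∫ a)` has a nonpositive derivative almost everywhere, and absolute
continuity turns this into a comparison of end values. No sign of `a` is required, so the rate may
include the damping -νmin. -/
theorem le_mul_exp_of_deriv_le {g a : ℝ → ℝ} {T : ℝ} (hT : 0 ≤ T)
    (hg : AbsolutelyContinuousOnInterval g 0 T) (ha : IntervalIntegrable a volume 0 T)
    (h : ∀ᵐ t, t ∈ Ioo 0 T → deriv g t ≤ a t * g t) :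
    g T ≤ g 0 * Real.exp (∫ τ in (0 : ℝ)..T, a τ) := by
  set A : ℝ → ℝ := fun t => ∫ τ in (0 : ℝ)..t, a τ with hA
  have hAac : AbsolutelyContinuousOnInterval A 0 T :=
    ha.absolutelyContinuousOnInterval_intervalIntegral left_mem_uIcc
  set e : ℝ → ℝ := fun t => Real.exp (-A t) with he
  have heac : AbsolutelyContinuousOnInterval e 0 T :=
    ContDiff.comp_absolutelyContinuousOnInterval (φ := fun x => Real.exp (-x))
      (by fun_prop) hAac
  have hv := hg.fun_mul heac
  have h1 := hv.integral_deriv_eq_sub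
  have hle : ∫ x in (0 : ℝ)..T, deriv (fun x => g x * e x) x ≤ 0 := by
    rw [intervalIntegral.integral_of_le hT, integral_Ioc_eq_integral_Ioo]
    refine integral_nonpos_of_ae ?_
    · have hd := ha.ae_hasDerivAt_integral
      rw [EventuallyLE, ae_restrict_iff' measurableSet_Ioo]
      filter_upwards [h, hg.ae_differentiableAt, hd] with t h1 h2 h3 ht
      have ht' : t ∈ uIcc 0 T := by rw [uIcc_of_le hT]; exact Ioo_subset_Icc_self ht
      have hA' : HasDerivAt A (a t) t := h3 ht' 0 left_mem_uIcc
      have he' : HasDerivAt e (Real.exp (-A t) * (-a t)) t := hA'.neg.exp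
      have := ((h2 ht').hasDerivAt.mul he').deriv
      have h4 : deriv (fun x => g x * e x) t
          = deriv g t * e t + g t * (Real.exp (-A t) * (-a t)) := this
      rw [h4, Pi.zero_apply]
      have h5 := h1 ht
      have h6 : 0 < e t := Real.exp_pos _
      have : deriv g t * e t + g t * (Real.exp (-A t) * (-a t))
          = (deriv g t - a t * g t) * e t := by simp only [he]; ring
      rw [this]
      exact mul_nonpos_of_nonpos_of_nonneg (by linarith) h6.le
  rw [h1] at hle
  have h0 : e 0 = 1 := by simp [he, hA]
  have h7 : g T * e T ≤ g 0 := by rw [h0] at hle; linarith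
  have h8 : e T * Real.exp (A T) = 1 := by
    simp only [he]; rw [← Real.exp_add]; simp
  calc g T = g T * e T * Real.exp (A T) := by rw [mul_assoc, h8, mul_one]
    _ ≤ g 0 * Real.exp (A T) := by gcongr

/-! ### Constitutive laws -/

/-- Quantitative monotonicity and Lipschitz bounds for the laws on the range of the density. -/
structure LawBounds (P μ lam : ℝ → ℝ) (I : Set ℝ) (νmin νmax K : ℝ) : Prop where
  pos : 0 < νmin
  lt : νmin < νmax
  nonneg : 0 ≤ K
  pressure : ∀ ρt, 0 < ρt → ∀ a ∈ I, ∀ b ∈ I,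
    νmin * (fLaw μ lam ρt a - fLaw μ lam ρt b) ^ 2
      ≤ (P a - P b) * (fLaw μ lam ρt a - fLaw μ lam ρt b)
  viscosity : ∀ ρt, 0 < ρt → ∀ a ∈ I, ∀ b ∈ I,
    |μ a - μ b| ≤ νmax * |fLaw μ lam ρt a - fLaw μ lam ρt b|
  lip : ∀ ρt, 0 < ρt → ∀ a ∈ I, ∀ b ∈ I, ∀ g ∈ ({P, μ, lam} : Set (ℝ → ℝ)),
    |g a - g b| ≤ K * |fLaw μ lam ρt a - fLaw μ lam ρt b|
  inverse : ∀ a ∈ I, ∀ b ∈ I, |a - b| ≤ K * |P a - P b|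
  lipId : ∀ a ∈ I, ∀ b ∈ I, ∀ g ∈ ({P, μ, lam} : Set (ℝ → ℝ)), |g a - g b| ≤ K * |a - b|
  bounded : ∀ a ∈ I, ∀ g ∈ ({P, μ, lam} : Set (ℝ → ℝ)), |g a| ≤ K

theorem hasDerivAt_fLaw {μ lam : ℝ → ℝ} (hμ : ContinuousOn μ (Ioi 0))
    (hlam : ContinuousOn lam (Ioi 0)) {ρt r : ℝ} (hρt : 0 < ρt) (hr : 0 < r) :
    HasDerivAt (fLaw μ lam ρt) ((2 * μ r + lam r) / r) r := by
  have hc : ContinuousOn (fun s => (2 * μ s + lam s) / s) (Ioi 0) :=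
    ((continuousOn_const.mul hμ).add hlam).div continuousOn_id fun x hx => ne_of_gt hx
  have hsub : uIcc ρt r ⊆ Ioi 0 := fun x hx => by
    rcases mem_uIcc.1 hx with h | h <;> simp only [mem_Ioi] <;> linarith [h.1]
  refine intervalIntegral.integral_hasDerivAt_right (hc.mono hsub).intervalIntegrable ?_
    (hc.continuousAt (Ioi_mem_nhds hr))
  exact hc.stronglyMeasurableAtFilter isOpen_Ioi _ hr

-- This bound and the next are the two halves of the mean value inequality; together they compare P,
-- μ, λ with f.
theorem abs_sub_le_of_hasDerivAt {g g' : ℝ → ℝ} {m M C : ℝ}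
    (hg : ∀ r ∈ Icc m M, HasDerivAt g (g' r) r) (hC : ∀ r ∈ Icc m M, |g' r| ≤ C)
    {a b : ℝ} (ha : a ∈ Icc m M) (hb : b ∈ Icc m M) : |g a - g b| ≤ C * |a - b| := by
  have := (convex_Icc m M).norm_image_sub_le_of_norm_hasDerivWithin_le
    (fun x hx => (hg x hx).hasDerivWithinAt) (fun x hx => hC x hx) hb ha
  simpa using this

theorem mul_sub_le_of_hasDerivAt {g g' : ℝ → ℝ} {m M c : ℝ}
    (hg : ∀ r ∈ Icc m M, HasDerivAt g (g' r) r) (hc : ∀ r ∈ Icc m M, c ≤ g' r)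
    {a b : ℝ} (ha : a ∈ Icc m M) (hb : b ∈ Icc m M) (hab : a ≤ b) :
    c * (b - a) ≤ g b - g a := by
  refine (convex_Icc m M).mul_sub_le_image_sub_of_le_deriv
    (fun x hx => (hg x hx).continuousAt.continuousWithinAt)
    (fun x hx => ((hg x (interior_subset hx)).differentiableAt).differentiableWithinAt)
    (fun x hx => ?_) a ha b hb hab
  rw [(hg x (interior_subset hx)).deriv]
  exact hc x (interior_subset hx)

theorem exists_pos_le_of_continuousOn {g : ℝ → ℝ} {m M : ℝ} (hg : ContinuousOn g (Icc m M))
    (hpos : ∀ r ∈ Icc m M, 0 < g r) : ∃ c, 0 < c ∧ ∀ r ∈ Icc m M, c ≤ g r := by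
  rcases (Icc m M).eq_empty_or_nonempty with h | h
  · exact ⟨1, one_pos, by simp [h]⟩
  · obtain ⟨x, hx, hmin⟩ := isCompact_Icc.exists_isMinOn h hg
    exact ⟨g x, hpos x hx, fun r hr => hmin hr⟩

theorem exists_abs_le_of_continuousOn {g : ℝ → ℝ} {m M : ℝ} (hg : ContinuousOn g (Icc m M)) :
    ∃ C, 0 < C ∧ ∀ r ∈ Icc m M, |g r| ≤ C := by
  obtain ⟨C, hC⟩ := isCompact_Icc.exists_bound_of_continuousOn hg
  exact ⟨|C| + 1, by positivity, fun r hr => (hC r hr).trans (by linarith [le_abs_self C])⟩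

/-- Compactness of `Icc m M` bounds P' and f' = (2μ + λ)/r above, and below away from zero, so each
law is a Lipschitz function of f. Changing `ρt` only adds a constant to f, which is why the
constants do not depend on it. -/
theorem exists_lawBounds {P μ lam : ℝ → ℝ} (hP : ContDiffOn ℝ 2 P (Ioi 0))
    (hμ : ContDiffOn ℝ 2 μ (Ioi 0)) (hlam : ContDiffOn ℝ 2 lam (Ioi 0)) {m M : ℝ} (hm : 0 < m)
    (hlaw : ∀ r ∈ Icc m M, 0 < deriv P r ∧ 0 < μ r ∧ 0 ≤ lam r) :
    ∃ νmin νmax K, LawBounds P μ lam (Icc m M) νmin νmax K := by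
  have hsub : Icc m M ⊆ Ioi 0 := fun x hx => lt_of_lt_of_le hm hx.1
  have hder : ∀ g : ℝ → ℝ, ContDiffOn ℝ 2 g (Ioi 0) →
      (∀ r ∈ Icc m M, HasDerivAt g (deriv g r) r) ∧ ContinuousOn (deriv g) (Icc m M) := by
    intro g hg
    refine ⟨fun r hr => ?_, ?_⟩
    · exact ((hg.contDiffAt (Ioi_mem_nhds (hsub hr))).differentiableAt (by decide)).hasDerivAt
    · exact (hg.continuousOn_deriv_of_isOpen isOpen_Ioi (by decide)).mono hsub
  obtain ⟨hP1, hP2⟩ := hder P hP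
  obtain ⟨hμ1, hμ2⟩ := hder μ hμ
  obtain ⟨hl1, hl2⟩ := hder lam hlam
  have hfc : ContinuousOn (fun s => (2 * μ s + lam s) / s) (Icc m M) :=
    ((continuousOn_const.mul hμ.continuousOn).add hlam.continuousOn |>.mono hsub).div
      continuousOn_id fun x hx => ne_of_gt (hsub hx)
  obtain ⟨cP, hcP, hcP'⟩ := exists_pos_le_of_continuousOn hP2 fun r hr => (hlaw r hr).1
  obtain ⟨cf, hcf, hcf'⟩ := exists_pos_le_of_continuousOn hfc fun r hr =>
    div_pos (by linarith [(hlaw r hr).2.1, (hlaw r hr).2.2]) (hsub hr)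
  obtain ⟨Cf, hCf, hCf'⟩ := exists_abs_le_of_continuousOn hfc
  obtain ⟨C1, hC1, hC1'⟩ := exists_abs_le_of_continuousOn hP2
  obtain ⟨C2, hC2, hC2'⟩ := exists_abs_le_of_continuousOn hμ2
  obtain ⟨C3, hC3, hC3'⟩ := exists_abs_le_of_continuousOn hl2
  obtain ⟨B1, hB1, hB1'⟩ := exists_abs_le_of_continuousOn (hP.continuousOn.mono hsub)
  obtain ⟨B2, hB2, hB2'⟩ := exists_abs_le_of_continuousOn (hμ.continuousOn.mono hsub)
  obtain ⟨B3, hB3, hB3'⟩ := exists_abs_le_of_continuousOn (hlam.continuousOn.mono hsub)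
  have hf1 : ∀ ρt, 0 < ρt → ∀ r ∈ Icc m M,
      HasDerivAt (fLaw μ lam ρt) ((2 * μ r + lam r) / r) r := fun ρt hρt r hr =>
    hasDerivAt_fLaw hμ.continuousOn hlam.continuousOn hρt (hsub hr)
  -- lower bounds in absolute value
  have habs : ∀ (g g' : ℝ → ℝ) (c : ℝ), 0 < c → (∀ r ∈ Icc m M, HasDerivAt g (g' r) r) →
      (∀ r ∈ Icc m M, c ≤ g' r) → ∀ a ∈ Icc m M, ∀ b ∈ Icc m M,
        |a - b| ≤ c⁻¹ * |g a - g b| := by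
    intro g g' c hc hg hcg a ha b hb
    rw [inv_mul_eq_div, le_div_iff₀ hc, mul_comm]
    rcases le_total a b with h | h
    · have := mul_sub_le_of_hasDerivAt hg hcg ha hb h
      rw [abs_sub_comm a b, abs_sub_comm (g a), abs_of_nonneg (by linarith : 0 ≤ b - a)]
      exact this.trans (le_abs_self _)
    · have := mul_sub_le_of_hasDerivAt hg hcg hb ha h
      rw [abs_of_nonneg (by linarith : 0 ≤ a - b)]
      exact this.trans (le_abs_self _)
  set D := C1 + C2 + C3 with hD
  have hlipId : ∀ a ∈ Icc m M, ∀ b ∈ Icc m M, ∀ g ∈ ({P, μ, lam} : Set (ℝ → ℝ)),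
      |g a - g b| ≤ D * |a - b| := by
    intro a ha b hb g hg
    have h0 := abs_nonneg (a - b)
    rcases hg with rfl | rfl | rfl
    · exact (abs_sub_le_of_hasDerivAt hP1 hC1' ha hb).trans (by gcongr; linarith)
    · exact (abs_sub_le_of_hasDerivAt hμ1 hC2' ha hb).trans (by gcongr; linarith)
    · exact (abs_sub_le_of_hasDerivAt hl1 hC3' ha hb).trans (by gcongr; linarith)
  have hlip : ∀ ρt, 0 < ρt → ∀ a ∈ Icc m M, ∀ b ∈ Icc m M, ∀ g ∈ ({P, μ, lam} : Set (ℝ → ℝ)),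
      |g a - g b| ≤ (D * cf⁻¹) * |fLaw μ lam ρt a - fLaw μ lam ρt b| := by
    intro ρt hρt a ha b hb g hg
    refine (hlipId a ha b hb g hg).trans ?_
    rw [mul_assoc]
    gcongr
    exact habs _ _ cf hcf (hf1 ρt hρt) hcf' a ha b hb
  -- `cP / Cf` is min P' over max f', the least slope of P against f; `D * cf⁻¹` is the Lipschitz
  -- constant of the laws against f. Adding `cP / Cf` to it makes νmin < νmax strict, and the last
  -- constant dominates every remaining bound at once.
  refine ⟨cP / Cf, cP / Cf + D * cf⁻¹, D * cf⁻¹ + cP⁻¹ + D + B1 + B2 + B3, by positivity,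
    lt_add_of_pos_right _ (by positivity), by positivity, ?_, ?_, ?_, ?_, ?_, ?_⟩
  · intro ρt hρt
    have key : ∀ a ∈ Icc m M, ∀ b ∈ Icc m M, a ≤ b →
        cP / Cf * (fLaw μ lam ρt a - fLaw μ lam ρt b) ^ 2
        ≤ (P a - P b) * (fLaw μ lam ρt a - fLaw μ lam ρt b) := by
      intro a ha b hb hab
      have h1 := mul_sub_le_of_hasDerivAt hP1 hcP' ha hb hab
      have h2 := abs_sub_le_of_hasDerivAt (hf1 ρt hρt) hCf' hb ha
      have h3 := mul_sub_le_of_hasDerivAt (hf1 ρt hρt) hcf' ha hb hab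
      set X := fLaw μ lam ρt b - fLaw μ lam ρt a with hX
      have hXn : 0 ≤ X := le_trans (by have := sub_nonneg.2 hab; positivity) h3
      rw [abs_of_nonneg (sub_nonneg.2 hab)] at h2
      have h4 : X ≤ Cf * (b - a) := (le_abs_self _).trans h2
      have h5 : cP / Cf * X ≤ P b - P a := by
        refine le_trans ?_ h1
        rw [div_mul_eq_mul_div, div_le_iff₀ hCf]
        nlinarith
      have e1 : fLaw μ lam ρt a - fLaw μ lam ρt b = -X := by rw [hX]; ring
      rw [e1]
      nlinarith
    intro a ha b hb
    rcases le_total a b with h | h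
    · exact key a ha b hb h
    · have := key b hb a ha h
      nlinarith
  · intro ρt hρt a ha b hb
    refine (hlip ρt hρt a ha b hb μ (by simp)).trans ?_
    gcongr
    have : 0 < cP / Cf := by positivity
    linarith
  · intro ρt hρt a ha b hb g hg
    refine (hlip ρt hρt a ha b hb g hg).trans ?_
    gcongr
    have : 0 < cP⁻¹ := by positivity
    linarith
  · intro a ha b hb
    refine (habs _ _ cP hcP hP1 hcP' a ha b hb).trans ?_
    gcongr
    have : 0 < D * cf⁻¹ := by positivity
    linarith
  · intro a ha b hb g hg
    refine (hlipId a ha b hb g hg).trans ?_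
    gcongr
    have : 0 < D * cf⁻¹ := by positivity
    have : 0 < cP⁻¹ := by positivity
    linarith
  · have h1 : 0 < D * cf⁻¹ := by positivity
    have h2 : 0 < cP⁻¹ := by positivity
    have h3 : 0 < D := by positivity
    intro a ha g hg
    rcases hg with rfl | rfl | rfl
    · linarith [hB1' a ha]
    · linarith [hB2' a ha]
    · linarith [hB3' a ha]

/-! ### Algebra of the jump relations at an interface -/

/-- The trace is independent of the basis, so the divergence can be read in the normal/tangent frame
`b 0`, `b 1` of the interface. -/
theorem divOf_eq_sum (A : Plane →L[ℝ] Plane) (b : OrthonormalBasis (Fin 2) ℝ Plane) :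
    divOf A = inner ℝ (b 0) (A (b 0)) + inner ℝ (b 1) (A (b 1)) := by
  have h1 := (A : Plane →ₗ[ℝ] Plane).trace_eq_sum_inner b
  have h2 := (A : Plane →ₗ[ℝ] Plane).trace_eq_sum_inner (EuclideanSpace.basisFun (Fin 2) ℝ)
  rw [h1] at h2
  simp only [Fin.sum_univ_two, ContinuousLinearMap.coe_coe] at h2
  rw [h2]
  simp [divOf, EuclideanSpace.inner_single_left, Fin.sum_univ_two]

theorem inner_symOf (A : Plane →L[ℝ] Plane) (v w : Plane) :
    inner ℝ v (symOf A w) = (1 / 2 : ℝ) * (inner ℝ v (A w) + inner ℝ w (A v)) := by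
  simp only [symOf, smul_apply, add_apply,
    inner_smul_right, inner_add_right, ContinuousLinearMap.adjoint_inner_right]
  rw [real_inner_comm w (A v)]

/-- The normal component of the jump of the stress tensor. -/
theorem jump_effective_flux {A B : Plane →L[ℝ] Plane} {μA μB lA lB pA pB : ℝ}
    (b : OrthonormalBasis (Fin 2) ℝ Plane) (htan : A (b 1) = B (b 1))
    (hstress : ∀ e, inner ℝ (b 0) ((2 * μA) • symOf A e + (lA * divOf A) • e - pA • e)
      = inner ℝ (b 0) ((2 * μB) • symOf B e + (lB * divOf B) • e - pB • e)) :
    (2 * μA + lA) * divOf A - (2 * μB + lB) * divOf B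
      = (pA - pB) + 2 * (μA - μB) * inner ℝ (b 1) (B (b 1)) := by
  have h := hstress (b 0)
  simp only [inner_add_right, inner_sub_right, inner_smul_right, inner_symOf,
    OrthonormalBasis.inner_eq_one, mul_one] at h
  have hA := divOf_eq_sum A b
  have hB := divOf_eq_sum B b
  rw [htan] at hA
  -- The normal-normal stress is 2μ ∂_n u_n + λ div u - P = (2μ + λ) div u - 2μ κ - P, and κ is the
  -- same on both sides.
  linear_combination h + 2 * μA * hA - 2 * μB * hB

/-- Since `A - B` kills the tangent `b 1`, it is v ↦ ⟨b 0, v⟩ a with a = (A - B)(b 0). The normal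
and tangential components of the stress balance are scalar equations for those of a, with
coefficients 2μ + λ and μ, both at least m. -/
theorem norm_jump_gradient_le {A B : Plane →L[ℝ] Plane} {μA μB lA lB pA pB m L K w : ℝ}
    (b : OrthonormalBasis (Fin 2) ℝ Plane) (htan : A (b 1) = B (b 1))
    (hstress : ∀ e, inner ℝ (b 0) ((2 * μA) • symOf A e + (lA * divOf A) • e - pA • e)
      = inner ℝ (b 0) ((2 * μB) • symOf B e + (lB * divOf B) • e - pB • e))
    (hm : 0 < m) (hμ : m ≤ μA) (hl : 0 ≤ lA) (hL : ‖B‖ ≤ L) (hp : |pA - pB| ≤ K * w)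
    (hμK : |μA - μB| ≤ K * w) (hlK : |lA - lB| ≤ K * w) :
    ‖A - B‖ ≤ 5 * K / m * w * (1 + L) := by
  have hL0 : 0 ≤ L := (norm_nonneg _).trans hL
  have hKw : 0 ≤ K * w := (abs_nonneg _).trans hp
  have hent : ∀ i j, |inner ℝ (b i) (B (b j))| ≤ L := fun i j => by
    refine (abs_real_inner_le_norm _ _).trans ?_
    have := B.le_opNorm (b j)
    simp only [OrthonormalBasis.norm_eq_one, mul_one, one_mul] at this ⊢
    exact this.trans hL
  set a := (A - B) (b 0) with ha
  have h0 := hstress (b 0)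
  have h1 := hstress (b 1)
  simp only [inner_add_right, inner_sub_right, inner_smul_right, inner_symOf,
    OrthonormalBasis.inner_eq_one, mul_one,
    b.inner_eq_zero (show (0 : Fin 2) ≠ 1 by decide), mul_zero, add_zero, sub_zero] at h0 h1
  have hA := divOf_eq_sum A b
  have hB := divOf_eq_sum B b
  rw [htan] at hA h1
  have ea : ∀ i, inner ℝ (b i) (A (b 0)) = inner ℝ (b i) a + inner ℝ (b i) (B (b 0)) := by
    intro i
    simp [ha, inner_sub_right]
  rw [ea] at h0 h1 hA
  rw [hA, hB] at h0
  set a0 := inner ℝ (b 0) a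
  set a1 := inner ℝ (b 1) a
  set B00 := inner ℝ (b 0) (B (b 0))
  set B01 := inner ℝ (b 0) (B (b 1))
  set B10 := inner ℝ (b 1) (B (b 0))
  set B11 := inner ℝ (b 1) (B (b 1))
  have e0 : (2 * μA + lA) * a0
      = (pA - pB) - 2 * (μA - μB) * B00 - (lA - lB) * (B00 + B11) := by
    linear_combination h0
  have e1 : μA * a1 = -((μA - μB) * (B01 + B10)) := by
    linear_combination h1
  have prod : ∀ x y : ℝ, |x| ≤ K * w → |y| ≤ L → |x * y| ≤ K * w * L := fun x y hx hy => by
    rw [abs_mul]; exact mul_le_mul hx hy (abs_nonneg _) hKw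
  have b0 : m * |a0| ≤ 2 * (K * w * (1 + L)) := by
    have hpos : 0 < 2 * μA + lA := by linarith
    have : (2 * μA + lA) * |a0| ≤ K * w + 4 * (K * w * L) := by
      rw [show (2 * μA + lA) * |a0| = |(2 * μA + lA) * a0| by rw [abs_mul, abs_of_pos hpos], e0]
      have q1 := prod _ _ hμK (hent 0 0)
      have q2 := prod _ _ hlK (hent 0 0)
      have q3 := prod _ _ hlK (hent 1 1)
      have q1 := abs_le.1 q1
      have q2 := abs_le.1 q2
      have q3 := abs_le.1 q3
      have q4 := abs_le.1 hp
      rw [abs_le]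
      constructor
      · linarith [q1.1, q1.2, q2.1, q2.2, q3.1, q3.2, q4.1, q4.2]
      · linarith [q1.1, q1.2, q2.1, q2.2, q3.1, q3.2, q4.1, q4.2]
    have h2 : 2 * (m * |a0|) ≤ (2 * μA + lA) * |a0| := by
      have := abs_nonneg a0
      nlinarith
    have : 0 ≤ K * w * L := by positivity
    nlinarith
  have b1 : m * |a1| ≤ 2 * (K * w * (1 + L)) := by
    have hpos : 0 < μA := by linarith
    have : μA * |a1| ≤ 2 * (K * w * L) := by
      rw [show μA * |a1| = |μA * a1| by rw [abs_mul, abs_of_pos hpos], e1]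
      have q1 := abs_le.1 (prod _ _ hμK (hent 0 1))
      have q2 := abs_le.1 (prod _ _ hμK (hent 1 0))
      rw [abs_le]
      constructor
      · linarith [q1.1, q1.2, q2.1, q2.2]
      · linarith [q1.1, q1.2, q2.1, q2.2]
    have h2 : m * |a1| ≤ μA * |a1| := by gcongr
    nlinarith
  have hna : ‖a‖ ≤ |a0| + |a1| := by
    have hs := b.sum_repr' a
    rw [Fin.sum_univ_two] at hs
    rw [← hs]
    refine (norm_add_le _ _).trans ?_
    simp [norm_smul, a0, a1]
  have hop : ‖A - B‖ ≤ ‖a‖ := by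
    refine ContinuousLinearMap.opNorm_le_bound _ (norm_nonneg _) fun v => ?_
    have hs := b.sum_repr' v
    rw [Fin.sum_univ_two] at hs
    have : (A - B) v = inner ℝ (b 0) v • a := by
      conv_lhs => rw [← hs]
      have : (A - B) (b 1) = 0 := by simp [htan]
      rw [map_add, map_smul, map_smul, this, smul_zero, add_zero]
    rw [this, norm_smul, mul_comm]
    gcongr
    have := abs_real_inner_le_norm (b 0) v
    simpa using this
  -- Each component of a contributes at most 2 K w (1 + L); the sum 4 is rounded up to 5.
  have hfin : m * ‖A - B‖ ≤ 5 * K * w * (1 + L) := by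
    have : m * ‖A - B‖ ≤ m * (|a0| + |a1|) := by gcongr; exact hop.trans hna
    have h3 : 0 ≤ K * w * (1 + L) := by positivity
    nlinarith
  have : 5 * K / m * w * (1 + L) = (5 * K * w * (1 + L)) / m := by ring
  rw [this, le_div_iff₀ hm, mul_comm]
  exact hfin

/-! ### Mollification -/

theorem fderiv_comp_sub_left {H : Type*} [NormedAddCommGroup H] [NormedSpace ℝ H] {k : H → ℝ}
    (hk : Differentiable ℝ k) (z w v : H) :
    fderiv ℝ (fun w => k (z - w)) w v = -fderiv ℝ k (z - w) v := by
  have h : HasFDerivAt (fun w => k (z - w))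
      ((fderiv ℝ k (z - w)).comp (-ContinuousLinearMap.id ℝ H)) w := by
    refine (hk (z - w)).hasFDerivAt.comp w ?_
    simpa using (hasFDerivAt_id w).const_sub z
  rw [h.fderiv]
  simp

theorem hasCompactSupport_comp_sub_left {H : Type*} [NormedAddCommGroup H] {k : H → ℝ}
    (hk : HasCompactSupport k) (z : H) :
    HasCompactSupport fun w => k (z - w) :=
  hk.comp_homeomorph (Homeomorph.subLeft z)

section Mollification

variable {H F : Type*} [NormedAddCommGroup H] [NormedSpace ℝ H] [FiniteDimensional ℝ H]
  [MeasurableSpace H] [BorelSpace H] [NormedAddCommGroup F] [NormedSpace ℝ F]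
  {ν : Measure H} [ν.IsAddHaarMeasure]

/-- A bump function of radius `ε` at the origin. -/
noncomputable def stdBump (H : Type*) [NormedAddCommGroup H] [NormedSpace ℝ H]
    [FiniteDimensional ℝ H] (ε : ℝ) (hε : 0 < ε) : ContDiffBump (0 : H) :=
  ⟨ε / 2, ε, half_pos hε, half_lt_self hε⟩

theorem convolution_eq_integral_sub [CompleteSpace F] (k : H → ℝ) (m : H → F) (z : H) :
    MeasureTheory.convolution k m (ContinuousLinearMap.lsmul ℝ ℝ) ν z
      = ∫ w, k (z - w) • m w ∂ν := by
  rw [convolution_lsmul_swap]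

theorem fderiv_convolution_apply [CompleteSpace F] {k : H → ℝ} (hk : ContDiff ℝ 1 k)
    (hkc : HasCompactSupport k) {m : H → F} (hm : LocallyIntegrable m ν) (z v : H) :
    fderiv ℝ (MeasureTheory.convolution k m (ContinuousLinearMap.lsmul ℝ ℝ) ν) z v
      = ∫ w, fderiv ℝ k (z - w) v • m w ∂ν := by
  rw [(hkc.hasFDerivAt_convolution_left (ContinuousLinearMap.lsmul ℝ ℝ) hk hm z).fderiv]
  have hex := (hkc.fderiv ℝ).convolutionExists_left
    ((ContinuousLinearMap.lsmul ℝ ℝ : ℝ →L[ℝ] F →L[ℝ] F).precompL H)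
    (hk.continuous_fderiv one_ne_zero) hm z
  rw [convolution_eq_swap, ContinuousLinearMap.integral_apply hex.integrable_swap]
  simp

theorem tsupport_comp_sub_left_subset (k : ContDiffBump (0 : H)) (z : H) :
    tsupport (fun w => k.normed ν (z - w)) ⊆ Metric.closedBall z k.rOut := by
  refine closure_minimal (fun w hw => ?_) Metric.isClosed_closedBall
  have : z - w ∈ Function.support (k.normed ν) := hw
  rw [k.support_normed_eq] at this
  simp only [Metric.mem_ball, dist_zero_right] at this
  rw [Metric.mem_closedBall, dist_comm, dist_eq_norm]
  exact this.le

end Mollification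

/-! ### Primitives in the sense of distributions -/

/-- Subtracting a primitive of Q reduces the claim to a continuous function with zero distributional
derivative. Its mollifications are constant on each compact subinterval, hence so is the function,
and continuity reaches the endpoints. -/
theorem sub_eq_integral_of_forall_test {R Q : ℝ → ℝ} {T : ℝ} (hT : 0 < T)
    (hR : ContinuousOn R (Icc 0 T)) (hQ : IntervalIntegrable Q volume 0 T)
    (h : ∀ θ : ℝ → ℝ, ContDiff ℝ ((⊤ : ℕ∞) : WithTop ℕ∞) θ → HasCompactSupport θ →
      tsupport θ ⊆ Ioo 0 T → ∫ t in Ioo 0 T, (deriv θ t * R t + θ t * Q t) = 0) :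
    ∀ t ∈ Icc 0 T, R t - R 0 = ∫ τ in (0 : ℝ)..t, Q τ := by
  set A : ℝ → ℝ := fun t => ∫ τ in (0 : ℝ)..t, Q τ with hA
  have hAac : AbsolutelyContinuousOnInterval A 0 T :=
    hQ.absolutelyContinuousOnInterval_intervalIntegral left_mem_uIcc
  have hAc : ContinuousOn A (Icc 0 T) := by
    have := hAac.continuousOn
    rwa [uIcc_of_le hT.le] at this
  set S : ℝ → ℝ := fun t => R t - A t with hS
  have hSc : ContinuousOn S (Icc 0 T) := hR.sub hAc
  have key : ∀ θ : ℝ → ℝ, ContDiff ℝ ((⊤ : ℕ∞) : WithTop ℕ∞) θ → HasCompactSupport θ →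
      tsupport θ ⊆ Ioo 0 T → ∫ t in Ioo 0 T, deriv θ t * S t = 0 := by
    intro θ hθ hθc hθs
    have hθac : AbsolutelyContinuousOnInterval θ 0 T :=
      (hθ.of_le (by exact_mod_cast le_top)).contDiffOn.absolutelyContinuousOnInterval
    have hparts := hθac.integral_mul_deriv_eq_deriv_mul hAac
    have h0 : θ 0 = 0 := by
      by_contra hne
      exact absurd (hθs (subset_tsupport _ hne)).1 (lt_irrefl _)
    have h1 : θ T = 0 := by
      by_contra hne
      exact absurd (hθs (subset_tsupport _ hne)).2 (lt_irrefl _)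
    rw [h0, h1] at hparts
    have hQA : ∫ x in (0 : ℝ)..T, θ x * deriv A x = ∫ x in (0 : ℝ)..T, θ x * Q x := by
      refine intervalIntegral.integral_congr_ae ?_
      filter_upwards [hQ.ae_hasDerivAt_integral] with x hx hx'
      rw [(hx (uIoc_subset_uIcc hx') 0 left_mem_uIcc).deriv]
    have hd : Continuous (deriv θ) := hθ.continuous_deriv (by exact_mod_cast le_top)
    have i1 : IntervalIntegrable (fun t => deriv θ t * R t) volume 0 T := by
      refine ContinuousOn.intervalIntegrable ?_
      rw [uIcc_of_le hT.le]
      exact hd.continuousOn.mul hR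
    have i2 : IntervalIntegrable (fun t => deriv θ t * A t) volume 0 T :=
      (hd.continuousOn.mul hAac.continuousOn).intervalIntegrable
    have i3 : IntervalIntegrable (fun t => θ t * Q t) volume 0 T :=
      hQ.continuousOn_mul hθ.continuous.continuousOn
    have h2 := h θ hθ hθc hθs
    rw [← integral_Ioc_eq_integral_Ioo, ← intervalIntegral.integral_of_le hT.le,
      intervalIntegral.integral_add i1 i3] at h2
    rw [← integral_Ioc_eq_integral_Ioo, ← intervalIntegral.integral_of_le hT.le]
    have : ∀ t, deriv θ t * S t = deriv θ t * R t - deriv θ t * A t := fun t => by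
      simp only [hS]; ring
    simp only [this]
    rw [intervalIntegral.integral_sub i1 i2]
    rw [hQA] at hparts
    linarith
  -- a global continuous extension, and its mollification
  set S' : ℝ → ℝ := fun t => S (projIcc 0 T hT.le t) with hS'
  have hS'c : Continuous S' :=
    (continuousOn_iff_continuous_domRestrict.1 hSc).comp continuous_projIcc
  have hS'eq : ∀ t ∈ Icc 0 T, S' t = S t := fun t ht => by simp [hS', projIcc_of_mem hT.le ht]
  have hconst : ∀ s ∈ Ioo 0 T, ∀ t ∈ Ioo 0 T, s ≤ t → S s = S t := by
    intro s hs t ht hst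
    obtain ⟨ε₀, hε₀, hs0, ht0⟩ : ∃ ε₀ > 0, ε₀ < s ∧ ε₀ < T - t :=
      ⟨min s (T - t) / 2, half_pos (lt_min hs.1 (sub_pos.2 ht.2)),
        (half_lt_self (lt_min hs.1 (sub_pos.2 ht.2))).trans_le (min_le_left _ _),
        (half_lt_self (lt_min hs.1 (sub_pos.2 ht.2))).trans_le (min_le_right _ _)⟩
    -- The radii stay below the distance of `[s, t]` to the ends of `(0, T)`, so every translated
    -- kernel is an admissible test function.
    let φ : ℕ → ContDiffBump (0 : ℝ) := fun n => stdBump ℝ (ε₀ / (n + 1)) (by positivity)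
    have hφ : Tendsto (fun n => (φ n).rOut) atTop (𝓝 0) := by
      simpa [φ, stdBump, div_eq_mul_inv] using
        (tendsto_one_div_add_atTop_nhds_zero_nat (𝕜 := ℝ)).const_mul ε₀
    have hφle : ∀ n, (φ n).rOut ≤ ε₀ := fun n => by
      simp only [φ, stdBump]
      exact div_le_self hε₀.le (by linarith [(Nat.cast_nonneg n : (0:ℝ) ≤ n)])
    let Sn : ℕ → ℝ → ℝ := fun n =>
      MeasureTheory.convolution ((φ n).normed volume) S' (ContinuousLinearMap.lsmul ℝ ℝ) volume
    have hlim : ∀ x, Tendsto (fun n => Sn n x) atTop (𝓝 (S' x)) := fun x =>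
      ContDiffBump.convolution_tendsto_right_of_continuous hφ hS'c x
    have hder : ∀ n, ∀ x ∈ Icc s t, HasDerivAt (Sn n) 0 x := by
      intro n x hx
      have hd := (φ n).hasCompactSupport_normed (μ := volume) |>.hasDerivAt_convolution_left
        (ContinuousLinearMap.lsmul ℝ ℝ) ((φ n).contDiff_normed (n := 1))
        (hS'c.locallyIntegrable (μ := volume)) x
      rw [convolution_lsmul_swap] at hd
      set θ : ℝ → ℝ := fun τ => (φ n).normed volume (x - τ) with hθ
      have hθ1 : ContDiff ℝ ((⊤ : ℕ∞) : WithTop ℕ∞) θ :=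
        (φ n).contDiff_normed.comp (contDiff_const.sub contDiff_id)
      have hsub : tsupport θ ⊆ Ioo 0 T := by
        refine (tsupport_comp_sub_left_subset (φ n) x).trans fun τ hτ => ?_
        rw [Real.closedBall_eq_Icc] at hτ
        have := hφle n
        constructor <;> linarith [hτ.1, hτ.2, hx.1, hx.2]
      have hk := key θ hθ1
        (hasCompactSupport_comp_sub_left (φ n).hasCompactSupport_normed x) hsub
      have hdθ : ∀ τ, deriv θ τ = -deriv ((φ n).normed volume) (x - τ) := fun τ => by
        simp only [hθ]; rw [deriv_comp_const_sub]
      have hz : ∀ τ, τ ∉ Ioo 0 T → deriv θ τ = 0 := fun τ hτ => by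
        by_contra hne
        exact hτ (hsub (support_deriv_subset hne))
      have : ∫ τ, deriv ((φ n).normed volume) (x - τ) • S' τ
          = -∫ τ in Ioo 0 T, deriv θ τ * S τ := by
        rw [← integral_neg, ← integral_indicator measurableSet_Ioo]
        refine integral_congr_ae (Eventually.of_forall fun τ => ?_)
        by_cases hτ : τ ∈ Ioo 0 T
        · simp only [indicator_of_mem hτ, hS'eq τ (Ioo_subset_Icc_self hτ), hdθ, smul_eq_mul]
          ring
        · have h0 := hz τ hτ
          rw [hdθ, neg_eq_zero] at h0
          simp [indicator_of_notMem hτ, h0]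
      rw [this, hk, neg_zero] at hd
      exact hd
    have heq : ∀ n, Sn n t = Sn n s := fun n =>
      constant_of_has_deriv_right_zero
        (fun x hx => (hder n x hx).continuousAt.continuousWithinAt)
        (fun x hx => (hder n x (Ico_subset_Icc_self hx)).hasDerivWithinAt) t ⟨hst, le_rfl⟩
    have h1 := hlim s
    have h2 := hlim t
    simp only [heq] at h2
    have := tendsto_nhds_unique h1 h2
    rwa [hS'eq s (Ioo_subset_Icc_self hs), hS'eq t (Ioo_subset_Icc_self ht)] at this
  have hmid : T / 2 ∈ Ioo 0 T := ⟨by linarith, by linarith⟩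
  have hIoo : EqOn S (fun _ => S (T / 2)) (Ioo 0 T) := fun s hs => by
    rcases le_total s (T / 2) with h' | h'
    · exact hconst s hs _ hmid h'
    · exact (hconst _ hmid s hs h').symm
  have hIcc : EqOn S (fun _ => S (T / 2)) (Icc 0 T) :=
    hIoo.of_subset_closure hSc continuousOn_const Ioo_subset_Icc_self
      (by rw [closure_Ioo hT.ne])
  intro t ht
  have h0 := hIcc (left_mem_Icc.2 hT.le)
  have h1 := hIcc ht
  have hA0 : A 0 = 0 := by simp [hA]
  simp only [hS] at h0 h1
  have : R t - A t = R 0 - A 0 := by rw [h0, h1]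
  rw [hA0] at this
  change _ = A t
  linarith

/-! ### Weak gradients -/

/-- Testing with a translated kernel shows that the derivative of a mollification of w is the
mollification of G, hence bounded by L. The mean value inequality on the whole plane applies across
the interface, and the Lipschitz bound survives the pointwise limit. -/
theorem IsWeakGradient.norm_sub_le {w : Plane → Plane} {G : Plane → Plane →L[ℝ] Plane} {L : ℝ}
    (h : IsWeakGradient w G) (hw : Continuous w) (hL : ∀ᵐ x, ‖G x‖ ≤ L)
    (x y : Plane) : ‖w x - w y‖ ≤ L * ‖x - y‖ := by
  let φ : ℕ → ContDiffBump (0 : Plane) := fun n => stdBump Plane (1 / (n + 1)) (by positivity)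
  have hφ : Tendsto (fun n => (φ n).rOut) atTop (𝓝 0) := by
    simpa [φ, stdBump] using tendsto_one_div_add_atTop_nhds_zero_nat (𝕜 := ℝ)
  let wn : ℕ → Plane → Plane := fun n =>
    MeasureTheory.convolution ((φ n).normed volume) w (ContinuousLinearMap.lsmul ℝ ℝ) volume
  have hlim : ∀ x, Tendsto (fun n => wn n x) atTop (𝓝 (w x)) := fun x =>
    ContDiffBump.convolution_tendsto_right_of_continuous hφ hw x
  have hd1 : ∀ n, Differentiable ℝ ((φ n).normed volume) := fun n =>
    ((φ n).contDiff_normed (n := 1)).differentiable one_ne_zero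
  have hbound : ∀ n z, ‖fderiv ℝ (wn n) z‖ ≤ L := by
    intro n z
    have hL0 : 0 ≤ L := by
      obtain ⟨x, hx⟩ := hL.exists
      exact (norm_nonneg _).trans hx
    refine ContinuousLinearMap.opNorm_le_bound _ hL0 fun v => ?_
    rw [fderiv_convolution_apply ((φ n).contDiff_normed (n := 1))
      (φ n).hasCompactSupport_normed hw.locallyIntegrable]
    have hη : ContDiff ℝ ((⊤ : ℕ∞) : WithTop ℕ∞) fun x => (φ n).normed volume (z - x) :=
      (φ n).contDiff_normed.comp (contDiff_const.sub contDiff_id)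
    have hh := h _ hη (hasCompactSupport_comp_sub_left (φ n).hasCompactSupport_normed z) v
    simp only [fderiv_comp_sub_left (hd1 n), neg_smul, integral_neg, neg_neg] at hh
    rw [← hh]
    have hint : Integrable fun x => (φ n).normed volume (z - x) :=
      (φ n).integrable_normed.comp_sub_left z
    calc ‖∫ x, (φ n).normed volume (z - x) • G x v‖
        ≤ ∫ x, (φ n).normed volume (z - x) * (L * ‖v‖) := by
          refine norm_integral_le_of_norm_le (hint.mul_const _) ?_
          filter_upwards [hL] with x hx
          rw [norm_smul, Real.norm_of_nonneg ((φ n).nonneg_normed _)]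
          have := (φ n).nonneg_normed (μ := volume) (z - x)
          gcongr
          exact (G x).le_of_opNorm_le hx v
      _ = L * ‖v‖ := by
          rw [integral_mul_const, integral_sub_left_eq_self (fun x => (φ n).normed volume x),
            (φ n).integral_normed, one_mul]
  have hlip : ∀ n, ‖wn n x - wn n y‖ ≤ L * ‖x - y‖ := fun n => by
    have hdiff : Differentiable ℝ (wn n) := fun z =>
      ((φ n).hasCompactSupport_normed.hasFDerivAt_convolution_left
        (ContinuousLinearMap.lsmul ℝ ℝ) ((φ n).contDiff_normed (n := 1))
        hw.locallyIntegrable z).differentiableAt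
    exact convex_univ.norm_image_sub_le_of_norm_fderiv_le (𝕜 := ℝ) (fun z _ => hdiff z)
      (fun z _ => hbound n z) (mem_univ y) (mem_univ x)
  exact le_of_tendsto ((hlim x).sub (hlim y)).norm (Eventually.of_forall hlip)

theorem integral_comp_add_smul {F : Type*} [NormedAddCommGroup F] [NormedSpace ℝ F]
    (f : Plane → F) (c : Plane) {r : ℝ} (hr : 0 < r) :
    ∫ x, f (r⁻¹ • (x - c)) = r ^ 2 • ∫ y, f y := by
  rw [integral_sub_right_eq_self (fun x => f (r⁻¹ • x)) c,
    Measure.integral_comp_inv_smul_of_nonneg volume f hr.le]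
  simp

theorem smul_integral_comp {F : Type*} [NormedAddCommGroup F] [NormedSpace ℝ F]
    (f : Plane → F) (c : Plane) {r : ℝ} (hr : 0 < r) :
    ∫ x, f x = r ^ 2 • ∫ y, f (c + r • y) := by
  rw [← integral_comp_add_smul (fun y => f (c + r • y)) c hr]
  congr 1
  ext x
  rw [smul_smul, mul_inv_cancel₀ hr.ne', one_smul, add_sub_cancel]

theorem fderiv_comp_inv_smul_sub {η : Plane → ℝ} (hη : Differentiable ℝ η) (c : Plane) (r : ℝ)
    (x v : Plane) :
    fderiv ℝ (fun x => η (r⁻¹ • (x - c))) x v = r⁻¹ * fderiv ℝ η (r⁻¹ • (x - c)) v := by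
  have h : HasFDerivAt (fun x => η (r⁻¹ • (x - c)))
      ((fderiv ℝ η (r⁻¹ • (x - c))).comp (r⁻¹ • ContinuousLinearMap.id ℝ Plane)) x := by
    refine (hη _).hasFDerivAt.comp x ?_
    exact ((hasFDerivAt_id x).sub_const c).const_smul r⁻¹
  rw [h.fderiv]
  simp

theorem hasCompactSupport_comp_inv_smul_sub {η : Plane → ℝ} (hη : HasCompactSupport η)
    (c : Plane) {r : ℝ} (hr : 0 < r) : HasCompactSupport fun x => η (r⁻¹ • (x - c)) := by
  have := hη.comp_homeomorph
    ((Homeomorph.subRight c).trans (Homeomorph.smulOfNeZero r⁻¹ (inv_ne_zero hr.ne')))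
  exact this

theorem inv_smul_add_smul_sub (c y : Plane) {r : ℝ} (hr : 0 < r) :
    r⁻¹ • (c + r • y - c) = y := by
  rw [add_sub_cancel_left, smul_smul, inv_mul_cancel₀ hr.ne', one_smul]

/-- The weak gradient relation in blown-up variables. -/
theorem IsWeakGradient.integral_comp_add_smul {w : Plane → Plane}
    {G : Plane → Plane →L[ℝ] Plane} (h : IsWeakGradient w G) {η : Plane → ℝ}
    (hη : ContDiff ℝ ((⊤ : ℕ∞) : WithTop ℕ∞) η) (hηc : HasCompactSupport η) (c v : Plane)
    {r : ℝ} (hr : 0 < r) :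
    ∫ y, η y • G (c + r • y) v = -(r⁻¹ • ∫ y, fderiv ℝ η y v • w (c + r • y)) := by
  have hd : Differentiable ℝ η := hη.differentiable (by simp)
  have h1 := h (fun x => η (r⁻¹ • (x - c)))
    (hη.comp ((contDiff_id.sub contDiff_const).const_smul r⁻¹))
    (hasCompactSupport_comp_inv_smul_sub hηc c hr) v
  rw [smul_integral_comp _ c hr, smul_integral_comp (fun x => _ • w x) c hr] at h1
  simp only [fderiv_comp_inv_smul_sub hd, inv_smul_add_smul_sub _ _ hr, mul_smul,
    integral_smul] at h1
  rw [← smul_neg] at h1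
  exact smul_right_injective _ (pow_ne_zero 2 hr.ne') h1

/-! ### Traces on an interface -/

theorem continuousOn_of_eHolderNorm_lt_top {F : Type*} [NormedAddCommGroup F] {α : ℝ≥0}
    (hα : 0 < α) {S : Set Plane} {g : Plane → F} (hg : eHolderNorm α (S.domRestrict g) < ∞) :
    UniformContinuousOn g S := by
  obtain ⟨C, hC⟩ := eHolderNorm_lt_top.1 hg
  exact uniformContinuousOn_iff_restrict.2 (hC.uniformContinuous hα)

/-- A uniformly continuous map with complete target has limits at closure points. These are the
traces on the two sides of the interface. -/
theorem exists_tendsto_of_eHolderNorm_lt_top {F : Type*} [NormedAddCommGroup F]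
    [CompleteSpace F] {α : ℝ≥0} (hα : 0 < α) {S : Set Plane} {g : Plane → F}
    (hg : eHolderNorm α (S.domRestrict g) < ∞) {σ : Plane} (hσ : σ ∈ closure S) :
    ∃ l, Tendsto g (𝓝[S] σ) (𝓝 l) := by
  have hu := continuousOn_of_eHolderNorm_lt_top hα hg
  have : (𝓝[S] σ).NeBot := mem_closure_iff_nhdsWithin_neBot.1 hσ
  rw [← cauchy_map_iff_exists_tendsto, Metric.cauchy_iff]
  refine ⟨inferInstance, fun ε hε => ?_⟩
  obtain ⟨δ, hδ, h⟩ := Metric.uniformContinuousOn_iff.1 hu ε hε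
  refine ⟨g '' (S ∩ Metric.ball σ (δ / 2)), image_mem_map
    (inter_mem self_mem_nhdsWithin
      (mem_nhdsWithin_of_mem_nhds (Metric.ball_mem_nhds _ (half_pos hδ)))), ?_⟩
  rintro _ ⟨x, hx, rfl⟩ _ ⟨y, hy, rfl⟩
  refine h x hx.1 y hy.1 ?_
  have h1 : dist x σ < δ / 2 := hx.2
  have h2 : dist y σ < δ / 2 := hy.2
  linarith [dist_triangle_right x y σ]

/-- Nonempty open sets have positive measure, so an a.e. bound holds at every point of continuity.
This permits evaluating ∇u along a single particle path, which is a null set in space-time. -/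
theorem norm_le_of_continuousOn_of_ae {F : Type*} [NormedAddCommGroup F] {S : Set Plane}
    (hS : IsOpen S) {g : Plane → F} (hg : ContinuousOn g S) {L : ℝ} (hL : ∀ᵐ x, ‖g x‖ ≤ L)
    {x : Plane} (hx : x ∈ S) : ‖g x‖ ≤ L := by
  by_contra hlt
  push Not at hlt
  have hc : ContinuousAt (fun x => ‖g x‖) x := (hg.continuousAt (hS.mem_nhds hx)).norm
  have hev : ∀ᶠ y in 𝓝 x, L < ‖g y‖ := hc.eventually (lt_mem_nhds hlt)
  obtain ⟨U, hU, hUo, hxU⟩ := eventually_nhds_iff.1 hev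
  have hpos : 0 < volume U := hUo.measure_pos volume ⟨x, hxU⟩
  have hz : volume U = 0 := by
    refine measure_mono_null (fun y hy => ?_) (ae_iff.1 hL)
    simpa using hU y hy
  exact hpos.ne' hz

theorem jump_eq {F : Type*} [NormedAddCommGroup F] {D : Set Plane} {n : Plane → Plane}
    {σ : Plane} {g : Plane → F} {p q : F}
    (hin : ∀ᶠ r in 𝓝[>] (0 : ℝ), σ - r • n σ ∈ D)
    (hout : ∀ᶠ r in 𝓝[>] (0 : ℝ), σ + r • n σ ∈ (closure D)ᶜ)
    (hp : Tendsto g (𝓝[D] σ) (𝓝 p)) (hq : Tendsto g (𝓝[(closure D)ᶜ] σ) (𝓝 q)) :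
    jump n g σ = q - p := by
  have hz : Tendsto (fun r : ℝ => r • n σ) (𝓝[>] 0) (𝓝 0) := by
    have : Tendsto (fun r : ℝ => r • n σ) (𝓝 0) (𝓝 ((0 : ℝ) • n σ)) :=
      (continuous_id.smul continuous_const).tendsto 0
    rw [zero_smul] at this
    exact this.mono_left nhdsWithin_le_nhds
  have h1 : Tendsto (fun r : ℝ => σ + r • n σ) (𝓝[>] 0) (𝓝[(closure D)ᶜ] σ) :=
    tendsto_nhdsWithin_iff.2 ⟨by simpa using hz.const_add σ, hout⟩
  have h2 : Tendsto (fun r : ℝ => σ - r • n σ) (𝓝[>] 0) (𝓝[D] σ) :=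
    tendsto_nhdsWithin_iff.2 ⟨by simpa using hz.const_sub σ, hin⟩
  exact ((hq.comp h1).sub (hp.comp h2)).limUnder_eq

/-! ### The two sides of a level-set interface. -/

namespace IsHolderDomain

variable {α : ℝ≥0} {D : Set Plane} {φ : Plane → ℝ} {σ : Plane}

theorem apply_eq_zero (h : IsHolderDomain α D φ) (hσ : σ ∈ frontier D) : φ σ = 0 := by
  rw [h.isOpen.frontier_eq] at hσ
  refine le_antisymm ?_ ?_
  · have := hσ.2
    rw [h.eq_superlevel] at this
    simpa using this
  · have hc : IsClosed {x | 0 ≤ φ x} := isClosed_le continuous_const h.contDiff.continuous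
    have hsub : D ⊆ {x | 0 ≤ φ x} := by
      rw [h.eq_superlevel]; exact fun x (hx : 0 < φ x) => hx.le
    exact closure_minimal hsub hc hσ.1

theorem norm_outwardNormal (h : IsHolderDomain α D φ) (hσ : σ ∈ frontier D) :
    ‖outwardNormal φ σ‖ = 1 := by
  obtain ⟨c, hc, hb⟩ := h.gradient_bound
  have : 0 < ‖gradient φ σ‖ := hc.trans_le (hb σ hσ)
  rw [outwardNormal, norm_neg, norm_smul, norm_inv, norm_norm, inv_mul_cancel₀ this.ne']

/-- As φ vanishes at σ, the quotient tends to the directional derivative ∇φ · y = -|∇φ| n · y. Its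
sign decides on which side a ray leaving σ lies at first. -/
theorem tendsto_slope (h : IsHolderDomain α D φ) (hσ : σ ∈ frontier D) (y : Plane) :
    Tendsto (fun r : ℝ => r⁻¹ * φ (σ + r • y)) (𝓝[>] 0)
      (𝓝 (-(‖gradient φ σ‖ * inner ℝ (outwardNormal φ σ) y))) := by
  obtain ⟨c, hc, hb⟩ := h.gradient_bound
  have hpos : 0 < ‖gradient φ σ‖ := hc.trans_le (hb σ hσ)
  have hd : DifferentiableAt ℝ φ σ := h.contDiff.differentiable one_ne_zero σ
  have hg := hd.hasGradientAt.hasFDerivAt.hasLineDerivAt y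
  have h1 := hasDerivAt_iff_tendsto_slope.1 hg
  have h2 := h1.mono_left (nhdsWithin_mono 0 (fun r (hr : 0 < r) => hr.ne'))
  have e : -(‖gradient φ σ‖ * inner ℝ (outwardNormal φ σ) y)
      = (InnerProductSpace.toDual ℝ Plane) (gradient φ σ) y := by
    rw [outwardNormal, inner_neg_left, inner_smul_left, InnerProductSpace.toDual_apply_apply]
    simp only [conj_trivial]
    field_simp
  rw [e]
  refine h2.congr fun r => ?_
  simp [slope_def_field, h.apply_eq_zero hσ, div_eq_inv_mul]

theorem eventually_mem (h : IsHolderDomain α D φ) (hσ : σ ∈ frontier D) {y : Plane}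
    (hy : inner ℝ (outwardNormal φ σ) y < 0) : ∀ᶠ r in 𝓝[>] (0 : ℝ), σ + r • y ∈ D := by
  obtain ⟨c, hc, hb⟩ := h.gradient_bound
  have hpos : 0 < ‖gradient φ σ‖ := hc.trans_le (hb σ hσ)
  have := (h.tendsto_slope hσ y).eventually (lt_mem_nhds (a := (0 : ℝ))
    (neg_pos.2 (mul_neg_of_pos_of_neg hpos hy)))
  filter_upwards [this, self_mem_nhdsWithin] with r hr (hr0 : 0 < r)
  rw [h.eq_superlevel]
  exact pos_of_mul_pos_right hr (inv_nonneg.2 hr0.le)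

theorem eventually_mem_compl_closure (h : IsHolderDomain α D φ) (hσ : σ ∈ frontier D)
    {y : Plane} (hy : 0 < inner ℝ (outwardNormal φ σ) y) :
    ∀ᶠ r in 𝓝[>] (0 : ℝ), σ + r • y ∈ (closure D)ᶜ := by
  obtain ⟨c, hc, hb⟩ := h.gradient_bound
  have hpos : 0 < ‖gradient φ σ‖ := hc.trans_le (hb σ hσ)
  have := (h.tendsto_slope hσ y).eventually (gt_mem_nhds (a := (0 : ℝ))
    (neg_neg_of_pos (mul_pos hpos hy)))
  filter_upwards [this, self_mem_nhdsWithin] with r hr (hr0 : 0 < r)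
  intro hcl
  have hcc : IsClosed {x | 0 ≤ φ x} := isClosed_le continuous_const h.contDiff.continuous
  have hsub : D ⊆ {x | 0 ≤ φ x} := by
    rw [h.eq_superlevel]; exact fun x (hx : 0 < φ x) => hx.le
  -- On the closure φ is only known to be nonnegative, which is enough because the slope is strictly
  -- negative.
  have h0 : 0 ≤ φ (σ + r • y) := closure_minimal hsub hcc hcl
  have : 0 ≤ r⁻¹ * φ (σ + r • y) := mul_nonneg (inv_nonneg.2 hr0.le) h0
  linarith

theorem jump_eq {F : Type*} [NormedAddCommGroup F] (h : IsHolderDomain α D φ)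
    (hσ : σ ∈ frontier D) {g : Plane → F} {p q : F}
    (hp : Tendsto g (𝓝[D] σ) (𝓝 p)) (hq : Tendsto g (𝓝[(closure D)ᶜ] σ) (𝓝 q)) :
    jump (outwardNormal φ) g σ = q - p := by
  have hn : inner ℝ (outwardNormal φ σ) (outwardNormal φ σ) = (1 : ℝ) := by
    rw [real_inner_self_eq_norm_sq, h.norm_outwardNormal hσ, one_pow]
  refine CompressibleNS.jump_eq (D := D) ?_ ?_ hp hq
  · have := h.eventually_mem hσ (y := -outwardNormal φ σ) (by rw [inner_neg_right, hn]; norm_num)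
    simpa [sub_eq_add_neg] using this
  · exact h.eventually_mem_compl_closure hσ (by rw [hn]; norm_num)

theorem mem_closure_compl_closure (h : IsHolderDomain α D φ) (hσ : σ ∈ frontier D) :
    σ ∈ closure (closure D)ᶜ := by
  have hn : inner ℝ (outwardNormal φ σ) (outwardNormal φ σ) = (1 : ℝ) := by
    rw [real_inner_self_eq_norm_sq, h.norm_outwardNormal hσ, one_pow]
  have h1 := h.eventually_mem_compl_closure hσ (y := outwardNormal φ σ) (by rw [hn]; norm_num)
  have hz : Tendsto (fun r : ℝ => σ + r • outwardNormal φ σ) (𝓝[>] 0) (𝓝 σ) := by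
    have : Tendsto (fun r : ℝ => σ + r • outwardNormal φ σ) (𝓝 0)
        (𝓝 (σ + (0 : ℝ) • outwardNormal φ σ)) :=
      (continuous_const.add (continuous_id.smul continuous_const)).tendsto 0
    rw [zero_smul, add_zero] at this
    exact this.mono_left nhdsWithin_le_nhds
  exact mem_closure_of_tendsto hz h1

end IsHolderDomain

/-! ### Blow-up at an interface -/

theorem quasiMeasurePreserving_add_smul (σ : Plane) {r : ℝ} (hr : r ≠ 0) :
    Measure.QuasiMeasurePreserving (fun y : Plane => σ + r • y) volume volume :=
  (measurePreserving_add_left volume σ).quasiMeasurePreserving.comp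
    (Measure.quasiMeasurePreserving_smul volume hr)

theorem ae_inner_ne_zero {n : Plane} (hn : n ≠ 0) : ∀ᵐ y : Plane, inner ℝ n y ≠ (0 : ℝ) := by
  have h := Measure.addHaar_submodule (volume : Measure Plane)
    (LinearMap.ker (innerSL ℝ n : Plane →ₗ[ℝ] ℝ)) (by
      intro htop
      have : n ∈ LinearMap.ker (innerSL ℝ n : Plane →ₗ[ℝ] ℝ) := htop ▸ Submodule.mem_top
      simp only [LinearMap.mem_ker, ContinuousLinearMap.coe_coe, innerSL_apply_apply,
        inner_self_eq_zero] at this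
      exact hn this)
  rw [ae_iff]
  convert h using 2
  ext y
  simp

/-- Every y off the null line n · y = 0 gives a ray that stays on one side for small r. So the
rescaled functions converge a.e. to one with value p on one half-plane and q on the other, and the
bound on f dominates. -/
theorem tendsto_integral_blowup {F : Type*} [NormedAddCommGroup F] [NormedSpace ℝ F]
    {f : Plane → F} {D : Set Plane} {σ n : Plane} (hn : n ≠ 0) {C : ℝ} {p q : F}
    (hf : AEStronglyMeasurable f volume) (hC : ∀ᵐ x, ‖f x‖ ≤ C)
    (hin : ∀ y, inner ℝ n y < (0 : ℝ) → ∀ᶠ r in 𝓝[>] (0 : ℝ), σ + r • y ∈ D)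
    (hout : ∀ y, (0 : ℝ) < inner ℝ n y → ∀ᶠ r in 𝓝[>] (0 : ℝ), σ + r • y ∈ (closure D)ᶜ)
    (hp : Tendsto f (𝓝[D] σ) (𝓝 p)) (hq : Tendsto f (𝓝[(closure D)ᶜ] σ) (𝓝 q))
    {ζ : Plane → ℝ} (hζ : Continuous ζ) (hζc : HasCompactSupport ζ) :
    Tendsto (fun r : ℝ => ∫ y, ζ y • f (σ + r • y)) (𝓝[>] 0)
      (𝓝 (∫ y, ζ y • if inner ℝ n y < (0 : ℝ) then p else q)) := by
  have hz : ∀ y : Plane, Tendsto (fun r : ℝ => σ + r • y) (𝓝[>] 0) (𝓝 σ) := fun y => by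
    have : Tendsto (fun r : ℝ => σ + r • y) (𝓝 0) (𝓝 (σ + (0 : ℝ) • y)) :=
      (continuous_const.add (continuous_id.smul continuous_const)).tendsto 0
    rw [zero_smul, add_zero] at this
    exact this.mono_left nhdsWithin_le_nhds
  refine tendsto_integral_filter_of_dominated_convergence (fun y => ‖ζ y‖ * C) ?_ ?_ ?_ ?_
  · filter_upwards [self_mem_nhdsWithin] with r (hr : 0 < r)
    exact hζ.aestronglyMeasurable.smul
      (hf.comp_quasiMeasurePreserving (quasiMeasurePreserving_add_smul σ hr.ne'))
  · filter_upwards [self_mem_nhdsWithin] with r (hr : 0 < r)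
    filter_upwards [(quasiMeasurePreserving_add_smul σ hr.ne').ae hC] with y hy
    rw [norm_smul]
    gcongr
  · exact (hζ.integrable_of_hasCompactSupport hζc).norm.mul_const C
  · filter_upwards [ae_inner_ne_zero hn] with y hy
    refine Tendsto.const_smul ?_ _
    rcases lt_or_gt_of_ne hy with h | h
    · rw [if_pos h]
      exact hp.comp (tendsto_nhdsWithin_iff.2 ⟨hz y, hin y h⟩)
    · rw [if_neg (not_lt.2 h.le)]
      exact hq.comp (tendsto_nhdsWithin_iff.2 ⟨hz y, hout y h⟩)

theorem integral_comp_inner_mul_comp_inner (b : OrthonormalBasis (Fin 2) ℝ Plane)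
    (f g : ℝ → ℝ) :
    ∫ y : Plane, f (inner ℝ (b 0) y) * g (inner ℝ (b 1) y) = (∫ s, f s) * ∫ s, g s := by
  have h1 := b.measurePreserving_repr
  have h2 := PiLp.volume_preserving_ofLp (Fin 2)
  have h3 := volume_preserving_finTwoArrow ℝ
  rw [← integral_prod_mul, ← Measure.volume_eq_prod, ← h3.integral_comp' (g := fun z : ℝ × ℝ => f z.1 * g z.2)]
  have e1 := h2.integral_comp (MeasurableEquiv.toLp 2 (Fin 2 → ℝ)).symm.measurableEmbedding
    (fun x : Fin 2 → ℝ => f (x 0) * g (x 1))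
  have e2 := h1.integral_comp b.repr.toHomeomorph.measurableEmbedding
    (fun x : Plane => f (x 0) * g (x 1))
  simp only [b.repr_apply_apply] at e2
  rw [e2]
  exact e1

/-- A test function adapted to a half-plane. -/
theorem exists_test_halfPlane (b : OrthonormalBasis (Fin 2) ℝ Plane) :
    ∃ η : Plane → ℝ, ContDiff ℝ ((⊤ : ℕ∞) : WithTop ℕ∞) η ∧ HasCompactSupport η ∧
      (∀ w, ∫ y in {y : Plane | inner ℝ (b 0) y < (0 : ℝ)}, fderiv ℝ η y w = inner ℝ (b 0) w) ∧
      ∀ w, ∫ y, fderiv ℝ η y w = 0 := by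
  -- The function is η(y) = a(y₀) c(y₁) with a(0) = 1 and ∫ c = 1. Over y₀ < 0 the normal derivative
  -- integrates to a(0) ∫ c = 1 and the tangential one to a multiple of ∫ c' = 0.
  let k : ContDiffBump (0 : ℝ) := stdBump ℝ 1 one_pos
  set a : ℝ → ℝ := fun s => k s with ha
  set c : ℝ → ℝ := k.normed volume with hc
  have hac : ContDiff ℝ ((⊤ : ℕ∞) : WithTop ℕ∞) a := k.contDiff
  have hcc : ContDiff ℝ ((⊤ : ℕ∞) : WithTop ℕ∞) c := k.contDiff_normed
  have hac1 : ContDiff ℝ 1 a := k.contDiff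
  have hcc1 : ContDiff ℝ 1 c := k.contDiff_normed
  have hin : ∀ v : Plane, ContDiff ℝ ((⊤ : ℕ∞) : WithTop ℕ∞) fun y : Plane => (inner ℝ v y : ℝ) :=
    fun v => (innerSL ℝ v).contDiff
  have hd : ∀ y w, fderiv ℝ (fun y => a (inner ℝ (b 0) y) * c (inner ℝ (b 1) y)) y w
      = inner ℝ (b 0) w * (deriv a (inner ℝ (b 0) y) * c (inner ℝ (b 1) y))
        + inner ℝ (b 1) w * (a (inner ℝ (b 0) y) * deriv c (inner ℝ (b 1) y)) := by
    intro y w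
    have h0 : HasFDerivAt (fun y : Plane => (inner ℝ (b 0) y : ℝ)) (innerSL ℝ (b 0)) y :=
      (innerSL ℝ (b 0)).hasFDerivAt
    have h1 : HasFDerivAt (fun y : Plane => (inner ℝ (b 1) y : ℝ)) (innerSL ℝ (b 1)) y :=
      (innerSL ℝ (b 1)).hasFDerivAt
    have ha' := ((hac1.differentiable one_ne_zero _).hasDerivAt (x := inner ℝ (b 0) y)).comp_hasFDerivAt y h0
    have hc' := ((hcc1.differentiable one_ne_zero _).hasDerivAt (x := inner ℝ (b 1) y)).comp_hasFDerivAt y h1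
    have h2 := (ha'.mul hc').fderiv
    have h3 : fderiv ℝ (fun y => a (inner ℝ (b 0) y) * c (inner ℝ (b 1) y)) y = _ := h2
    rw [h3]
    simp
    ring
  have hdac : Continuous (deriv a) := hac1.continuous_deriv le_rfl
  have hdcc : Continuous (deriv c) := hcc1.continuous_deriv le_rfl
  have hsup : HasCompactSupport fun y : Plane => a (inner ℝ (b 0) y) * c (inner ℝ (b 1) y) := by
    refine HasCompactSupport.intro (isCompact_closedBall (0 : Plane) 2) fun y hy => ?_
    by_contra hne
    have ha0 : a (inner ℝ (b 0) y) ≠ 0 := left_ne_zero_of_mul hne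
    have hc0 : c (inner ℝ (b 1) y) ≠ 0 := right_ne_zero_of_mul hne
    have h1 : (inner ℝ (b 0) y : ℝ) ∈ Function.support k := ha0
    have h2 : (inner ℝ (b 1) y : ℝ) ∈ Function.support (k.normed volume) := hc0
    rw [k.support_eq] at h1
    rw [k.support_normed_eq] at h2
    simp only [Metric.mem_ball, dist_zero_right, Real.norm_eq_abs] at h1 h2
    refine hy ?_
    have hs := b.sum_repr' y
    rw [Fin.sum_univ_two] at hs
    rw [mem_closedBall_zero_iff, ← hs]
    refine (norm_add_le _ _).trans ?_
    simp only [norm_smul, OrthonormalBasis.norm_eq_one, mul_one, Real.norm_eq_abs]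
    have hr : k.rOut = 1 := rfl
    rw [hr] at h1 h2
    linarith
  have hci : Integrable c := k.integrable_normed
  have hc1 : ∫ s, c s = 1 := k.integral_normed
  have hkc : HasCompactSupport c := k.hasCompactSupport_normed
  have hka : HasCompactSupport a := k.hasCompactSupport
  have hdc0 : ∫ s, deriv c s = 0 :=
    integral_eq_zero_of_hasDerivAt_of_integrable
      (fun x => (hcc1.differentiable one_ne_zero x).hasDerivAt)
      (hdcc.integrable_of_hasCompactSupport hkc.deriv) hci
  have hda0 : ∫ s, deriv a s = 0 :=
    integral_eq_zero_of_hasDerivAt_of_integrable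
      (fun x => (hac1.differentiable one_ne_zero x).hasDerivAt)
      (hdac.integrable_of_hasCompactSupport hka.deriv)
      (hac.continuous.integrable_of_hasCompactSupport hka)
  have hin' : ∀ v : Plane, Continuous fun y : Plane => (inner ℝ v y : ℝ) := fun v => (hin v).continuous
  have hcs : ∀ f g : ℝ → ℝ, HasCompactSupport f → HasCompactSupport g → Continuous f →
      Continuous g → Integrable fun y : Plane => f (inner ℝ (b 0) y) * g (inner ℝ (b 1) y) := by
    intro f g hf hg hfc hgc
    refine Continuous.integrable_of_hasCompactSupport
      ((hfc.comp (hin' _)).mul (hgc.comp (hin' _))) ?_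
    obtain ⟨R, hR⟩ := hf.isCompact.isBounded.subset_closedBall 0
    obtain ⟨R', hR'⟩ := hg.isCompact.isBounded.subset_closedBall 0
    refine HasCompactSupport.intro (isCompact_closedBall (0 : Plane) (R + R')) fun y hy => ?_
    by_contra hne
    have h1 := hR (subset_tsupport f (left_ne_zero_of_mul hne))
    have h2 := hR' (subset_tsupport g (right_ne_zero_of_mul hne))
    rw [mem_closedBall_zero_iff, Real.norm_eq_abs] at h1 h2
    refine hy ?_
    have hs := b.sum_repr' y
    rw [Fin.sum_univ_two] at hs
    rw [mem_closedBall_zero_iff, ← hs]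
    refine (norm_add_le _ _).trans ?_
    simp only [norm_smul, OrthonormalBasis.norm_eq_one, mul_one, Real.norm_eq_abs]
    linarith
  have I1 := hcs _ _ hka.deriv hkc hdac hcc.continuous
  have I2 := hcs _ _ hka hkc.deriv hac.continuous hdcc
  refine ⟨_, (hac.comp (hin (b 0))).mul (hcc.comp (hin (b 1))), hsup, fun w => ?_, fun w => ?_⟩
  · have hm : MeasurableSet {y : Plane | inner ℝ (b 0) y < (0 : ℝ)} :=
      (isOpen_lt (hin' _) continuous_const).measurableSet
    change ∫ y in {y : Plane | inner ℝ (b 0) y < (0 : ℝ)},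
      fderiv ℝ (fun y => a (inner ℝ (b 0) y) * c (inner ℝ (b 1) y)) y w = _
    simp only [hd]
    rw [integral_add (I1.const_mul _).integrableOn (I2.const_mul _).integrableOn,
      integral_const_mul, integral_const_mul, ← integral_indicator hm, ← integral_indicator hm]
    have hind : ∀ f g : ℝ → ℝ, ({y : Plane | inner ℝ (b 0) y < (0 : ℝ)}).indicator
        (fun y => f (inner ℝ (b 0) y) * g (inner ℝ (b 1) y))
        = fun y => (Iio (0 : ℝ)).indicator f (inner ℝ (b 0) y) * g (inner ℝ (b 1) y) := by
      intro f g
      ext y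
      by_cases hy : (inner ℝ (b 0) y : ℝ) < 0
      · rw [indicator_of_mem (by exact hy), indicator_of_mem (by exact hy)]
      · rw [indicator_of_notMem (by exact hy), indicator_of_notMem (by exact hy), zero_mul]
    rw [hind, hind, integral_comp_inner_mul_comp_inner, integral_comp_inner_mul_comp_inner,
      hc1, hdc0, integral_indicator measurableSet_Iio, ← integral_Iic_eq_integral_Iio,
      hka.integral_Iic_deriv_eq hac1]
    have : a 0 = 1 := k.one_of_mem_closedBall (by simpa using k.rIn_pos.le)
    rw [this]
    ring
  · change ∫ y, fderiv ℝ (fun y => a (inner ℝ (b 0) y) * c (inner ℝ (b 1) y)) y w = _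
    simp only [hd]
    rw [integral_add (I1.const_mul _) (I2.const_mul _), integral_const_mul, integral_const_mul,
      integral_comp_inner_mul_comp_inner, integral_comp_inner_mul_comp_inner, hda0, hdc0]
    ring

theorem integral_halfPlane {F : Type*} [NormedAddCommGroup F] [NormedSpace ℝ F] [CompleteSpace F]
    {b : OrthonormalBasis (Fin 2) ℝ Plane} {η : Plane → ℝ}
    (hη : ContDiff ℝ ((⊤ : ℕ∞) : WithTop ℕ∞) η) (hηc : HasCompactSupport η)
    (h : ∀ w, ∫ y in {y : Plane | inner ℝ (b 0) y < (0 : ℝ)}, fderiv ℝ η y w = inner ℝ (b 0) w)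
    (h0 : ∀ w, ∫ y, fderiv ℝ η y w = 0) (w : Plane) (p q : F) :
    ∫ y, (fderiv ℝ η y w • if inner ℝ (b 0) y < (0 : ℝ) then p else q)
      = (inner ℝ (b 0) w : ℝ) • (p - q) := by
  have hm : MeasurableSet {y : Plane | inner ℝ (b 0) y < (0 : ℝ)} :=
    (isOpen_lt ((innerSL ℝ (b 0)).continuous) continuous_const).measurableSet
  have hi : Integrable fun y => fderiv ℝ η y w :=
    ((hη.continuous_fderiv (by simp)).clm_apply continuous_const).integrable_of_hasCompactSupport
      (hηc.fderiv_apply ℝ w)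
  have e : ∀ y, (fderiv ℝ η y w • if inner ℝ (b 0) y < (0 : ℝ) then p else q)
      = ({y : Plane | inner ℝ (b 0) y < (0 : ℝ)}).indicator (fun y => fderiv ℝ η y w) y • (p - q)
        + fderiv ℝ η y w • q := by
    intro y
    by_cases hy : (inner ℝ (b 0) y : ℝ) < 0
    · rw [if_pos hy, indicator_of_mem (by exact hy), smul_sub]; abel
    · rw [if_neg hy, indicator_of_notMem (by exact hy), zero_smul, zero_add]
  simp only [e]
  rw [integral_add ((hi.indicator hm).smul_const _) (hi.smul_const _), integral_smul_const,
    integral_smul_const, integral_indicator hm, h, h0, zero_smul, add_zero]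

theorem fderiv_fderiv_apply {η : Plane → ℝ} (hη : ContDiff ℝ ((⊤ : ℕ∞) : WithTop ℕ∞) η)
    (y v w : Plane) :
    fderiv ℝ (fun y => fderiv ℝ η y w) y v = fderiv ℝ (fun y => fderiv ℝ η y v) y w := by
  have hle : (2 : WithTop ℕ∞) ≤ ((⊤ : ℕ∞) : WithTop ℕ∞) := by
    exact WithTop.coe_le_coe.2 (le_top : (2 : ℕ∞) ≤ ⊤)
  have hd : DifferentiableAt ℝ (fderiv ℝ η) y :=
    ((hη.fderiv_right (m := 1) (by rw [one_add_one_eq_two]; exact hle)).differentiable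
      one_ne_zero) y
  have hs := (hη.contDiffAt (x := y)).isSymmSndFDerivAt (by simpa using hle)
  have e : ∀ v w, fderiv ℝ (fun y => fderiv ℝ η y w) y v = fderiv ℝ (fderiv ℝ η) y v w := by
    intro v w
    have := hd.hasFDerivAt.clm_apply (hasFDerivAt_const w y)
    rw [this.fderiv]
    simp
  rw [e, e]
  exact hs v w

/-- The velocity gradient has no tangential jump. -/
theorem IsWeakGradient.traces_tangential {w : Plane → Plane} {G : Plane → Plane →L[ℝ] Plane}
    (h : IsWeakGradient w G) {D : Set Plane} {σ : Plane}
    (b : OrthonormalBasis (Fin 2) ℝ Plane) {L : ℝ} {A B : Plane →L[ℝ] Plane}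
    (hG : AEStronglyMeasurable G volume) (hL : ∀ᵐ x, ‖G x‖ ≤ L)
    (hin : ∀ y, inner ℝ (b 0) y < (0 : ℝ) → ∀ᶠ r in 𝓝[>] (0 : ℝ), σ + r • y ∈ D)
    (hout : ∀ y, (0 : ℝ) < inner ℝ (b 0) y → ∀ᶠ r in 𝓝[>] (0 : ℝ), σ + r • y ∈ (closure D)ᶜ)
    (hA : Tendsto G (𝓝[D] σ) (𝓝 A)) (hB : Tendsto G (𝓝[(closure D)ᶜ] σ) (𝓝 B)) :
    B (b 1) = A (b 1) := by
  obtain ⟨η, hη, hηc, h1, h0⟩ := exists_test_halfPlane b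
  have hb0 : b 0 ≠ 0 := b.orthonormal.ne_zero 0
  have hηd : ∀ w, ContDiff ℝ ((⊤ : ℕ∞) : WithTop ℕ∞) fun y => fderiv ℝ η y w := fun w =>
    (hη.fderiv_right (m := ((⊤ : ℕ∞) : WithTop ℕ∞)) (by exact_mod_cast le_top)).clm_apply
      contDiff_const
  have lim : ∀ w v, Tendsto (fun r : ℝ => ∫ y, fderiv ℝ η y w • G (σ + r • y) v) (𝓝[>] 0)
      (𝓝 ((inner ℝ (b 0) w : ℝ) • (A v - B v))) := by
    intro w v
    rw [← integral_halfPlane hη hηc h1 h0]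
    refine tendsto_integral_blowup (f := fun x => G x v) (C := L * ‖v‖) hb0 ?_ ?_ hin hout ?_ ?_
      (hηd w).continuous (hηc.fderiv_apply ℝ w)
    · exact (ContinuousLinearMap.apply ℝ Plane v).continuous.comp_aestronglyMeasurable hG
    · filter_upwards [hL] with x hx using (G x).le_of_opNorm_le hx v
    · exact ((ContinuousLinearMap.apply ℝ Plane v).continuous.tendsto A).comp hA
    · exact ((ContinuousLinearMap.apply ℝ Plane v).continuous.tendsto B).comp hB
  -- A weak gradient is curl free: integrating both sides by parts leaves the same mixed second
  -- derivative of η.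
  have hsymm : ∀ r : ℝ, 0 < r → ∫ y, fderiv ℝ η y (b 0) • G (σ + r • y) (b 1)
      = ∫ y, fderiv ℝ η y (b 1) • G (σ + r • y) (b 0) := by
    intro r hr
    rw [h.integral_comp_add_smul (hηd _) (hηc.fderiv_apply ℝ _) σ (b 1) hr,
      h.integral_comp_add_smul (hηd _) (hηc.fderiv_apply ℝ _) σ (b 0) hr]
    simp only [fderiv_fderiv_apply hη _ (b 1) (b 0)]
  -- The limit carries the factor ⟨b 0, w⟩: for w = `b 0` it is the tangential jump, for w = `b 1`
  -- it is zero.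
  have l1 := lim (b 0) (b 1)
  have l2 := lim (b 1) (b 0)
  have := tendsto_nhds_unique (l1.congr' (by
    filter_upwards [self_mem_nhdsWithin] with r (hr : 0 < r) using hsymm r hr)) l2
  rw [b.inner_eq_one, b.inner_eq_zero (show (0 : Fin 2) ≠ 1 by decide), one_smul, zero_smul,
    sub_eq_zero] at this
  exact this.symm

/-- In the plane L² is the borderline space for this scaling. Young's inequality bounds r |q| by
(m/2) r² q² + 1/(2m); undoing the dilation, r² ∫ |η| q(σ + r y)² is the mass of q² weighted near σ,
which vanishes with r, and m is then taken large. -/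
theorem tendsto_smul_integral_blowup_of_memLp {q : Plane → ℝ} (hq : MemLp q 2 volume)
    {η : Plane → ℝ} (hη : Continuous η) (hηc : HasCompactSupport η) (σ : Plane) :
    Tendsto (fun r : ℝ => r * ∫ y, η y * q (σ + r • y)) (𝓝[>] 0) (𝓝 0) := by
  have hq2 : Integrable fun x => q x ^ 2 := hq.integrable_sq
  have hηi : Integrable fun y => |η y| := (hη.integrable_of_hasCompactSupport hηc).abs
  obtain ⟨M, hM⟩ := hηc.exists_bound_of_continuous hη
  set J : ℝ → ℝ := fun r => ∫ x, |η (r⁻¹ • (x - σ))| * q x ^ 2 with hJ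
  have hJ0 : Tendsto J (𝓝[>] 0) (𝓝 0) := by
    suffices Tendsto J (𝓝[>] 0) (𝓝 (∫ x : Plane, (0 : ℝ))) by simpa using this
    refine tendsto_integral_filter_of_dominated_convergence (fun x => M * q x ^ 2) ?_ ?_ ?_ ?_
    · refine Eventually.of_forall fun r => ?_
      exact (hη.comp (by fun_prop)).abs.aestronglyMeasurable.mul hq2.aestronglyMeasurable
    · refine Eventually.of_forall fun r => Eventually.of_forall fun x => ?_
      rw [norm_mul, Real.norm_eq_abs, abs_abs, Real.norm_of_nonneg (sq_nonneg _)]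
      have := hM (r⁻¹ • (x - σ))
      gcongr
      exact this
    · exact hq2.const_mul M
    -- For fixed x ≠ σ the rescaled point leaves the support of η once r is small.
    · have : ∀ᵐ x : Plane, x ≠ σ := by simp [ae_iff]
      filter_upwards [this] with x hx
      obtain ⟨R, hR⟩ := hηc.isCompact.isBounded.subset_closedBall 0
      have hpos : 0 < ‖x - σ‖ := norm_pos_iff.2 (sub_ne_zero.2 hx)
      have hev : ∀ᶠ r in 𝓝[>] (0 : ℝ), r * (|R| + 1) < ‖x - σ‖ := by
        have : Tendsto (fun r : ℝ => r * (|R| + 1)) (𝓝 0) (𝓝 (0 * (|R| + 1))) :=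
          tendsto_id.mul_const _
        rw [zero_mul] at this
        exact (this.mono_left nhdsWithin_le_nhds).eventually (gt_mem_nhds hpos)
      refine tendsto_const_nhds.congr' ?_
      filter_upwards [hev, self_mem_nhdsWithin] with r hr (hr0 : 0 < r)
      have : η (r⁻¹ • (x - σ)) = 0 := by
        by_contra hne
        have h1 := hR (subset_tsupport η hne)
        rw [mem_closedBall_zero_iff, norm_smul, norm_inv, Real.norm_of_nonneg hr0.le,
          inv_mul_le_iff₀ hr0] at h1
        have := le_abs_self R
        nlinarith
      simp [this]
  have hbound : ∀ m : ℝ, 0 < m → ∀ r : ℝ, 0 < r →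
      |r * ∫ y, η y * q (σ + r • y)| ≤ m / 2 * J r + (∫ y, |η y|) / (2 * m) := by
    intro m hm r hr
    have hJr : J r = r ^ 2 * ∫ y, |η y| * q (σ + r • y) ^ 2 := by
      simp only [hJ]
      rw [smul_integral_comp _ σ hr]
      simp only [inv_smul_add_smul_sub _ _ hr, smul_eq_mul]
    have hi2 : Integrable fun y => |η y| * q (σ + r • y) ^ 2 := by
      have hqr : Integrable fun y => q (σ + r • y) ^ 2 := by
        have := (hq2.comp_add_left σ).comp_smul hr.ne'
        exact this
      refine hqr.bdd_mul (c := M) hη.abs.aestronglyMeasurable (Eventually.of_forall fun y => ?_)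
      simpa using hM y
    rw [hJr, ← integral_const_mul]
    calc |∫ y, r * (η y * q (σ + r • y))|
        ≤ ∫ y, (m / 2 * r ^ 2 * (|η y| * q (σ + r • y) ^ 2) + |η y| / (2 * m)) := by
          rw [← Real.norm_eq_abs]
          refine norm_integral_le_of_norm_le ((hi2.const_mul _).add (hηi.div_const _))
            (Eventually.of_forall fun y => ?_)
          rw [Real.norm_eq_abs, abs_mul, abs_mul, abs_of_pos hr]
          have h0 := abs_nonneg (η y)
          have key : r * |q (σ + r • y)| ≤ m / 2 * r ^ 2 * q (σ + r • y) ^ 2 + 1 / (2 * m) := by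
            rw [← sq_abs (q _)]
            have := sq_nonneg (m * r * |q (σ + r • y)| - 1)
            have e : m / 2 * r ^ 2 * |q (σ + r • y)| ^ 2 + 1 / (2 * m) - r * |q (σ + r • y)|
                = (m * r * |q (σ + r • y)| - 1) ^ 2 / (2 * m) := by field_simp; ring
            have : 0 ≤ (m * r * |q (σ + r • y)| - 1) ^ 2 / (2 * m) := by positivity
            linarith
          calc r * (|η y| * |q (σ + r • y)|) = |η y| * (r * |q (σ + r • y)|) := by ring
            _ ≤ |η y| * (m / 2 * r ^ 2 * q (σ + r • y) ^ 2 + 1 / (2 * m)) := by gcongr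
            _ = _ := by ring
      _ = m / 2 * (r ^ 2 * ∫ y, |η y| * q (σ + r • y) ^ 2) + (∫ y, |η y|) / (2 * m) := by
          rw [integral_add (hi2.const_mul _) (hηi.div_const _), integral_const_mul,
            integral_div]
          ring
  have hI : 0 ≤ ∫ y, |η y| := integral_nonneg fun y => abs_nonneg _
  rw [Metric.tendsto_nhds]
  intro ε hε
  -- This m keeps the term without `J` at most ε/2; the `+ 1` ensures m > 0.
  set m := ((∫ y, |η y|) + 1) / ε with hm
  have hmpos : 0 < m := by positivity
  have hev : ∀ᶠ r in 𝓝[>] (0 : ℝ), J r < ε / m :=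
    hJ0.eventually (gt_mem_nhds (by positivity))
  filter_upwards [hev, self_mem_nhdsWithin] with r hr (hr0 : 0 < r)
  rw [dist_zero_right, Real.norm_eq_abs]
  refine (hbound m hmpos r hr0).trans_lt ?_
  have h1 : m / 2 * J r < ε / 2 := by
    calc m / 2 * J r < m / 2 * (ε / m) := by gcongr
      _ = ε / 2 := by field_simp
  have h2 : (∫ y, |η y|) / (2 * m) ≤ ε / 2 := by
    rw [hm, div_le_div_iff₀ (by positivity) (by positivity)]
    have : ε * (2 * (((∫ y, |η y|) + 1) / ε)) = 2 * ((∫ y, |η y|) + 1) := by field_simp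
    rw [this]
    linarith
  linarith

/-- Rankine-Hugoniot: a bounded field whose divergence is square integrable has no normal jump. -/
theorem inner_traces_eq {Sg : Plane → Plane} {q : Plane → ℝ} {D : Set Plane} {σ : Plane}
    (b : OrthonormalBasis (Fin 2) ℝ Plane) {C : ℝ} {p p' : Plane}
    (hSg : AEStronglyMeasurable Sg volume) (hC : ∀ᵐ x, ‖Sg x‖ ≤ C) (hq : MemLp q 2 volume)
    (h : ∀ η : Plane → ℝ, ContDiff ℝ ((⊤ : ℕ∞) : WithTop ℕ∞) η → HasCompactSupport η →
      ∫ x, fderiv ℝ η x (Sg x) = ∫ x, η x * q x)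
    (hin : ∀ y, inner ℝ (b 0) y < (0 : ℝ) → ∀ᶠ r in 𝓝[>] (0 : ℝ), σ + r • y ∈ D)
    (hout : ∀ y, (0 : ℝ) < inner ℝ (b 0) y → ∀ᶠ r in 𝓝[>] (0 : ℝ), σ + r • y ∈ (closure D)ᶜ)
    (hp : Tendsto Sg (𝓝[D] σ) (𝓝 p)) (hp' : Tendsto Sg (𝓝[(closure D)ᶜ] σ) (𝓝 p')) :
    (inner ℝ (b 0) p' : ℝ) = inner ℝ (b 0) p := by
  obtain ⟨η, hη, hηc, h1, h0⟩ := exists_test_halfPlane b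
  have hb0 : b 0 ≠ 0 := b.orthonormal.ne_zero 0
  have hd : Differentiable ℝ η := hη.differentiable (by simp)
  have hηd : ∀ w, Continuous fun y => fderiv ℝ η y w := fun w =>
    (hη.continuous_fderiv (by simp)).clm_apply continuous_const
  have hcont : ∀ i, Continuous fun x : Plane => (inner ℝ (b i) x : ℝ) := fun i =>
    (innerSL ℝ (b i)).continuous
  have hmi : ∀ i, AEStronglyMeasurable (fun x => (inner ℝ (b i) (Sg x) : ℝ)) volume := fun i =>
    (hcont i).comp_aestronglyMeasurable hSg
  have hCi : ∀ i, ∀ᵐ x, ‖(inner ℝ (b i) (Sg x) : ℝ)‖ ≤ C := fun i => by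
    filter_upwards [hC] with x hx
    have := norm_inner_le_norm (𝕜 := ℝ) (b i) (Sg x)
    rw [b.norm_eq_one, one_mul] at this
    exact this.trans hx
  have lim : ∀ i, Tendsto (fun r : ℝ => ∫ y, fderiv ℝ η y (b i) • (inner ℝ (b i) (Sg (σ + r • y)) : ℝ))
      (𝓝[>] 0) (𝓝 ((inner ℝ (b 0) (b i) : ℝ) • (inner ℝ (b i) p - inner ℝ (b i) p' : ℝ))) := by
    intro i
    rw [← integral_halfPlane hη hηc h1 h0]
    exact tendsto_integral_blowup (f := fun x => (inner ℝ (b i) (Sg x) : ℝ)) (C := C) hb0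
      (hmi i) (hCi i) hin hout (((hcont i).tendsto p).comp hp) (((hcont i).tendsto p').comp hp')
      (hηd _) (hηc.fderiv_apply ℝ _)
  have hsum := (lim 0).add (lim 1)
  rw [b.inner_eq_one, b.inner_eq_zero (show (0 : Fin 2) ≠ 1 by decide), one_smul, zero_smul,
    add_zero] at hsum
  have hz := tendsto_smul_integral_blowup_of_memLp hq hη.continuous hηc σ
  -- The derivative of the rescaled test function costs a factor 1/r, so the source term carries an
  -- extra r and disappears in the limit.
  have heq : ∀ r : ℝ, 0 < r → r * ∫ y, η y * q (σ + r • y)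
      = (∫ y, fderiv ℝ η y (b 0) • (inner ℝ (b 0) (Sg (σ + r • y)) : ℝ))
        + ∫ y, fderiv ℝ η y (b 1) • (inner ℝ (b 1) (Sg (σ + r • y)) : ℝ) := by
    intro r hr
    have hint : ∀ i, Integrable fun y => fderiv ℝ η y (b i) • (inner ℝ (b i) (Sg (σ + r • y)) : ℝ) := by
      intro i
      have hi : Integrable fun y => fderiv ℝ η y (b i) :=
        (hηd _).integrable_of_hasCompactSupport (hηc.fderiv_apply ℝ _)
      refine hi.mul_bdd (c := C) ?_ ?_
      · exact (hmi i).comp_quasiMeasurePreserving (quasiMeasurePreserving_add_smul σ hr.ne')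
      · exact (quasiMeasurePreserving_add_smul σ hr.ne').ae (hCi i)
    rw [← integral_add (hint 0) (hint 1)]
    have h2 := h (fun x => η (r⁻¹ • (x - σ)))
      (hη.comp ((contDiff_id.sub contDiff_const).const_smul r⁻¹))
      (hasCompactSupport_comp_inv_smul_sub hηc σ hr)
    rw [smul_integral_comp _ σ hr, smul_integral_comp (fun x => _ * q x) σ hr] at h2
    simp only [fderiv_comp_inv_smul_sub hd, inv_smul_add_smul_sub _ _ hr, integral_const_mul,
      smul_eq_mul] at h2
    have h3 : ∫ y, fderiv ℝ η y (Sg (σ + r • y)) = r * ∫ y, η y * q (σ + r • y) := by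
      field_simp at h2
      linarith
    rw [← h3]
    congr 1
    ext y
    conv_lhs => rw [← b.sum_repr' (Sg (σ + r • y)), Fin.sum_univ_two]
    simp only [map_add, map_smul, smul_eq_mul]
    ring
  have := tendsto_nhds_unique (hz.congr' (by
    filter_upwards [self_mem_nhdsWithin] with r (hr : 0 < r) using heq r hr)) hsum
  linarith

theorem exists_orthonormalBasis_of_norm_eq_one {n : Plane} (hn : ‖n‖ = 1) :
    ∃ b : OrthonormalBasis (Fin 2) ℝ Plane, b 0 = n := by
  have ho : Orthonormal ℝ (({0} : Set (Fin 2)).domRestrict fun _ : Fin 2 => n) := by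
    constructor
    · intro i; simpa using hn
    · intro i j hij
      exact absurd (Subtype.ext (i.2.trans j.2.symm)) hij
  obtain ⟨b, hb⟩ := ho.exists_orthonormalBasis_extension_of_card_eq (by simp)
  exact ⟨b, hb 0 rfl⟩

/-! ### Local integrability -/

theorem _root_.MeasureTheory.LocallyIntegrableOn.integrable_smul_of_tsupport_subset {H F : Type*}
    [TopologicalSpace H] [T2Space H] [MeasurableSpace H] [OpensMeasurableSpace H]
    [SecondCountableTopology H]
    [NormedAddCommGroup F] [NormedSpace ℝ F] {ν : Measure H} {S : Set H} {f : H → F}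
    (hf : LocallyIntegrableOn f S ν) {ζ : H → ℝ} (hζ : Continuous ζ) (hζc : HasCompactSupport ζ)
    (hζS : tsupport ζ ⊆ S) : Integrable (fun z => ζ z • f z) ν := by
  have hK := hf.integrableOn_compact_subset hζS hζc
  obtain ⟨C, hC⟩ := hζc.exists_bound_of_continuous hζ
  have h1 : IntegrableOn (fun z => ζ z • f z) (tsupport ζ) ν :=
    hK.bdd_smul C hζ.aestronglyMeasurable (Eventually.of_forall hC)
  refine (integrableOn_iff_integrable_of_support_subset fun z hz => ?_).1 h1
  by_contra hne
  exact hz (by simp [image_eq_zero_of_notMem_tsupport hne])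

theorem locallyIntegrableOn_of_bounded {H F : Type*} [TopologicalSpace H] [MeasurableSpace H]
    [OpensMeasurableSpace H]
    [NormedAddCommGroup F] {ν : Measure H} [IsLocallyFiniteMeasure ν] {S : Set H} {f : H → F}
    (hS : MeasurableSet S) (hf : AEStronglyMeasurable f (ν.restrict S)) {C : ℝ}
    (hC : ∀ z ∈ S, ‖f z‖ ≤ C) : LocallyIntegrableOn f S ν := by
  intro x hx
  obtain ⟨U, hU, hUfin⟩ := ν.finiteAt_nhds x
  refine ⟨U ∩ S, inter_mem (mem_nhdsWithin_of_mem_nhds hU) self_mem_nhdsWithin, ?_⟩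
  have hUS : ν (U ∩ S) < ∞ := (measure_mono inter_subset_left).trans_lt hUfin
  have hle : ν.restrict (U ∩ S) ≤ ν.restrict S := Measure.restrict_mono inter_subset_right le_rfl
  have : ∀ᵐ z ∂ν.restrict (U ∩ S), ‖f z‖ ≤ C :=
    ae_mono hle ((ae_restrict_iff' hS).2 (Eventually.of_forall hC))
  have : IsFiniteMeasure (ν.restrict (U ∩ S)) := ⟨by simpa using hUS⟩
  exact Integrable.of_bound (hf.mono_measure hle) C ‹_›

theorem _root_.MeasureTheory.LocallyIntegrableOn.bdd_smul_of_bounded {H F : Type*}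
    [TopologicalSpace H] [MeasurableSpace H]
    [NormedAddCommGroup F] [NormedSpace ℝ F] {ν : Measure H} {S : Set H} {f : H → F}
    (hf : LocallyIntegrableOn f S ν) (hS : MeasurableSet S) {a : H → ℝ}
    (ha : AEStronglyMeasurable a (ν.restrict S)) {C : ℝ} (hC : ∀ z ∈ S, ‖a z‖ ≤ C) :
    LocallyIntegrableOn (fun z => a z • f z) S ν := by
  intro x hx
  obtain ⟨U, hU, hUi⟩ := hf x hx
  refine ⟨U ∩ S, inter_mem hU self_mem_nhdsWithin, ?_⟩
  have hle : ν.restrict (U ∩ S) ≤ ν.restrict S := Measure.restrict_mono inter_subset_right le_rfl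
  have : ∀ᵐ z ∂ν.restrict (U ∩ S), ‖a z‖ ≤ C :=
    ae_mono hle ((ae_restrict_iff' hS).2 (Eventually.of_forall hC))
  exact (hUi.mono_set inter_subset_left)
    |>.bdd_smul C (ha.mono_measure hle) this

theorem _root_.MeasureTheory.LocallyIntegrableOn.clm_comp {H F F' : Type*}
    [TopologicalSpace H] [MeasurableSpace H] [NormedAddCommGroup F] [NormedSpace ℝ F]
    [NormedAddCommGroup F'] [NormedSpace ℝ F'] {ν : Measure H} {S : Set H} {f : H → F}
    (hf : LocallyIntegrableOn f S ν) (ℓ : F →L[ℝ] F') :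
    LocallyIntegrableOn (fun z => ℓ (f z)) S ν := by
  intro x hx
  obtain ⟨U, hU, hUi⟩ := hf x hx
  exact ⟨U, hU, ℓ.integrable_comp hUi⟩

/-! ### Space-time test functions -/

instance : (volume : Measure (ℝ × Plane)).IsAddHaarMeasure :=
  inferInstanceAs ((volume : Measure ℝ).prod (volume : Measure Plane)).IsAddHaarMeasure

/-- The open slab `(0, T) × ℝ²`. -/
def slab (T : ℝ) : Set (ℝ × Plane) := Ioo 0 T ×ˢ univ

theorem isOpen_slab (T : ℝ) : IsOpen (slab T) := isOpen_Ioo.prod isOpen_univ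

section TestFunctions

variable {T : ℝ} {ψ : ℝ × Plane → ℝ}

theorem IsTest.differentiable (h : IsTest T ψ) : Differentiable ℝ ψ := h.1.differentiable (by simp)

theorem IsTest.continuous_fderiv (h : IsTest T ψ) (v : ℝ × Plane) :
    Continuous fun z => fderiv ℝ ψ z v :=
  (h.1.continuous_fderiv (by simp)).clm_apply continuous_const

theorem IsTest.tsupport_fderiv_subset (h : IsTest T ψ) (v : ℝ × Plane) :
    tsupport (fun z => fderiv ℝ ψ z v) ⊆ slab T :=
  (tsupport_fderiv_apply_subset ℝ v).trans h.2.2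

theorem IsTest.integrable_smul {F : Type*} [NormedAddCommGroup F] [NormedSpace ℝ F]
    (h : IsTest T ψ) {f : ℝ × Plane → F} (hf : LocallyIntegrableOn f (slab T) volume) :
    Integrable fun z => ψ z • f z :=
  hf.integrable_smul_of_tsupport_subset h.1.continuous h.2.1 h.2.2

theorem IsTest.integrable_fderiv_smul {F : Type*} [NormedAddCommGroup F] [NormedSpace ℝ F]
    (h : IsTest T ψ) (v : ℝ × Plane) {f : ℝ × Plane → F}
    (hf : LocallyIntegrableOn f (slab T) volume) :
    Integrable fun z => fderiv ℝ ψ z v • f z :=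
  hf.integrable_smul_of_tsupport_subset (h.continuous_fderiv v) (h.2.1.fderiv_apply ℝ v)
    (h.tsupport_fderiv_subset v)

theorem plane_eq_sum (v : Plane) :
    v = v 0 • EuclideanSpace.single 0 (1 : ℝ) + v 1 • EuclideanSpace.single 1 (1 : ℝ) := by
  ext i
  fin_cases i <;> simp

theorem dx_eq_sum (ψ : ℝ × Plane → ℝ) (z : ℝ × Plane) (v : Plane) :
    dx ψ z v = v 0 * fderiv ℝ ψ z (0, EuclideanSpace.single 0 1)
      + v 1 * fderiv ℝ ψ z (0, EuclideanSpace.single 1 1) := by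
  have : ((0 : ℝ), v) = v 0 • ((0 : ℝ), (EuclideanSpace.single 0 1 : Plane))
      + v 1 • ((0 : ℝ), (EuclideanSpace.single 1 1 : Plane)) := by
    conv_lhs => rw [plane_eq_sum v]
    simp
  rw [dx, this, map_add, map_smul, map_smul, smul_eq_mul, smul_eq_mul]

end TestFunctions

/-! ### Mollification in the slab -/

section SlabMollification

variable {T : ℝ} {K : Set (ℝ × Plane)} {ε : ℝ}

theorem support_convolution_bump_subset {f : ℝ × Plane → ℝ} (k : ContDiffBump (0 : ℝ × Plane))
    (hk : k.rOut ≤ ε) (hf : Function.support f ⊆ K) :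
    tsupport (MeasureTheory.convolution (k.normed volume) f (ContinuousLinearMap.lsmul ℝ ℝ) volume)
      ⊆ Metric.cthickening ε K := by
  refine closure_minimal ?_ Metric.isClosed_cthickening
  refine (support_convolution_subset _).trans ?_
  rintro _ ⟨x, hx, y, hy, rfl⟩
  rw [k.support_normed_eq, Metric.mem_ball, dist_zero_right] at hx
  refine Metric.mem_cthickening_of_dist_le _ y _ _ (hf hy) ?_
  simpa [dist_eq_norm] using hx.le.trans hk

theorem isTest_convolution_bump {f : ℝ × Plane → ℝ} (k : ContDiffBump (0 : ℝ × Plane))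
    (hk : k.rOut ≤ ε) (hK : IsCompact K) (hKε : Metric.cthickening ε K ⊆ slab T)
    (hf : Function.support f ⊆ K) (hfi : Integrable f) :
    IsTest T (MeasureTheory.convolution (k.normed volume) f (ContinuousLinearMap.lsmul ℝ ℝ)
      volume) := by
  refine ⟨k.hasCompactSupport_normed.contDiff_convolution_left _ k.contDiff_normed
    hfi.locallyIntegrable, ?_, (support_convolution_bump_subset k hk hf).trans hKε⟩
  exact IsCompact.of_isClosed_subset hK.cthickening (isClosed_tsupport _)
    (support_convolution_bump_subset k hk hf)

/-- No continuity of f is needed: the mollifications keep its bound C and converge at almost every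
point by Lebesgue differentiation, for which the ratio of the radii of the kernels must stay
bounded. -/
theorem tendsto_integral_convolution_bump {F : Type*} [NormedAddCommGroup F] [NormedSpace ℝ F]
    {f : ℝ × Plane → ℝ} {g : ℝ × Plane → F} {k : ℕ → ContDiffBump (0 : ℝ × Plane)}
    (hk : ∀ n, (k n).rOut ≤ ε) (hk0 : Tendsto (fun n => (k n).rOut) atTop (𝓝 0))
    (hkr : ∀ n, (k n).rOut ≤ 2 * (k n).rIn) (hK : IsCompact K)
    (hf : Function.support f ⊆ K) (hfi : Integrable f) {C : ℝ} (hC : ∀ z, ‖f z‖ ≤ C)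
    (hg : IntegrableOn g (Metric.cthickening ε K)) :
    Tendsto (fun n => ∫ z, (MeasureTheory.convolution ((k n).normed volume) f
      (ContinuousLinearMap.lsmul ℝ ℝ) volume z) • g z) atTop (𝓝 (∫ z, f z • g z)) := by
  set K' := Metric.cthickening ε K with hK'
  have hK'c : IsCompact K' := hK.cthickening
  have hred : ∀ h : ℝ × Plane → ℝ, Function.support h ⊆ K' →
      ∫ z, h z • g z = ∫ z in K', h z • g z := by
    intro h hh
    refine (setIntegral_eq_integral_of_forall_compl_eq_zero fun z hz => ?_).symm
    have : h z = 0 := by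
      by_contra hne
      exact hz (hh hne)
    rw [this, zero_smul]
  rw [hred f (hf.trans (Metric.self_subset_cthickening K))]
  have hs : ∀ n, Function.support (MeasureTheory.convolution ((k n).normed volume) f
      (ContinuousLinearMap.lsmul ℝ ℝ) volume) ⊆ K' := fun n =>
    (subset_tsupport _).trans (support_convolution_bump_subset (k n) (hk n) hf)
  simp only [fun n => hred _ (hs n)]
  have hae := ContDiffBump.ae_convolution_tendsto_right_of_locallyIntegrable (μ := volume)
    (K := 2) hk0 (Eventually.of_forall hkr) hfi.locallyIntegrable
  refine tendsto_integral_of_dominated_convergence (fun z => C * ‖g z‖) ?_ ?_ ?_ ?_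
  · intro n
    refine AEStronglyMeasurable.smul ?_ hg.aestronglyMeasurable
    exact ((k n).hasCompactSupport_normed.contDiff_convolution_left (n := 0) _
      ((k n).contDiff_normed) hfi.locallyIntegrable).continuous.aestronglyMeasurable
  · exact hg.norm.const_mul C
  · intro n
    refine Eventually.of_forall fun z => ?_
    rw [norm_smul]
    gcongr
    rw [convolution_eq_integral_sub]
    have hint : Integrable fun x => (k n).normed volume (z - x) :=
      (k n).integrable_normed.comp_sub_left z
    calc ‖∫ w, (k n).normed volume (z - w) • f w‖
        ≤ ∫ w, (k n).normed volume (z - w) * C := by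
          refine norm_integral_le_of_norm_le (hint.mul_const _) (Eventually.of_forall fun w => ?_)
          rw [norm_smul, Real.norm_of_nonneg ((k n).nonneg_normed _)]
          have := (k n).nonneg_normed (μ := volume) (z - w)
          gcongr
          exact hC w
      _ = C := by
          rw [integral_mul_const, integral_sub_left_eq_self (fun x => (k n).normed volume x),
            (k n).integral_normed, one_mul]
  · filter_upwards [ae_restrict_of_ae hae] with z hz using hz.smul_const _

end SlabMollification

/-! ### The momentum equation in terms of the material derivative -/

/-- If `∂_t r + div(r u) = 0` and `∂_t u + (u · ∇) u = V`, then
`∂_t (r u) + div(r u ⊗ u) = r V`, in the sense of distributions. -/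
theorem integral_mul_material {T : ℝ} {r : ℝ × Plane → ℝ} {u V : ℝ × Plane → Plane}
    {G : ℝ × Plane → Plane →L[ℝ] Plane} {C : ℝ}
    (hr : AEStronglyMeasurable r (volume.restrict (slab T))) (hrC : ∀ z ∈ slab T, ‖r z‖ ≤ C)
    (hu : ContinuousOn u (slab T)) (hG : LocallyIntegrableOn G (slab T) volume)
    (hV : LocallyIntegrableOn V (slab T) volume)
    (hmass : ∀ ψ, IsTest T ψ → ∫ z, r z * (dt ψ z + dx ψ z (u z)) = 0)
    (hgrad : ∀ ψ, IsTest T ψ → ∀ v : Plane, ∫ z, ψ z • G z v = -∫ z, dx ψ z v • u z)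
    (hmat : ∀ ψ, IsTest T ψ → ∫ z, (ψ z • G z (u z) - dt ψ z • u z) = ∫ z, ψ z • V z)
    {ψ : ℝ × Plane → ℝ} (hψ : IsTest T ψ) :
    ∫ z, (r z * (dt ψ z + dx ψ z (u z))) • u z = -∫ z, (ψ z * r z) • V z := by
  have hSm : MeasurableSet (slab T) := (isOpen_slab T).measurableSet
  obtain ⟨ε, hε, hKε⟩ := hψ.2.1.isCompact.exists_cthickening_subset_open (isOpen_slab T) hψ.2.2
  set K := tsupport ψ with hKdef
  have hKc : IsCompact K := hψ.2.1
  set K' := Metric.cthickening ε K with hK'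
  have hK'c : IsCompact K' := hKc.cthickening
  let e : Fin 2 → Plane := fun j => EuclideanSpace.single j 1
  set D : ℝ × Plane → ℝ := fun z => dt ψ z + dx ψ z (u z) with hD
  -- the three fields to be mollified
  set m : ℝ × Plane → ℝ := fun z => ψ z * r z with hm
  set m0 : ℝ × Plane → ℝ := fun z => r z * D z with hm0
  set g : Fin 2 → ℝ × Plane → ℝ := fun j z => m z * u z j with hg
  have hum : AEStronglyMeasurable u (volume.restrict (slab T)) :=
    hu.aestronglyMeasurable hSm
  have hucoord : ∀ j : Fin 2, ContinuousOn (fun z => u z j) (slab T) := fun j =>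
    (EuclideanSpace.proj (𝕜 := ℝ) j).continuous.comp_continuousOn hu
  have hDcont : ContinuousOn D (slab T) := by
    simp only [hD, dx_eq_sum]
    exact (hψ.continuous_fderiv (1, 0)).continuousOn.add
      (((hucoord 0).mul (hψ.continuous_fderiv _).continuousOn).add
        ((hucoord 1).mul (hψ.continuous_fderiv _).continuousOn))
  have hψK : ∀ z, z ∉ K → ψ z = 0 := fun z hz => image_eq_zero_of_notMem_tsupport hz
  have hdψK : ∀ z, z ∉ K → fderiv ℝ ψ z = 0 := fun z hz =>
    image_eq_zero_of_notMem_tsupport fun h => hz (tsupport_fderiv_subset ℝ h)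
  have hDK : ∀ z, z ∉ K → D z = 0 := fun z hz => by simp [hD, dt, dx, hdψK z hz]
  have hC0 : ∀ z ∈ K, 0 ≤ C := fun z hz => (norm_nonneg _).trans (hrC z (hψ.2.2 hz))
  -- bounded, compactly supported fields
  have hgood : ∀ c : ℝ × Plane → ℝ, ContinuousOn c (slab T) → (∀ z, z ∉ K → c z = 0) →
      Function.support (fun z => c z * r z) ⊆ K ∧ Integrable (fun z => c z * r z) ∧
        ∃ M, ∀ z, ‖c z * r z‖ ≤ M := by
    intro c hc hcK
    have h1 : Function.support (fun z => c z * r z) ⊆ K := fun z hz => by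
      by_contra hne
      exact hz (by simp [hcK z hne])
    obtain ⟨M, hM⟩ := hKc.exists_bound_of_continuousOn (hc.mono hψ.2.2)
    have h2 : ∀ z ∈ K, ‖c z * r z‖ ≤ M * C := fun z hz => by
      rw [norm_mul]
      exact mul_le_mul (hM z hz) (hrC z (hψ.2.2 hz)) (norm_nonneg _)
        ((norm_nonneg _).trans (hM z hz))
    refine ⟨h1, ?_, max (M * C) 0, fun z => ?_⟩
    · refine (integrableOn_iff_integrable_of_support_subset h1).1 ?_
      have hKm : MeasurableSet K := hKc.measurableSet
      have hle : volume.restrict K ≤ volume.restrict (slab T) :=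
        Measure.restrict_mono hψ.2.2 le_rfl
      have hcr : AEStronglyMeasurable (fun z => c z * r z) (volume.restrict (slab T)) :=
        (hc.aestronglyMeasurable hSm).mul hr
      have : IsFiniteMeasure (volume.restrict K) := ⟨by simpa using hKc.measure_lt_top⟩
      exact Integrable.of_bound (hcr.mono_measure hle) (M * C)
        ((ae_restrict_iff' hKm).2 (Eventually.of_forall h2))
    · by_cases hz : z ∈ K
      · exact (h2 z hz).trans (le_max_left _ _)
      · simp [hcK z hz]
  have hψc : ContinuousOn ψ (slab T) := hψ.1.continuous.continuousOn
  obtain ⟨hms, hmi, Cm, hCm⟩ := hgood ψ hψc hψK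
  obtain ⟨hm0s, hm0i, Cm0, hCm0⟩ := hgood D hDcont hDK
  have em0 : (fun z => D z * r z) = m0 := by ext z; simp only [hm0]; ring
  rw [em0] at hm0s hm0i
  replace hCm0 : ∀ z, ‖m0 z‖ ≤ Cm0 := fun z => by rw [← em0]; exact hCm0 z
  have hg3 : ∀ j, Function.support (g j) ⊆ K ∧ Integrable (g j) ∧ ∃ M, ∀ z, ‖g j z‖ ≤ M := by
    intro j
    have := hgood (fun z => ψ z * u z j) (hψc.mul (hucoord j)) (fun z hz => by simp [hψK z hz])
    have e1 : (fun z => ψ z * u z j * r z) = g j := by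
      ext z; simp only [hg, hm]; ring
    have e2 : ∀ z, ψ z * u z j * r z = g j z := fun z => congrFun e1 z
    simpa only [e2] using this
  -- the mollifiers
  let k : ℕ → ContDiffBump (0 : ℝ × Plane) := fun n =>
    stdBump (ℝ × Plane) (ε / (n + 1)) (by positivity)
  have hk0 : Tendsto (fun n => (k n).rOut) atTop (𝓝 0) := by
    simpa [k, stdBump, div_eq_mul_inv] using
      (tendsto_one_div_add_atTop_nhds_zero_nat (𝕜 := ℝ)).const_mul ε
  have hkε : ∀ n, (k n).rOut ≤ ε := fun n => by
    simp only [k, stdBump]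
    exact div_le_self hε.le (by linarith [(Nat.cast_nonneg n : (0 : ℝ) ≤ n)])
  have hkr : ∀ n, (k n).rOut ≤ 2 * (k n).rIn := fun n => by
    simp only [k, stdBump]; linarith
  let cv : ℕ → (ℝ × Plane → ℝ) → ℝ × Plane → ℝ := fun n f =>
    MeasureTheory.convolution ((k n).normed volume) f (ContinuousLinearMap.lsmul ℝ ℝ) volume
  have hkd : ∀ n, ContDiff ℝ 1 ((k n).normed volume) := fun n => (k n).contDiff_normed
  have htest : ∀ n f, Function.support f ⊆ K → Integrable f → IsTest T (cv n f) :=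
    fun n f hf hfi => isTest_convolution_bump (k n) (hkε n) hKc hKε hf hfi
  -- the mollified mass equation
  have hmass' : ∀ n w, dt (cv n m) w
      = cv n m0 w - (dx (cv n (g 0)) w (e 0) + dx (cv n (g 1)) w (e 1)) := by
    intro n w
    have hη : ContDiff ℝ ((⊤ : ℕ∞) : WithTop ℕ∞) fun z => (k n).normed volume (w - z) :=
      (k n).contDiff_normed.comp (contDiff_const.sub contDiff_id)
    have hηd : Differentiable ℝ fun z => (k n).normed volume (w - z) := hη.differentiable (by simp)
    have hprod : IsTest T fun z => ψ z * (k n).normed volume (w - z) :=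
      ⟨hψ.1.mul hη, hψ.2.1.mul_right, (tsupport_mul_subset_left).trans hψ.2.2⟩
    have h0 := hmass _ hprod
    have hfd : ∀ z v, fderiv ℝ (fun z => ψ z * (k n).normed volume (w - z)) z v
        = (k n).normed volume (w - z) * fderiv ℝ ψ z v
          - ψ z * fderiv ℝ ((k n).normed volume) (w - z) v := by
      intro z v
      have := ((hψ.differentiable z).hasFDerivAt.mul (hηd z).hasFDerivAt).fderiv
      have h2 : fderiv ℝ (fun z => ψ z * (k n).normed volume (w - z)) z = _ := this
      rw [h2]
      simp only [add_apply, smul_apply, smul_eq_mul,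
        fderiv_comp_sub_left ((hkd n).differentiable one_ne_zero)]
      ring
    have hbd : ∀ v, Continuous fun z => fderiv ℝ ((k n).normed volume) (w - z) v := fun v =>
      (((hkd n).continuous_fderiv one_ne_zero).comp (continuous_const.sub continuous_id)).clm_apply
        continuous_const
    have hbc : ∀ v, HasCompactSupport fun z => fderiv ℝ ((k n).normed volume) (w - z) v := fun v =>
      hasCompactSupport_comp_sub_left ((k n).hasCompactSupport_normed.fderiv_apply ℝ v) w
    have i0 : Integrable fun z => (k n).normed volume (w - z) * m0 z :=
      hm0i.locallyIntegrable.integrable_smul_left_of_hasCompactSupport hη.continuous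
        (hasCompactSupport_comp_sub_left (k n).hasCompactSupport_normed w)
    have i1 : Integrable fun z => fderiv ℝ ((k n).normed volume) (w - z) (1, 0) * m z :=
      hmi.locallyIntegrable.integrable_smul_left_of_hasCompactSupport (hbd _) (hbc _)
    have i2 : ∀ j, Integrable fun z => fderiv ℝ ((k n).normed volume) (w - z) (0, e j) * g j z :=
      fun j => (hg3 j).2.1.locallyIntegrable.integrable_smul_left_of_hasCompactSupport
        (hbd _) (hbc _)
    have hpt : ∀ z, r z * (dt (fun z => ψ z * (k n).normed volume (w - z)) z
          + dx (fun z => ψ z * (k n).normed volume (w - z)) z (u z))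
        = (k n).normed volume (w - z) * m0 z
          - fderiv ℝ ((k n).normed volume) (w - z) (1, 0) * m z
          - (fderiv ℝ ((k n).normed volume) (w - z) (0, e 0) * g 0 z
            + fderiv ℝ ((k n).normed volume) (w - z) (0, e 1) * g 1 z) := by
      intro z
      rw [dt, dx_eq_sum, hfd, hfd, hfd]
      simp only [hm0, hD, hm, hg, e, dt, dx_eq_sum]
      ring
    simp only [hpt] at h0
    have i01 : Integrable fun z => (k n).normed volume (w - z) * m0 z
      - fderiv ℝ ((k n).normed volume) (w - z) (1, 0) * m z := i0.sub i1
    have i22 : Integrable fun z => fderiv ℝ ((k n).normed volume) (w - z) (0, e 0) * g 0 z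
      + fderiv ℝ ((k n).normed volume) (w - z) (0, e 1) * g 1 z := (i2 0).add (i2 1)
    rw [integral_sub i01 i22, integral_sub i0 i1, integral_add (i2 0) (i2 1)] at h0
    simp only [dt, dx, cv]
    rw [fderiv_convolution_apply (hkd n) (k n).hasCompactSupport_normed hmi.locallyIntegrable,
      fderiv_convolution_apply (hkd n) (k n).hasCompactSupport_normed
        (hg3 0).2.1.locallyIntegrable,
      fderiv_convolution_apply (hkd n) (k n).hasCompactSupport_normed
        (hg3 1).2.1.locallyIntegrable, convolution_eq_integral_sub]
    simp only [smul_eq_mul]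
    linarith
  -- local integrability of the factors
  have huL : LocallyIntegrableOn u (slab T) volume := hu.locallyIntegrableOn hSm
  have hGe : ∀ j, LocallyIntegrableOn (fun z => G z (e j)) (slab T) volume := fun j =>
    hG.clm_comp (ContinuousLinearMap.apply ℝ Plane (e j))
  have hGuK : IntegrableOn (fun z => G z (u z)) K' := by
    have hGK : IntegrableOn G K' := hG.integrableOn_compact_subset hKε hK'c
    obtain ⟨M, hM⟩ := hK'c.exists_bound_of_continuousOn (hu.mono hKε)
    refine (hGK.norm.mul_const M).mono' ?_ ?_
    · have hum' : AEStronglyMeasurable u (volume.restrict K') :=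
        hum.mono_measure (Measure.restrict_mono hKε le_rfl)
      exact (ContinuousLinearMap.id ℝ (Plane →L[ℝ] Plane)).aestronglyMeasurable_comp₂
        hGK.aestronglyMeasurable hum'
    · refine (ae_restrict_iff' hK'c.measurableSet).2 (Eventually.of_forall fun z hz => ?_)
      exact ((G z).le_opNorm _).trans (by gcongr; exact hM z hz)
  have hint : ∀ {F : ℝ × Plane → Plane} (n : ℕ) (f : ℝ × Plane → ℝ), Function.support f ⊆ K →
      Integrable f → IntegrableOn F K' → Integrable fun z => cv n f z • F z := by
    intro F n f hf hfi hF
    have ht := htest n f hf hfi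
    obtain ⟨M, hM⟩ := ht.2.1.exists_bound_of_continuous ht.1.continuous
    refine (integrableOn_iff_integrable_of_support_subset (s := K') fun z hz => ?_).1
      (hF.bdd_smul M ht.1.continuous.aestronglyMeasurable (Eventually.of_forall hM))
    by_contra hne
    have : cv n f z = 0 := by
      by_contra h0
      exact hne (support_convolution_bump_subset (k n) (hkε n) hf (subset_tsupport _ h0))
    exact hz (by simp [this])
  have huK : IntegrableOn u K' := huL.integrableOn_compact_subset hKε hK'c
  have hVK : IntegrableOn V K' := hV.integrableOn_compact_subset hKε hK'c
  have hGeK : ∀ j, IntegrableOn (fun z => G z (e j)) K' := fun j =>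
    (hGe j).integrableOn_compact_subset hKε hK'c
  -- The mollification of ψ r is tested in the equation for V. Its time derivative is replaced
  -- through the mollified mass equation, and the weak gradient absorbs the divergence. The products
  -- are formed before mollifying, so no commutator appears.
  have hid : ∀ n, (∫ z, cv n m z • G z (u z)) - (∫ z, cv n m0 z • u z)
      - ((∫ z, cv n (g 0) z • G z (e 0)) + ∫ z, cv n (g 1) z • G z (e 1))
      = ∫ z, cv n m z • V z := by
    intro n
    have t := htest n m hms hmi
    have tj := fun j => htest n (g j) (hg3 j).1 (hg3 j).2.1
    have h1 := hmat _ t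
    have j1 : Integrable fun z => dt (cv n m) z • u z := t.integrable_fderiv_smul (1, 0) huL
    have j2 : ∀ j, Integrable fun z => dx (cv n (g j)) z (e j) • u z := fun j =>
      (tj j).integrable_fderiv_smul (0, e j) huL
    rw [integral_sub (hint n m hms hmi hGuK) j1] at h1
    have h2 : ∫ z, dt (cv n m) z • u z = (∫ z, cv n m0 z • u z)
        - ((∫ z, dx (cv n (g 0)) z (e 0) • u z) + ∫ z, dx (cv n (g 1)) z (e 1) • u z) := by
      have j22 : Integrable fun z => dx (cv n (g 0)) z (e 0) • u z
        + dx (cv n (g 1)) z (e 1) • u z := (j2 0).add (j2 1)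
      rw [← integral_add (j2 0) (j2 1), ← integral_sub (hint n m0 hm0s hm0i huK) j22]
      congr 1
      ext1 z
      rw [hmass' n z, sub_smul, add_smul]
    rw [h2] at h1
    rw [hgrad _ (tj 0) (e 0), hgrad _ (tj 1) (e 1), ← h1]
    abel
  have lim : ∀ {F : ℝ × Plane → Plane} (f : ℝ × Plane → ℝ), Function.support f ⊆ K →
      Integrable f → (∃ M, ∀ z, ‖f z‖ ≤ M) → IntegrableOn F K' →
      Tendsto (fun n => ∫ z, cv n f z • F z) atTop (𝓝 (∫ z, f z • F z)) := by
    intro F f hf hfi ⟨M, hM⟩ hF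
    exact tendsto_integral_convolution_bump hkε hk0 hkr hKc hf hfi hM hF
  have hl := (((lim m hms hmi ⟨_, hCm⟩ hGuK).sub (lim m0 hm0s hm0i ⟨_, hCm0⟩ huK)).sub
    ((lim (g 0) (hg3 0).1 (hg3 0).2.1 (hg3 0).2.2 (hGeK 0)).add
      (lim (g 1) (hg3 1).1 (hg3 1).2.1 (hg3 1).2.2 (hGeK 1))))
  simp only [hid] at hl
  have hfin := tendsto_nhds_unique (lim m hms hmi ⟨_, hCm⟩ hVK) hl
  have hi : ∀ {F : ℝ × Plane → Plane} (f : ℝ × Plane → ℝ), Function.support f ⊆ K →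
      Integrable f → (∃ M, ∀ z, ‖f z‖ ≤ M) → IntegrableOn F K' →
      Integrable fun z => f z • F z := by
    intro F f hf hfi ⟨M, hM⟩ hF
    refine (integrableOn_iff_integrable_of_support_subset (s := K') fun z hz => ?_).1
      (hF.bdd_smul M hfi.aestronglyMeasurable.restrict (Eventually.of_forall hM))
    by_contra hne
    have : f z = 0 := by
      by_contra h0
      exact hne (Metric.self_subset_cthickening K (hf h0))
    exact hz (by simp [this])
  -- In the limit the two convective terms coincide by linearity of G and cancel.
  have hsum : (∫ z, g 0 z • G z (e 0)) + ∫ z, g 1 z • G z (e 1) = ∫ z, m z • G z (u z) := by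
    rw [← integral_add (hi (g 0) (hg3 0).1 (hg3 0).2.1 (hg3 0).2.2 (hGeK 0))
      (hi (g 1) (hg3 1).1 (hg3 1).2.1 (hg3 1).2.2 (hGeK 1))]
    congr 1
    ext1 z
    conv_rhs => rw [plane_eq_sum (u z), map_add, map_smul, map_smul]
    simp only [hg, mul_smul, smul_add, e]
  rw [hsum] at hfin
  rw [hfin]
  abel

/-! ### Continuity in time with values in Lebesgue spaces -/

section TimeContinuity

variable {T : ℝ}

theorem ContInL2.clm_comp {F F' : Type*} [NormedAddCommGroup F] [NormedSpace ℝ F]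
    [NormedAddCommGroup F'] [NormedSpace ℝ F'] {g : ℝ → Plane → F} (hg : ContInL2 T g)
    (ℓ : F →L[ℝ] F') : ContInL2 T fun t x => ℓ (g t x) := by
  intro t ht
  obtain ⟨h1, h2⟩ := hg t ht
  refine ⟨ℓ.comp_memLp' h1, ?_⟩
  have hb : ∀ s, eLpNorm (fun x => ℓ (g s x) - ℓ (g t x)) 2 volume
      ≤ ENNReal.ofReal ‖ℓ‖ * eLpNorm (fun x => g s x - g t x) 2 volume := fun s => by
    refine eLpNorm_le_mul_eLpNorm_of_ae_le_mul (Eventually.of_forall fun x => ?_) 2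
    rw [← map_sub]
    exact ℓ.le_opNorm _
  refine tendsto_of_tendsto_of_tendsto_of_le_of_le tendsto_const_nhds ?_ (fun _ => zero_le) hb
  have := ENNReal.Tendsto.const_mul (a := ENNReal.ofReal ‖ℓ‖) h2 (Or.inr ENNReal.ofReal_ne_top)
  rwa [mul_zero] at this

theorem ContInL2.exists_bound {F : Type*} [NormedAddCommGroup F] {g : ℝ → Plane → F}
    (hg : ContInL2 T g) : ∃ M < ∞, ∀ t ∈ Icc 0 T, eLpNorm (g t) 2 volume ≤ M := by
  refine isCompact_Icc.induction_on (p := fun s => ∃ M < ∞, ∀ t ∈ s ∩ Icc 0 T,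
    eLpNorm (g t) 2 volume ≤ M) ?_ ?_ ?_ ?_ |>.imp fun M hM => ⟨hM.1, fun t ht => hM.2 t ⟨ht, ht⟩⟩
  · exact ⟨0, by simp, by simp⟩
  · rintro s t hst ⟨M, hM, h⟩
    exact ⟨M, hM, fun x hx => h x ⟨hst hx.1, hx.2⟩⟩
  · rintro s t ⟨M, hM, h⟩ ⟨M', hM', h'⟩
    refine ⟨max M M', max_lt hM hM', fun x hx => ?_⟩
    rcases hx.1 with h1 | h1
    · exact (h x ⟨h1, hx.2⟩).trans (le_max_left _ _)
    · exact (h' x ⟨h1, hx.2⟩).trans (le_max_right _ _)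
  · intro t ht
    obtain ⟨h1, h2⟩ := hg t ht
    refine ⟨_, h2.eventually (gt_mem_nhds one_pos), 1 + eLpNorm (g t) 2 volume,
      ENNReal.add_lt_top.2 ⟨ENNReal.one_lt_top, h1.2⟩, fun s hs => ?_⟩
    have hm : AEStronglyMeasurable (fun x => g s x - g t x) volume :=
      (hg s hs.2).1.1.sub h1.1
    calc eLpNorm (g s) 2 volume = eLpNorm ((fun x => g s x - g t x) + g t) 2 volume := by
          congr 1; ext x; simp
      _ ≤ eLpNorm (fun x => g s x - g t x) 2 volume + eLpNorm (g t) 2 volume :=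
          eLpNorm_add_le hm h1.1 (by norm_num)
      _ ≤ 1 + eLpNorm (g t) 2 volume := by
          gcongr
          have h3 : eLpNorm (fun x => g s x - g t x) 2 volume < 1 := hs.1
          exact h3.le

/-- Uniformly bounded functions, continuous in time in `L²` increments. -/
def BddContL2 (T C : ℝ) (a : ℝ → Plane → ℝ) : Prop :=
  ∀ t ∈ Icc 0 T, AEStronglyMeasurable (a t) volume ∧ (∀ x, |a t x| ≤ C) ∧
    Tendsto (fun s => eLpNorm (fun x => a s x - a t x) 2 volume) (𝓝[Icc 0 T] t) (𝓝 0)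

/-- Continuity in time with values in `L¹_loc`. -/
def ContL1Loc (T : ℝ) (c : ℝ → Plane → ℝ) : Prop :=
  ∀ K : Set Plane, IsCompact K → ∀ t ∈ Icc 0 T, IntegrableOn (c t) K ∧
    Tendsto (fun s => eLpNorm (fun x => c s x - c t x) 1 (volume.restrict K)) (𝓝[Icc 0 T] t) (𝓝 0)

/-- The composite need not be square integrable, since h may not vanish at 0; only its increments in
time are controlled in L². -/
theorem ContInL2.bddContL2_comp {w : ℝ → Plane → ℝ} (hw : ContInL2 T w) {h : ℝ → ℝ} {K : ℝ≥0}
    (hh : LipschitzWith K h) {C : ℝ} (hC : ∀ t ∈ Icc 0 T, ∀ x, |h (w t x)| ≤ C) :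
    BddContL2 T C fun t x => h (w t x) := by
  intro t ht
  obtain ⟨h1, h2⟩ := hw t ht
  refine ⟨hh.continuous.comp_aestronglyMeasurable h1.1, hC t ht, ?_⟩
  have hb : ∀ s, eLpNorm (fun x => h (w s x) - h (w t x)) 2 volume
      ≤ ENNReal.ofReal K * eLpNorm (fun x => w s x - w t x) 2 volume := fun s => by
    refine eLpNorm_le_mul_eLpNorm_of_ae_le_mul (Eventually.of_forall fun x => ?_) 2
    simpa [Real.dist_eq] using hh.dist_le_mul (w s x) (w t x)
  refine tendsto_of_tendsto_of_tendsto_of_le_of_le tendsto_const_nhds ?_ (fun _ => zero_le) hb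
  have := ENNReal.Tendsto.const_mul (a := ENNReal.ofReal K) h2 (Or.inr ENNReal.ofReal_ne_top)
  rwa [mul_zero] at this

theorem BddContL2.contL1Loc {C : ℝ} {a : ℝ → Plane → ℝ} (ha : BddContL2 T C a) :
    ContL1Loc T a := by
  intro K hK t ht
  obtain ⟨h1, h2, h3⟩ := ha t ht
  have hfin : IsFiniteMeasure (volume.restrict K) := ⟨by simpa using hK.measure_lt_top⟩
  refine ⟨Integrable.of_bound h1.restrict C (Eventually.of_forall h2), ?_⟩
  have hb : ∀ᶠ s in 𝓝[Icc 0 T] t, eLpNorm (fun x => a s x - a t x) 1 (volume.restrict K)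
      ≤ eLpNorm (fun x => a s x - a t x) 2 volume * volume K ^ (1 / 2 : ℝ) := by
    filter_upwards [self_mem_nhdsWithin] with s hs
    have hm : AEStronglyMeasurable (fun x => a s x - a t x) volume := (ha s hs).1.sub h1
    have h4 := eLpNorm_le_eLpNorm_mul_rpow_measure_univ (p := 1) (q := 2) (by norm_num)
      (hm.restrict (s := K))
    refine h4.trans ?_
    rw [Measure.restrict_apply_univ]
    have : (1 / (1 : ℝ≥0∞).toReal - 1 / (2 : ℝ≥0∞).toReal) = (1 / 2 : ℝ) := by norm_num
    rw [this]
    gcongr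
    exact Measure.restrict_le_self
  refine tendsto_of_tendsto_of_tendsto_of_le_of_le' tendsto_const_nhds ?_
    (Eventually.of_forall fun _ => zero_le) hb
  have := ENNReal.Tendsto.mul_const (b := volume K ^ (1 / 2 : ℝ)) h3
    (Or.inr (ENNReal.rpow_ne_top_of_nonneg (by norm_num) hK.measure_lt_top.ne))
  rwa [zero_mul] at this

/-- The increment is a(s)(b(s) - b(t)) + (a(s) - a(t)) b(t): the first term uses the bound on a and
the finite measure of K, the second Cauchy–Schwarz. The products μ(ρ)∇u, λ(ρ) div u and ρV are of
this type. -/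
theorem BddContL2.mul_contL1Loc {C : ℝ} {a b : ℝ → Plane → ℝ} (ha : BddContL2 T C a)
    (hb : ContInL2 T b) : ContL1Loc T fun t x => a t x * b t x := by
  intro K hK t ht
  obtain ⟨h1, h2, h3⟩ := ha t ht
  obtain ⟨b1, b2⟩ := hb t ht
  have hfin : IsFiniteMeasure (volume.restrict K) := ⟨by simpa using hK.measure_lt_top⟩
  have hbi : IntegrableOn (b t) K := (b1.restrict K).integrable (by norm_num)
  refine ⟨hbi.bdd_mul (c := C) h1.restrict (Eventually.of_forall h2), ?_⟩
  have hb : ∀ᶠ s in 𝓝[Icc 0 T] t,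
      eLpNorm (fun x => a s x * b s x - a t x * b t x) 1 (volume.restrict K)
      ≤ ENNReal.ofReal C * (eLpNorm (fun x => b s x - b t x) 2 volume * volume K ^ (1 / 2 : ℝ))
        + eLpNorm (fun x => a s x - a t x) 2 volume * eLpNorm (b t) 2 volume := by
    filter_upwards [self_mem_nhdsWithin] with s hs
    have hm : AEStronglyMeasurable (fun x => a s x - a t x) volume := (ha s hs).1.sub h1
    have hmb : AEStronglyMeasurable (fun x => b s x - b t x) volume := (hb s hs).1.1.sub b1.1
    have e : (fun x => a s x * b s x - a t x * b t x)
        = (fun x => a s x * (b s x - b t x)) + ((fun x => a s x - a t x) • b t) := by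
      ext x; simp; ring
    rw [e]
    refine (eLpNorm_add_le (((ha s hs).1.mul hmb).restrict) ((hm.smul b1.1).restrict)
      le_rfl).trans ?_
    gcongr
    · have h4 := eLpNorm_le_eLpNorm_mul_rpow_measure_univ (p := 1) (q := 2) (by norm_num)
        (hmb.restrict (s := K))
      rw [Measure.restrict_apply_univ] at h4
      have : (1 / (1 : ℝ≥0∞).toReal - 1 / (2 : ℝ≥0∞).toReal) = (1 / 2 : ℝ) := by norm_num
      rw [this] at h4
      calc eLpNorm (fun x => a s x * (b s x - b t x)) 1 (volume.restrict K)
          ≤ ENNReal.ofReal C * eLpNorm (fun x => b s x - b t x) 1 (volume.restrict K) := by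
            refine eLpNorm_le_mul_eLpNorm_of_ae_le_mul (Eventually.of_forall fun x => ?_) 1
            rw [norm_mul]
            gcongr
            exact (ha s hs).2.1 x
        _ ≤ _ := by
            gcongr
            refine h4.trans ?_
            gcongr
            exact Measure.restrict_le_self
    · refine (eLpNorm_mono_measure _ Measure.restrict_le_self).trans ?_
      exact eLpNorm_smul_le_mul_eLpNorm b1.1 hm
  refine tendsto_of_tendsto_of_tendsto_of_le_of_le' tendsto_const_nhds ?_
    (Eventually.of_forall fun _ => zero_le) hb
  have t1 := ENNReal.Tendsto.const_mul (a := ENNReal.ofReal C)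
    (ENNReal.Tendsto.mul_const (b := volume K ^ (1 / 2 : ℝ)) b2
    (Or.inr (ENNReal.rpow_ne_top_of_nonneg (by norm_num) hK.measure_lt_top.ne)))
    (Or.inr ENNReal.ofReal_ne_top)
  have t2 := ENNReal.Tendsto.mul_const (b := eLpNorm (b t) 2 volume) h3 (Or.inr b1.2.ne)
  simpa using t1.add t2

theorem ContL1Loc.add {c d : ℝ → Plane → ℝ} (hc : ContL1Loc T c) (hd : ContL1Loc T d) :
    ContL1Loc T fun t x => c t x + d t x := by
  intro K hK t ht
  obtain ⟨c1, c2⟩ := hc K hK t ht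
  obtain ⟨d1, d2⟩ := hd K hK t ht
  refine ⟨c1.add d1, ?_⟩
  have hb : ∀ᶠ s in 𝓝[Icc 0 T] t,
      eLpNorm (fun x => c s x + d s x - (c t x + d t x)) 1 (volume.restrict K)
      ≤ eLpNorm (fun x => c s x - c t x) 1 (volume.restrict K)
        + eLpNorm (fun x => d s x - d t x) 1 (volume.restrict K) := by
    filter_upwards [self_mem_nhdsWithin] with s hs
    have e : (fun x => c s x + d s x - (c t x + d t x))
        = (fun x => c s x - c t x) + fun x => d s x - d t x := by
      ext x; simp; ring
    rw [e]
    exact eLpNorm_add_le ((hc K hK s hs).1.1.sub c1.1) ((hd K hK s hs).1.1.sub d1.1) le_rfl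
  refine tendsto_of_tendsto_of_tendsto_of_le_of_le' tendsto_const_nhds ?_
    (Eventually.of_forall fun _ => zero_le) hb
  simpa using c2.add d2

theorem ContL1Loc.const_mul {c : ℝ → Plane → ℝ} (hc : ContL1Loc T c) (k : ℝ) :
    ContL1Loc T fun t x => k * c t x := by
  intro K hK t ht
  obtain ⟨c1, c2⟩ := hc K hK t ht
  refine ⟨c1.const_mul k, ?_⟩
  have hb : ∀ s, eLpNorm (fun x => k * c s x - k * c t x) 1 (volume.restrict K)
      ≤ ENNReal.ofReal |k| * eLpNorm (fun x => c s x - c t x) 1 (volume.restrict K) := fun s => by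
    refine eLpNorm_le_mul_eLpNorm_of_ae_le_mul (Eventually.of_forall fun x => ?_) 1
    rw [← mul_sub, norm_mul, Real.norm_eq_abs k]
  refine tendsto_of_tendsto_of_tendsto_of_le_of_le tendsto_const_nhds ?_ (fun _ => zero_le) hb
  have := ENNReal.Tendsto.const_mul (a := ENNReal.ofReal |k|) c2 (Or.inr ENNReal.ofReal_ne_top)
  rwa [mul_zero] at this

theorem ContL1Loc.integrable_mul {c : ℝ → Plane → ℝ} (hc : ContL1Loc T c) {t : ℝ}
    (ht : t ∈ Icc 0 T) {ζ : Plane → ℝ} (hζ : Continuous ζ) (hζc : HasCompactSupport ζ) :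
    Integrable fun x => ζ x * c t x := by
  obtain ⟨C, hC⟩ := hζc.exists_bound_of_continuous hζ
  have h1 : IntegrableOn (fun x => ζ x * c t x) (tsupport ζ) :=
    ((hc _ hζc t ht).1).bdd_mul (c := C) hζ.aestronglyMeasurable (Eventually.of_forall hC)
  refine (integrableOn_iff_integrable_of_support_subset fun z hz => ?_).1 h1
  by_contra hne
  exact hz (by simp [image_eq_zero_of_notMem_tsupport hne])

/-- The weight may depend on time, as is needed for test functions that travel with a particle. -/
theorem ContL1Loc.continuousOn_integral {c : ℝ → Plane → ℝ} (hc : ContL1Loc T c)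
    {ζ : ℝ → Plane → ℝ} (hζ : Continuous (Function.uncurry ζ)) {K : Set Plane}
    (hK : IsCompact K) (hζK : ∀ t ∈ Icc 0 T, ∀ x, x ∉ K → ζ t x = 0) :
    ContinuousOn (fun t => ∫ x, ζ t x * c t x) (Icc 0 T) := by
  have hred : ∀ t ∈ Icc 0 T, ∀ s ∈ Icc 0 T,
      ∫ x, ζ t x * c s x = ∫ x in K, ζ t x * c s x := fun t ht s _ =>
    (setIntegral_eq_integral_of_forall_compl_eq_zero fun x hx => by
      rw [hζK t ht x hx, zero_mul]).symm
  have hζt : ∀ t, Continuous (ζ t) := fun t => hζ.comp (Continuous.prodMk_right t)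
  obtain ⟨M, hM⟩ := (isCompact_Icc.prod hK).exists_bound_of_continuousOn
    (s := Icc 0 T ×ˢ K) hζ.continuousOn
  have hM' : ∀ t ∈ Icc 0 T, ∀ᵐ x ∂volume.restrict K, ‖ζ t x‖ ≤ M := fun t ht =>
    (ae_restrict_iff' hK.measurableSet).2 (Eventually.of_forall fun x hx => hM (t, x) ⟨ht, hx⟩)
  intro t ht
  obtain ⟨c1, c2⟩ := hc K hK t ht
  -- the first increment
  have d1 : Tendsto (fun s => ∫ x in K, ζ s x * (c s x - c t x)) (𝓝[Icc 0 T] t) (𝓝 0) := by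
    rw [tendsto_zero_iff_norm_tendsto_zero]
    have hr : Tendsto (fun s => M * (eLpNorm (fun x => c s x - c t x) 1
        (volume.restrict K)).toReal) (𝓝[Icc 0 T] t) (𝓝 0) := by
      have := ((ENNReal.tendsto_toReal ENNReal.zero_ne_top).comp c2).const_mul M
      simpa using this
    refine squeeze_zero' (Eventually.of_forall fun _ => norm_nonneg _) ?_ hr
    filter_upwards [self_mem_nhdsWithin] with s hs
    have hi : Integrable (fun x => c s x - c t x) (volume.restrict K) :=
      (hc K hK s hs).1.sub c1
    have : (eLpNorm (fun x => c s x - c t x) 1 (volume.restrict K)).toReal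
        = ∫ x in K, ‖c s x - c t x‖ := by
      rw [eLpNorm_one_eq_lintegral_enorm, integral_norm_eq_lintegral_enorm hi.1]
    rw [this, ← integral_const_mul]
    refine norm_integral_le_of_norm_le (hi.norm.const_mul M) ?_
    filter_upwards [hM' s hs] with x hx
    rw [norm_mul]
    gcongr
  have d2 : Tendsto (fun s => ∫ x in K, ζ s x * c t x) (𝓝[Icc 0 T] t)
      (𝓝 (∫ x in K, ζ t x * c t x)) := by
    refine tendsto_integral_filter_of_dominated_convergence (fun x => M * ‖c t x‖) ?_ ?_
      (c1.norm.const_mul M) ?_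
    · exact Eventually.of_forall fun s => (hζt s).aestronglyMeasurable.mul c1.1
    · filter_upwards [self_mem_nhdsWithin] with s hs
      filter_upwards [hM' s hs] with x hx
      rw [norm_mul]
      gcongr
    · refine Eventually.of_forall fun x => ?_
      have : Continuous fun s => ζ s x := hζ.comp (Continuous.prodMk_left x)
      exact ((this.tendsto t).mono_left nhdsWithin_le_nhds).mul_const _
  have := d1.add d2
  rw [zero_add, ← hred t ht t ht] at this
  refine this.congr' ?_
  filter_upwards [self_mem_nhdsWithin] with s hs
  rw [hred s hs s hs, ← integral_add]
  · congr 1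
    ext x
    ring
  · exact ((hc K hK s hs).1.sub c1).bdd_mul (c := M) (hζt s).aestronglyMeasurable (hM' s hs)
  · exact c1.bdd_mul (c := M) (hζt s).aestronglyMeasurable (hM' s hs)

end TimeContinuity

/-! ### Slices and local integrability in space-time -/

theorem restrict_slab_eq (T : ℝ) : (volume : Measure (ℝ × Plane)).restrict (slab T)
    = ((volume : Measure ℝ).restrict (Ioo 0 T)).prod (volume : Measure Plane) := by
  rw [slab, Measure.volume_eq_prod, ← Measure.prod_restrict, Measure.restrict_univ]

theorem ContInL2.locallyIntegrableOn {F : Type*} [NormedAddCommGroup F] {T : ℝ}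
    {g : ℝ → Plane → F} (hg : ContInL2 T g)
    (hm : AEStronglyMeasurable (Function.uncurry g) (volume.restrict (slab T))) :
    LocallyIntegrableOn (Function.uncurry g) (slab T) volume := by
  obtain ⟨M, hM, hb⟩ := hg.exists_bound
  have hmem : MemLp (Function.uncurry g) 2 (volume.restrict (slab T)) := by
    refine ⟨hm, ?_⟩
    rw [eLpNorm_lt_top_iff_lintegral_rpow_enorm_lt_top (by norm_num) (by norm_num)]
    rw [restrict_slab_eq] at hm ⊢
    rw [lintegral_prod _ (hm.enorm.pow_const _)]
    calc ∫⁻ t in Ioo 0 T, ∫⁻ x, ‖Function.uncurry g (t, x)‖ₑ ^ (2 : ℝ≥0∞).toReal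
        ≤ ∫⁻ t in Ioo 0 T, M ^ (2 : ℝ≥0∞).toReal := by
          refine setLIntegral_mono measurable_const fun t ht => ?_
          have h1 := hb t (Ioo_subset_Icc_self ht)
          rw [eLpNorm_eq_lintegral_rpow_enorm_toReal (by norm_num) (by norm_num)] at h1
          have h2 := ENNReal.rpow_le_rpow (z := (2 : ℝ≥0∞).toReal) h1 (by norm_num)
          rw [← ENNReal.rpow_mul] at h2
          simpa using h2
      _ < ∞ := by
          rw [lintegral_const]
          refine ENNReal.mul_lt_top (ENNReal.rpow_lt_top_of_nonneg (by norm_num) hM.ne) ?_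
          simp
  exact locallyIntegrableOn_of_locallyIntegrable_restrict (hmem.locallyIntegrable (by norm_num))

theorem IsTest.slice {T : ℝ} {ψ : ℝ × Plane → ℝ} (h : IsTest T ψ) (t : ℝ) :
    ContDiff ℝ ((⊤ : ℕ∞) : WithTop ℕ∞) (fun x => ψ (t, x)) ∧
      HasCompactSupport (fun x => ψ (t, x)) ∧
      ∀ x v, fderiv ℝ (fun x => ψ (t, x)) x v = dx ψ (t, x) v := by
  refine ⟨h.1.comp (contDiff_prodMk_right t), ?_, fun x v => ?_⟩
  · refine h.2.1.comp_isClosedEmbedding (g := fun x : Plane => (t, x)) ?_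
    exact Topology.IsClosedEmbedding.of_continuous_injective_isClosedMap
      (Continuous.prodMk_right t) (Prod.mk_right_injective t) (isClosedMap_prodMk_left t)
  · have := (h.differentiable (t, x)).hasFDerivAt.comp x (hasFDerivAt_prodMk_right t x)
    have h2 : fderiv ℝ (fun x => ψ (t, x)) x = _ := this.fderiv
    rw [h2]
    simp [dx]

theorem IsTest.eq_zero_of_notMem {T : ℝ} {ψ : ℝ × Plane → ℝ} (h : IsTest T ψ) {t : ℝ}
    (ht : t ∉ Ioo 0 T) (x : Plane) : ψ (t, x) = 0 ∧ fderiv ℝ ψ (t, x) = 0 := by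
  have hn : (t, x) ∉ tsupport ψ := fun hm => ht (h.2.2 hm).1
  exact ⟨image_eq_zero_of_notMem_tsupport hn,
    image_eq_zero_of_notMem_tsupport fun hm => hn (_root_.tsupport_fderiv_subset ℝ hm)⟩

theorem integral_smul_gradient {T : ℝ} {u : ℝ → Plane → Plane}
    {G : ℝ → Plane → Plane →L[ℝ] Plane} (hgrad : ∀ t ∈ Icc 0 T, IsWeakGradient (u t) (G t))
    (hu : LocallyIntegrableOn (Function.uncurry u) (slab T) volume)
    (hG : LocallyIntegrableOn (Function.uncurry G) (slab T) volume) {ψ : ℝ × Plane → ℝ}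
    (hψ : IsTest T ψ) (v : Plane) :
    ∫ z : ℝ × Plane, ψ z • G z.1 z.2 v = -∫ z : ℝ × Plane, dx ψ z v • u z.1 z.2 := by
  have i1 : Integrable fun z : ℝ × Plane => ψ z • G z.1 z.2 v :=
    hψ.integrable_smul (hG.clm_comp (ContinuousLinearMap.apply ℝ Plane v))
  have i2 : Integrable fun z : ℝ × Plane => dx ψ z v • u z.1 z.2 :=
    hψ.integrable_fderiv_smul (0, v) hu
  rw [Measure.volume_eq_prod] at i1 i2 ⊢
  rw [integral_prod _ i1, integral_prod _ i2, ← integral_neg]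
  congr 1
  ext1 t
  by_cases ht : t ∈ Ioo 0 T
  · obtain ⟨h1, h2, h3⟩ := hψ.slice t
    have := hgrad t (Ioo_subset_Icc_self ht) _ h1 h2 v
    simpa only [h3] using this
  · have h0 := hψ.eq_zero_of_notMem ht
    simp [dx, h0]

/-! ### The mass equation with continuously differentiable test functions -/

/-- A bump carried by a particle is only C¹ in time, because the path is. Mollifying the test
function makes it admissible, and its first derivatives are the mollified derivatives. -/
theorem integral_mass_of_contDiff_one {T : ℝ} {r : ℝ × Plane → ℝ} {u : ℝ × Plane → Plane} {C : ℝ}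
    (hr : AEStronglyMeasurable r (volume.restrict (slab T))) (hrC : ∀ z ∈ slab T, ‖r z‖ ≤ C)
    (hu : ContinuousOn u (slab T))
    (hmass : ∀ ψ, IsTest T ψ → ∫ z, r z * (dt ψ z + dx ψ z (u z)) = 0)
    {ψ : ℝ × Plane → ℝ} (hψ : ContDiff ℝ 1 ψ) (hψc : HasCompactSupport ψ)
    (hψs : tsupport ψ ⊆ slab T) :
    ∫ z, r z * (dt ψ z + dx ψ z (u z)) = 0 := by
  have hSm : MeasurableSet (slab T) := (isOpen_slab T).measurableSet
  obtain ⟨ε, hε, hKε⟩ := hψc.isCompact.exists_cthickening_subset_open (isOpen_slab T) hψs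
  set K := tsupport ψ with hKdef
  have hKc : IsCompact K := hψc
  set K' := Metric.cthickening ε K with hK'
  have hK'c : IsCompact K' := hKc.cthickening
  let k : ℕ → ContDiffBump (0 : ℝ × Plane) := fun n =>
    stdBump (ℝ × Plane) (ε / (n + 1)) (by positivity)
  have hk0 : Tendsto (fun n => (k n).rOut) atTop (𝓝 0) := by
    simpa [k, stdBump, div_eq_mul_inv] using
      (tendsto_one_div_add_atTop_nhds_zero_nat (𝕜 := ℝ)).const_mul ε
  have hkε : ∀ n, (k n).rOut ≤ ε := fun n => by
    simp only [k, stdBump]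
    exact div_le_self hε.le (by linarith [(Nat.cast_nonneg n : (0 : ℝ) ≤ n)])
  have hkr : ∀ n, (k n).rOut ≤ 2 * (k n).rIn := fun n => by
    simp only [k, stdBump]; linarith
  let cv : ℕ → (ℝ × Plane → ℝ) → ℝ × Plane → ℝ := fun n f =>
    MeasureTheory.convolution ((k n).normed volume) f (ContinuousLinearMap.lsmul ℝ ℝ) volume
  have hki : ∀ n, LocallyIntegrable ((k n).normed volume) (volume : Measure (ℝ × Plane)) :=
    fun n => (k n).continuous_normed.locallyIntegrable
  have hfd : ∀ n z v, fderiv ℝ (cv n ψ) z v = cv n (fun z => fderiv ℝ ψ z v) z := by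
    intro n z v
    rw [(hψc.hasFDerivAt_convolution_right (ContinuousLinearMap.lsmul ℝ ℝ) (hki n) hψ z).fderiv,
      convolution_precompR_apply _ (hki n) (hψc.fderiv ℝ) (hψ.continuous_fderiv one_ne_zero)]
  have hdK : ∀ v, Function.support (fun z => fderiv ℝ ψ z v) ⊆ K := fun v z hz => by
    by_contra hne
    have : fderiv ℝ ψ z = 0 :=
      image_eq_zero_of_notMem_tsupport fun h => hne (tsupport_fderiv_subset ℝ h)
    exact hz (by simp [this])
  have hdc : ∀ v, Continuous fun z => fderiv ℝ ψ z v := fun v =>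
    (hψ.continuous_fderiv one_ne_zero).clm_apply continuous_const
  have hdcs : ∀ v, HasCompactSupport fun z => fderiv ℝ ψ z v := fun v => hψc.fderiv_apply ℝ v
  have hdi : ∀ v, Integrable fun z => fderiv ℝ ψ z v := fun v =>
    (hdc v).integrable_of_hasCompactSupport (hdcs v)
  have hrL : LocallyIntegrableOn r (slab T) volume := locallyIntegrableOn_of_bounded hSm hr hrC
  have huj : ∀ j, LocallyIntegrableOn (fun z => r z • u z j) (slab T) volume := fun j =>
    (((EuclideanSpace.proj (𝕜 := ℝ) j).continuous.comp_continuousOn hu).locallyIntegrableOn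
      hSm).bdd_smul_of_bounded hSm hr hrC
  have hlim : ∀ v (F : ℝ × Plane → ℝ), LocallyIntegrableOn F (slab T) volume →
      Tendsto (fun n => ∫ z, cv n (fun z => fderiv ℝ ψ z v) z • F z) atTop
        (𝓝 (∫ z, fderiv ℝ ψ z v • F z)) := by
    intro v F hF
    obtain ⟨M, hM⟩ := (hdcs v).exists_bound_of_continuous (hdc v)
    exact tendsto_integral_convolution_bump hkε hk0 hkr hKc (hdK v) (hdi v) hM
      (hF.integrableOn_compact_subset hKε hK'c)
  have hint : ∀ n v (F : ℝ × Plane → ℝ), LocallyIntegrableOn F (slab T) volume →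
      Integrable fun z => cv n (fun z => fderiv ℝ ψ z v) z • F z := fun n v F hF =>
    (isTest_convolution_bump (k n) (hkε n) hKc hKε (hdK v) (hdi v)).integrable_smul hF
  have hint' : ∀ v (F : ℝ × Plane → ℝ), LocallyIntegrableOn F (slab T) volume →
      Integrable fun z => fderiv ℝ ψ z v • F z := fun v F hF =>
    hF.integrable_smul_of_tsupport_subset (hdc v) (hdcs v)
      ((closure_minimal (hdK v) hKc.isClosed).trans hψs)
  let e : Fin 2 → ℝ × Plane := fun j => (0, EuclideanSpace.single j 1)
  have hn : ∀ n, (∫ z, cv n (fun z => fderiv ℝ ψ z (1, 0)) z • r z)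
      + ((∫ z, cv n (fun z => fderiv ℝ ψ z (e 0)) z • (r z • u z 0))
        + ∫ z, cv n (fun z => fderiv ℝ ψ z (e 1)) z • (r z • u z 1)) = 0 := by
    intro n
    have hsum : Integrable fun z => cv n (fun z => fderiv ℝ ψ z (e 0)) z • (r z • u z 0)
        + cv n (fun z => fderiv ℝ ψ z (e 1)) z • (r z • u z 1) :=
      (hint n _ _ (huj 0)).add (hint n _ _ (huj 1))
    rw [← integral_add (hint n _ _ (huj 0)) (hint n _ _ (huj 1)),
      ← integral_add (hint n _ _ hrL) hsum,
      ← hmass (cv n ψ) (isTest_convolution_bump (k n) (hkε n) hKc hKε (subset_tsupport ψ)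
        (hψ.continuous.integrable_of_hasCompactSupport hψc))]
    congr 1
    ext1 z
    rw [dt, dx_eq_sum, hfd, hfd, hfd]
    simp only [smul_eq_mul, e]
    ring
  have hl := (hlim (1, 0) _ hrL).add ((hlim (e 0) _ (huj 0)).add (hlim (e 1) _ (huj 1)))
  simp only [hn] at hl
  have hsum : Integrable fun z => fderiv ℝ ψ z (e 0) • (r z • u z 0)
      + fderiv ℝ ψ z (e 1) • (r z • u z 1) := (hint' _ _ (huj 0)).add (hint' _ _ (huj 1))
  rw [← integral_add (hint' _ _ (huj 0)) (hint' _ _ (huj 1)),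
      ← integral_add (hint' _ _ hrL) hsum] at hl
  rw [tendsto_nhds_unique tendsto_const_nhds hl]
  congr 1
  ext1 z
  rw [dt, dx_eq_sum]
  simp only [smul_eq_mul, e]
  ring

/-! ### Functions of the density -/

/-- On I the law P is injective with Lipschitz inverse, so g ∘ P⁻¹ is Lipschitz on P(I) and extends
to the line with the same constant. Thus regularity assumed for the pressure passes to the density
and to the viscosities. -/
theorem exists_lipschitz_factor {P g : ℝ → ℝ} {I : Set ℝ} {K K' : ℝ} (hK : 0 ≤ K) (hK' : 0 ≤ K')
    (hP : ∀ a ∈ I, ∀ b ∈ I, |a - b| ≤ K * |P a - P b|)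
    (hg : ∀ a ∈ I, ∀ b ∈ I, |g a - g b| ≤ K' * |a - b|) (c : ℝ) :
    ∃ C, ∃ h : ℝ → ℝ, LipschitzWith C h ∧ ∀ r ∈ I, h (P r - c) = g r := by
  rcases I.eq_empty_or_nonempty with rfl | hne
  · exact ⟨0, fun _ => 0, LipschitzWith.const 0, by simp⟩
  set p : ℝ → ℝ := fun r => P r - c
  have hinj : InjOn p I := fun a ha b hb hab => by
    have h1 := hP a ha b hb
    have h2 : P a - P b = 0 := by simp only [p] at hab; linarith
    rw [h2, abs_zero, mul_zero] at h1
    linarith [abs_nonpos_iff.1 h1]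
  have hne' : Nonempty ℝ := ⟨0⟩
  have hl : LipschitzOnWith (⟨K', hK'⟩ * ⟨K, hK⟩) (fun y => g (Function.invFunOn p I y))
      (p '' I) := by
    refine LipschitzOnWith.of_dist_le_mul ?_
    rintro _ ⟨a, ha, rfl⟩ _ ⟨b, hb, rfl⟩
    rw [hinj.leftInvOn_invFunOn ha, hinj.leftInvOn_invFunOn hb, Real.dist_eq, Real.dist_eq]
    have e : p a - p b = P a - P b := by simp only [p]; ring
    rw [e]
    calc |g a - g b| ≤ K' * |a - b| := hg a ha b hb
      _ ≤ K' * (K * |P a - P b|) := by gcongr; exact hP a ha b hb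
      _ = _ := by rw [← mul_assoc]; rfl
  obtain ⟨h, h1, h2⟩ := hl.extend_real
  refine ⟨_, h, h1, fun r hr => ?_⟩
  have := h2 (mem_image_of_mem p hr)
  rw [show P r - c = p r from rfl, ← this]
  exact congrArg g (hinj.leftInvOn_invFunOn hr)

theorem BddContL2.congr {T C : ℝ} {a b : ℝ → Plane → ℝ} (ha : BddContL2 T C a)
    (h : ∀ t ∈ Icc 0 T, ∀ x, a t x = b t x) : BddContL2 T C b := by
  intro t ht
  have e : ∀ s ∈ Icc 0 T, a s = b s := fun s hs => funext (h s hs)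
  obtain ⟨h1, h2, h3⟩ := ha t ht
  rw [e t ht] at h1 h2 h3
  refine ⟨h1, h2, h3.congr' ?_⟩
  filter_upwards [self_mem_nhdsWithin] with s hs
  rw [e s hs]

/-- A Lipschitz function of the density (such as the pressure and the viscosities). -/
def LawLip (I : Set ℝ) (g : ℝ → ℝ) : Prop :=
  (∃ K, 0 ≤ K ∧ ∀ a ∈ I, ∀ b ∈ I, |g a - g b| ≤ K * |a - b|) ∧ ∃ M, ∀ a ∈ I, |g a| ≤ M

section Density

variable {P μ lam : ℝ → ℝ} {α : ℝ≥0} {ρt T : ℝ} {D₀ : Set Plane} {ρ : ℝ → Plane → ℝ}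
  {u : ℝ → Plane → Plane} {G : ℝ → Plane → Plane →L[ℝ] Plane} {V X : ℝ → Plane → Plane}
  {φ : ℝ → Plane → ℝ} {I : Set ℝ} {νmin νmax K : ℝ}

theorem LawBounds.lawLip (hb : LawBounds P μ lam I νmin νmax K) {g : ℝ → ℝ}
    (hg : g ∈ ({P, μ, lam} : Set (ℝ → ℝ))) : LawLip I g :=
  ⟨⟨K, hb.nonneg, fun a ha b hb' => hb.lipId a ha b hb' g hg⟩, K, fun a ha => hb.bounded a ha g hg⟩

theorem LawLip.id {m M : ℝ} : LawLip (Icc m M) fun r => r :=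
  ⟨⟨1, zero_le_one, fun a _ b _ => by simp⟩, max |m| |M|, fun _ ha => abs_le_max_abs_abs ha.1 ha.2⟩

/-- Nothing is known of g outside I, so g is first replaced by a Lipschitz function on the whole
line. -/
theorem LawLip.aestronglyMeasurable {g : ℝ → ℝ} (hg : LawLip I g) {A : Type*}
    [MeasurableSpace A] {ν : Measure A} {r : A → ℝ} (hr : AEStronglyMeasurable r ν)
    (hI : ∀ᵐ z ∂ν, r z ∈ I) : AEStronglyMeasurable (fun z => g (r z)) ν := by
  obtain ⟨⟨K', hK', hg'⟩, -⟩ := hg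
  obtain ⟨C, h, hh, he⟩ := exists_lipschitz_factor (P := fun r => r) zero_le_one hK'
    (by simp) hg' 0
  refine (hh.continuous.comp_aestronglyMeasurable hr).congr ?_
  filter_upwards [hI] with z hz
  simpa using he _ hz

theorem LawBounds.exists_factor (hb : LawBounds P μ lam I νmin νmax K) {g : ℝ → ℝ}
    (hg : LawLip I g) (c : ℝ) :
    ∃ C, ∃ h : ℝ → ℝ, LipschitzWith C h ∧ ∀ r ∈ I, h (P r - c) = g r := by
  obtain ⟨⟨K', hK', hg'⟩, -⟩ := hg
  exact exists_lipschitz_factor hb.nonneg hK' hb.inverse hg' c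

theorem IsLocalSolution.bddContL2 (h : IsLocalSolution P μ lam α ρt T D₀ ρ u G V X φ)
    (hb : LawBounds P μ lam I νmin νmax K) (hρ : ∀ t ∈ Icc 0 T, ∀ x, ρ t x ∈ I) {g : ℝ → ℝ}
    (hg : LawLip I g) : ∃ M, BddContL2 T M fun t x => g (ρ t x) := by
  obtain ⟨C, f, hf, he⟩ := hb.exists_factor hg (P ρt)
  obtain ⟨-, M, hM⟩ := hg
  refine ⟨M, (h.pressure_cont.bddContL2_comp hf (C := M) fun t ht x => ?_).congr
    fun t ht x => he _ (hρ t ht x)⟩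
  rw [he _ (hρ t ht x)]
  exact hM _ (hρ t ht x)

theorem IsLocalSolution.aestronglyMeasurable_law
    (h : IsLocalSolution P μ lam α ρt T D₀ ρ u G V X φ) (hρ : ∀ t ∈ Icc 0 T, ∀ x, ρ t x ∈ I)
    {g : ℝ → ℝ} (hg : LawLip I g) :
    AEStronglyMeasurable (fun z : ℝ × Plane => g (ρ z.1 z.2)) (volume.restrict (slab T)) :=
  hg.aestronglyMeasurable h.measurable_ρ ((ae_restrict_iff' (isOpen_slab T).measurableSet).2
    (Eventually.of_forall fun _ hz => hρ _ (Ioo_subset_Icc_self hz.1) _))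

end Density

/-! ### The stationary momentum balance -/

/-- `(symOf A) e`, as a linear function of `A`. -/
noncomputable def symOfL (e : Plane) : (Plane →L[ℝ] Plane) →L[ℝ] Plane :=
  LinearMap.toContinuousLinearMap
    { toFun := fun A => symOf A e
      map_add' := fun A B => by simp only [symOf, map_add, smul_apply, add_apply]; module
      map_smul' := fun c A => by
        simp [symOf, smul_comm c] }

theorem symOfL_apply (e : Plane) (A : Plane →L[ℝ] Plane) : symOfL e A = symOf A e := rfl

/-- The divergence, as a linear function of the gradient. -/
noncomputable def divOfL : (Plane →L[ℝ] Plane) →L[ℝ] ℝ :=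
  LinearMap.toContinuousLinearMap
    { toFun := divOf
      map_add' := fun A B => by simp [divOf]; ring
      map_smul' := fun c A => by simp [divOf]; ring }

theorem divOfL_apply (A : Plane →L[ℝ] Plane) : divOfL A = divOf A := rfl

/-- The stress vector `(2 m 𝔻 + l div - p) e`. -/
noncomputable def stress (m l p : ℝ) (A : Plane →L[ℝ] Plane) (e : Plane) : Plane :=
  (2 * m) • symOf A e + (l * divOf A) • e - p • e

theorem stress_apply (m l p : ℝ) (A : Plane →L[ℝ] Plane) (e : Plane) :
    stress m l p A e = (2 * m) • symOfL e A + (l * divOfL A) • e - p • e := by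
  rw [symOfL_apply, divOfL_apply, stress]

theorem isTest_mul {T : ℝ} {θ : ℝ → ℝ} {η : Plane → ℝ}
    (hθ : ContDiff ℝ ((⊤ : ℕ∞) : WithTop ℕ∞) θ) (hθc : HasCompactSupport θ)
    (hθT : tsupport θ ⊆ Ioo 0 T) (hη : ContDiff ℝ ((⊤ : ℕ∞) : WithTop ℕ∞) η)
    (hηc : HasCompactSupport η) : IsTest T fun z : ℝ × Plane => θ z.1 * η z.2 := by
  have hs : tsupport (fun z : ℝ × Plane => θ z.1 * η z.2) ⊆ tsupport θ ×ˢ tsupport η := by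
    refine closure_minimal (fun z hz => ?_) ((isClosed_tsupport _).prod (isClosed_tsupport _))
    have hz' : θ z.1 * η z.2 ≠ 0 := hz
    exact ⟨subset_tsupport _ (left_ne_zero_of_mul hz'), subset_tsupport _
      (right_ne_zero_of_mul hz')⟩
  refine ⟨(hθ.comp contDiff_fst).mul (hη.comp contDiff_snd), ?_, fun z hz =>
    ⟨hθT (hs hz).1, mem_univ _⟩⟩
  exact IsCompact.of_isClosed_subset (hθc.isCompact.prod hηc.isCompact) (isClosed_tsupport _) hs

/-- Time-continuous fields that satisfy a spatial divergence identity in space-time satisfy it at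
every time. -/
theorem integral_eq_zero_of_forall_test {T : ℝ} (hT : 0 < T) {c₀ c₁ d : ℝ → Plane → ℝ}
    (h₀ : ContL1Loc T c₀) (h₁ : ContL1Loc T c₁) (hd : ContL1Loc T d)
    (l₀ : LocallyIntegrableOn (Function.uncurry c₀) (slab T) volume)
    (l₁ : LocallyIntegrableOn (Function.uncurry c₁) (slab T) volume)
    (ld : LocallyIntegrableOn (Function.uncurry d) (slab T) volume)
    (h : ∀ ψ : ℝ × Plane → ℝ, IsTest T ψ →
      ∫ z : ℝ × Plane, (fderiv ℝ ψ z (0, EuclideanSpace.single 0 1) * c₀ z.1 z.2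
        + fderiv ℝ ψ z (0, EuclideanSpace.single 1 1) * c₁ z.1 z.2 + ψ z * d z.1 z.2) = 0)
    {η : Plane → ℝ} (hη : ContDiff ℝ ((⊤ : ℕ∞) : WithTop ℕ∞) η) (hηc : HasCompactSupport η)
    {t : ℝ} (ht : t ∈ Icc 0 T) :
    ∫ x, (fderiv ℝ η x (EuclideanSpace.single 0 1) * c₀ t x
      + fderiv ℝ η x (EuclideanSpace.single 1 1) * c₁ t x + η x * d t x) = 0 := by
  have hc : ∀ v, Continuous fun x => fderiv ℝ η x v := fun v =>
    (hη.continuous_fderiv (by simp)).clm_apply continuous_const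
  have hcs : ∀ v, HasCompactSupport fun x => fderiv ℝ η x v := fun v => hηc.fderiv_apply ℝ v
  set g : ℝ → ℝ := fun t => ∫ x, (fderiv ℝ η x (EuclideanSpace.single 0 1) * c₀ t x
      + fderiv ℝ η x (EuclideanSpace.single 1 1) * c₁ t x + η x * d t x) with hg
  have hgs : ∀ t ∈ Icc 0 T, g t = (∫ x, fderiv ℝ η x (EuclideanSpace.single 0 1) * c₀ t x)
      + (∫ x, fderiv ℝ η x (EuclideanSpace.single 1 1) * c₁ t x) + ∫ x, η x * d t x := by
    intro t ht
    have i0 := h₀.integrable_mul ht (hc (EuclideanSpace.single 0 1)) (hcs _)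
    have i1 := h₁.integrable_mul ht (hc (EuclideanSpace.single 1 1)) (hcs _)
    have i2 := hd.integrable_mul ht hη.continuous hηc
    have i01 : Integrable fun x => fderiv ℝ η x (EuclideanSpace.single 0 1) * c₀ t x
      + fderiv ℝ η x (EuclideanSpace.single 1 1) * c₁ t x := i0.add i1
    rw [← integral_add i0 i1, ← integral_add i01 i2]
  have hK : ∀ {ζ : Plane → ℝ} {c : ℝ → Plane → ℝ}, ContL1Loc T c → Continuous ζ →
      HasCompactSupport ζ → ContinuousOn (fun t => ∫ x, ζ x * c t x) (Icc 0 T) := by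
    intro ζ c hc hζ hζc
    exact hc.continuousOn_integral (ζ := fun _ => ζ) (hζ.comp continuous_snd) hζc.isCompact
      fun t _ x hx => image_eq_zero_of_notMem_tsupport hx
  have hgc : ContinuousOn g (Icc 0 T) :=
    (((hK h₀ (hc _) (hcs _)).add (hK h₁ (hc _) (hcs _))).add
      (hK hd hη.continuous hηc)).congr hgs
  -- Product test functions θ(t) η(x) and Fubini show that g is orthogonal to every θ.
  have hz : ∀ θ : ℝ → ℝ, ContDiff ℝ ((⊤ : ℕ∞) : WithTop ℕ∞) θ → HasCompactSupport θ →
      tsupport θ ⊆ Ioo 0 T → ∫ t, θ t • g t = 0 := by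
    intro θ hθ hθc hθT
    have ht := isTest_mul hθ hθc hθT hη hηc
    have e : ∀ (z : ℝ × Plane) (v : Plane), fderiv ℝ (fun z : ℝ × Plane => θ z.1 * η z.2) z (0, v)
        = θ z.1 * fderiv ℝ η z.2 v := by
      intro z v
      have h1 : HasFDerivAt (fun z : ℝ × Plane => θ z.1) _ z :=
        ((hθ.differentiable (by simp)) z.1).hasFDerivAt.comp z hasFDerivAt_fst
      have h2 : HasFDerivAt (fun z : ℝ × Plane => η z.2) _ z :=
        ((hη.differentiable (by simp)) z.2).hasFDerivAt.comp z hasFDerivAt_snd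
      have h3 : fderiv ℝ (fun z : ℝ × Plane => θ z.1 * η z.2) z = _ := (h1.mul h2).fderiv
      rw [h3]
      simp
    have h3 := h _ ht
    have i0 := ht.integrable_fderiv_smul (0, EuclideanSpace.single 0 1) l₀
    have i1 := ht.integrable_fderiv_smul (0, EuclideanSpace.single 1 1) l₁
    have i2 := ht.integrable_smul ld
    have i3 : Integrable fun z : ℝ × Plane =>
        fderiv ℝ (fun z : ℝ × Plane => θ z.1 * η z.2) z (0, EuclideanSpace.single 0 1) * c₀ z.1 z.2
        + fderiv ℝ (fun z : ℝ × Plane => θ z.1 * η z.2) z (0, EuclideanSpace.single 1 1)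
          * c₁ z.1 z.2 + θ z.1 * η z.2 * d z.1 z.2 := (i0.add i1).add i2
    rw [Measure.volume_eq_prod] at h3 i3
    rw [integral_prod _ i3] at h3
    rw [← h3]
    congr 1
    ext1 t
    rw [hg, smul_eq_mul, ← integral_const_mul]
    congr 1
    ext1 x
    rw [e, e]
    ring
  have hae : ∀ᵐ t, t ∈ Ioo 0 T → g t = 0 := by
    refine isOpen_Ioo.ae_eq_zero_of_integral_contDiff_smul_eq_zero
      ((hgc.mono Ioo_subset_Icc_self).locallyIntegrableOn measurableSet_Ioo) ?_
    intro θ hθ hθc hθT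
    exact hz θ hθ hθc hθT
  have hae' : g =ᵐ[volume.restrict (Icc 0 T)] fun _ => 0 := by
    rw [restrict_Ioo_eq_restrict_Icc.symm]
    exact (ae_restrict_iff' measurableSet_Ioo).2 hae
  -- Continuity of g upgrades the a.e. statement to every time, endpoints included.
  exact Measure.eqOn_Icc_of_ae_eq _ hT.ne hae' hgc continuousOn_const ht

section Momentum

variable {P μ lam : ℝ → ℝ} {α : ℝ≥0} {ρt T : ℝ} {D₀ : Set Plane} {ρ : ℝ → Plane → ℝ}
  {u : ℝ → Plane → Plane} {G : ℝ → Plane → Plane →L[ℝ] Plane} {V X : ℝ → Plane → Plane}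
  {φ : ℝ → Plane → ℝ} {I : Set ℝ} {νmin νmax K : ℝ}

/-- Each coordinate becomes a sum of bounded laws times linear functionals of the gradient, the form
to which `BddContL2.mul_contL1Loc` applies. -/
theorem inner_stress_coord (m l p : ℝ) (A : Plane →L[ℝ] Plane) (e : Plane) (j : Fin 2) :
    stress m l p A e j = 2 * (m * ((EuclideanSpace.proj (𝕜 := ℝ) j).comp (symOfL e)) A)
      + (e j * (l * divOfL A) + (-e j) * p) := by
  rw [stress_apply]
  simp only [PiLp.sub_apply, PiLp.add_apply, PiLp.smul_apply, smul_eq_mul,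
    ContinuousLinearMap.coe_comp, Function.comp_apply, PiLp.proj_apply]
  ring

theorem fderiv_eq_sum (η : Plane → ℝ) (x v : Plane) :
    fderiv ℝ η x v = fderiv ℝ η x (EuclideanSpace.single 0 1) * v 0
      + fderiv ℝ η x (EuclideanSpace.single 1 1) * v 1 := by
  conv_lhs => rw [plane_eq_sum v]
  rw [map_add, map_smul, map_smul, smul_eq_mul, smul_eq_mul]
  ring

/-- The momentum equation, at every time: `div Σ = ρ V`, with the stress tensor `Σ`. -/
theorem IsLocalSolution.integral_stress (h : IsLocalSolution P μ lam α ρt T D₀ ρ u G V X φ)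
    (hT : 0 < T) (hb : LawBounds P μ lam I νmin νmax K) (hI : LawLip I fun r => r)
    (hρ : ∀ t ∈ Icc 0 T, ∀ x, ρ t x ∈ I) {t : ℝ} (ht : t ∈ Icc 0 T) (e : Plane) {η : Plane → ℝ}
    (hη : ContDiff ℝ ((⊤ : ℕ∞) : WithTop ℕ∞) η) (hηc : HasCompactSupport η) :
    ∫ x, fderiv ℝ η x (stress (μ (ρ t x)) (lam (ρ t x)) (P (ρ t x)) (G t x) e)
      = ∫ x, η x * (-(ρ t x * inner ℝ e (V t x))) := by
  have hSm : MeasurableSet (slab T) := (isOpen_slab T).measurableSet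
  have lP : LawLip I P := hb.lawLip (by simp)
  have lμ : LawLip I μ := hb.lawLip (by simp)
  have ll : LawLip I lam := hb.lawLip (by simp)
  obtain ⟨MP, bP⟩ := h.bddContL2 hb hρ lP
  obtain ⟨Mμ, bμ⟩ := h.bddContL2 hb hρ lμ
  obtain ⟨Ml, bl⟩ := h.bddContL2 hb hρ ll
  obtain ⟨Mρ, bρ⟩ := h.bddContL2 hb hρ hI
  have hGl : LocallyIntegrableOn (Function.uncurry G) (slab T) volume :=
    h.gradient_cont.locallyIntegrableOn h.measurable_G
  have hVl : LocallyIntegrableOn (Function.uncurry V) (slab T) volume :=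
    h.material_cont.locallyIntegrableOn h.measurable_V
  have hu : ContinuousOn (Function.uncurry u) (slab T) :=
    h.u_continuous.mono (prod_mono Ioo_subset_Icc_self subset_rfl)
  have hul : LocallyIntegrableOn (Function.uncurry u) (slab T) volume :=
    hu.locallyIntegrableOn hSm
  have hbd : ∀ {g : ℝ → ℝ} {M : ℝ}, BddContL2 T M (fun t x => g (ρ t x)) →
      ∀ z ∈ slab T, ‖g (ρ z.1 z.2)‖ ≤ M := fun hg z hz =>
    (hg z.1 (Ioo_subset_Icc_self hz.1)).2.1 z.2
  let c : Fin 2 → ℝ → Plane → ℝ := fun j t x =>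
    stress (μ (ρ t x)) (lam (ρ t x)) (P (ρ t x)) (G t x) e j
  let d : ℝ → Plane → ℝ := fun t x => ρ t x * inner ℝ e (V t x)
  have hc : ∀ j, ContL1Loc T (c j) := fun j => by
    simp only [c, inner_stress_coord]
    exact ((bμ.mul_contL1Loc (h.gradient_cont.clm_comp _)).const_mul 2).add
      (((bl.mul_contL1Loc (h.gradient_cont.clm_comp divOfL)).const_mul (e j)).add
        (bP.contL1Loc.const_mul (-e j)))
  have hd : ContL1Loc T d := bρ.mul_contL1Loc (h.material_cont.clm_comp (innerSL ℝ e))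
  have hmk : ∀ {g : ℝ → ℝ} {M : ℝ} {f : ℝ × Plane → ℝ}, LawLip I g →
      BddContL2 T M (fun t x => g (ρ t x)) → LocallyIntegrableOn f (slab T) volume →
      LocallyIntegrableOn (fun z : ℝ × Plane => g (ρ z.1 z.2) * f z) (slab T) volume :=
    fun hg hb' hf => hf.bdd_smul_of_bounded hSm (h.aestronglyMeasurable_law hρ hg) (hbd hb')
  have hcl : ∀ j, LocallyIntegrableOn (Function.uncurry (c j)) (slab T) volume := fun j => by
    have e1 : Function.uncurry (c j) = fun z : ℝ × Plane =>
        2 * (μ (ρ z.1 z.2) * ((EuclideanSpace.proj (𝕜 := ℝ) j).comp (symOfL e)) (G z.1 z.2))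
      + (e j * (lam (ρ z.1 z.2) * divOfL (G z.1 z.2)) + (-e j) * P (ρ z.1 z.2)) := by
      ext z
      exact inner_stress_coord _ _ _ _ _ _
    rw [e1]
    exact ((hmk lμ bμ (hGl.clm_comp _)).smul (2 : ℝ)).add
      (((hmk ll bl (hGl.clm_comp divOfL)).smul (e j)).add
        ((locallyIntegrableOn_of_bounded hSm (h.aestronglyMeasurable_law hρ lP) (hbd bP)).smul
          (-e j)))
  have hdl : LocallyIntegrableOn (Function.uncurry d) (slab T) volume :=
    hmk hI bρ (hVl.clm_comp (innerSL ℝ e))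
  have key := integral_eq_zero_of_forall_test hT (hc 0) (hc 1) hd (hcl 0) (hcl 1) hdl ?_ hη hηc ht
  · have i0 : Integrable fun x => fderiv ℝ η x (EuclideanSpace.single 0 1) * c 0 t x
        + fderiv ℝ η x (EuclideanSpace.single 1 1) * c 1 t x :=
      ((hc 0).integrable_mul ht ((hη.continuous_fderiv (by simp)).clm_apply continuous_const)
        (hηc.fderiv_apply ℝ _)).add
      ((hc 1).integrable_mul ht ((hη.continuous_fderiv (by simp)).clm_apply continuous_const)
        (hηc.fderiv_apply ℝ _))
    rw [integral_add i0 (hd.integrable_mul ht hη.continuous hηc)] at key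
    simp only [mul_neg, integral_neg]
    rw [← eq_neg_of_add_eq_zero_left key]
    congr 1
    ext1 x
    rw [fderiv_eq_sum]
  · intro ψ hψ
    -- The inertial terms of the momentum equation equal -∫ ψ ρ V · e, so only the stress and ρV
    -- remain.
    have hmat := integral_mul_material (r := fun z => ρ z.1 z.2) (u := fun z => u z.1 z.2)
      (V := fun z => V z.1 z.2) (G := fun z => G z.1 z.2) h.measurable_ρ (hbd (g := fun r => r) bρ)
      hu hGl hVl h.mass (fun ψ hψ v => integral_smul_gradient h.gradient hul hGl hψ v)
      h.material hψ
    have hmom := h.momentum ψ hψ e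
    have iu : Integrable fun z : ℝ × Plane =>
        (ρ z.1 z.2 * (dt ψ z + dx ψ z (u z.1 z.2))) • u z.1 z.2 := by
      have l1 : LocallyIntegrableOn (fun z : ℝ × Plane => ρ z.1 z.2 • u z.1 z.2) (slab T)
          volume := hul.bdd_smul_of_bounded hSm h.measurable_ρ (hbd (g := fun r => r) bρ)
      have l2 : ∀ j, LocallyIntegrableOn (fun z : ℝ × Plane =>
          ρ z.1 z.2 • (u z.1 z.2 j • u z.1 z.2)) (slab T) volume := fun j =>
        ((((EuclideanSpace.proj (𝕜 := ℝ) j).continuous.comp_continuousOn hu).smul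
          hu).locallyIntegrableOn hSm).bdd_smul_of_bounded hSm h.measurable_ρ
            (hbd (g := fun r => r) bρ)
      refine ((hψ.integrable_fderiv_smul (1, 0) l1).add
        ((hψ.integrable_fderiv_smul (0, EuclideanSpace.single 0 1) (l2 0)).add
        (hψ.integrable_fderiv_smul (0, EuclideanSpace.single 1 1) (l2 1)))).congr
        (Eventually.of_forall fun z => ?_)
      simp only [Pi.add_apply, dx_eq_sum, dt]
      module
    have iV : Integrable fun z : ℝ × Plane => (ψ z * ρ z.1 z.2) • V z.1 z.2 := by
      refine (hψ.integrable_smul (hVl.bdd_smul_of_bounded hSm h.measurable_ρ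
        (hbd (g := fun r => r) bρ))).congr (Eventually.of_forall fun z => ?_)
      simp only [smul_smul]
      rfl
    have h1 := congrArg (fun v => inner ℝ e v) hmat
    simp only [inner_neg_right] at h1
    rw [← integral_inner iu, ← integral_inner iV] at h1
    have i0 : Integrable fun z : ℝ × Plane =>
        fderiv ℝ ψ z (0, EuclideanSpace.single 0 1) * c 0 z.1 z.2
        + fderiv ℝ ψ z (0, EuclideanSpace.single 1 1) * c 1 z.1 z.2 :=
      (hψ.integrable_fderiv_smul _ (hcl 0)).add (hψ.integrable_fderiv_smul _ (hcl 1))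
    have i1 : Integrable fun z : ℝ × Plane => ψ z * d z.1 z.2 := hψ.integrable_smul hdl
    rw [integral_add i0 i1]
    have e2 : ∫ z : ℝ × Plane, ψ z * d z.1 z.2
        = ∫ z : ℝ × Plane, inner ℝ e ((ψ z * ρ z.1 z.2) • V z.1 z.2) := by
      congr 1
      ext1 z
      simp only [d, inner_smul_right]
      ring
    have e3 : (∫ z : ℝ × Plane,
          inner ℝ e ((ρ z.1 z.2 * (dt ψ z + dx ψ z (u z.1 z.2))) • u z.1 z.2))
        - ∫ z : ℝ × Plane, (fderiv ℝ ψ z (0, EuclideanSpace.single 0 1) * c 0 z.1 z.2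
        + fderiv ℝ ψ z (0, EuclideanSpace.single 1 1) * c 1 z.1 z.2) = 0 := by
      rw [← integral_sub (iu.const_inner e) i0]
      refine Eq.trans ?_ hmom
      congr 1
      ext1 z
      have : dx ψ z (stress (μ (ρ z.1 z.2)) (lam (ρ z.1 z.2)) (P (ρ z.1 z.2)) (G z.1 z.2) e)
          = fderiv ℝ ψ z (0, EuclideanSpace.single 0 1) * c 0 z.1 z.2
            + fderiv ℝ ψ z (0, EuclideanSpace.single 1 1) * c 1 z.1 z.2 := by
        rw [dx_eq_sum]
        ring
      rw [← this, inner_smul_right, real_inner_comm]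
      have e4 : ∀ (a : ℝ) (v : Plane), ((0 : ℝ), a • v) = a • ((0 : ℝ), v) := by simp
      have e5 : ∀ v w : Plane, ((0 : ℝ), v + w) = ((0 : ℝ), v) + (0, w) := by simp
      have e6 : ∀ v w : Plane, ((0 : ℝ), v - w) = ((0 : ℝ), v) - (0, w) := by simp
      simp only [stress, dx, e4, e5, e6, map_add, map_sub, map_smul, smul_eq_mul]
      ring
    linarith

end Momentum

/-! ### Traces of the density and of the stress, and the jump conditions. -/

theorem pwHolderNorm_lt_top_iff {F : Type*} [NormedAddCommGroup F] {α : ℝ≥0} {D : Set Plane}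
    {g : Plane → F} : pwHolderNorm α D g < ∞ ↔ eLpNorm g ∞ volume < ∞ ∧
      eHolderNorm α (D.domRestrict g) < ∞ ∧ eHolderNorm α ((closure D)ᶜ.domRestrict g) < ∞ := by
  simp [pwHolderNorm, ENNReal.add_lt_top]

theorem supNorm_nonneg {F : Type*} [NormedAddCommGroup F] (g : Plane → F) : 0 ≤ supNorm g :=
  ENNReal.toReal_nonneg

theorem ae_norm_le_supNorm {F : Type*} [NormedAddCommGroup F] {g : Plane → F}
    (hg : eLpNorm g ∞ volume < ∞) : ∀ᵐ x, ‖g x‖ ≤ supNorm g := by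
  have h := ae_le_eLpNormEssSup (f := g) (μ := volume)
  rw [← eLpNorm_exponent_top] at h
  filter_upwards [h] with x hx
  have := ENNReal.toReal_mono hg.ne hx
  rwa [toReal_enorm] at this

theorem LawLip.tendsto {I : Set ℝ} {g : ℝ → ℝ} (hg : LawLip I g) {A : Type*} {l : Filter A}
    {r : A → ℝ} {a : ℝ} (hr : Tendsto r l (𝓝 a)) (hI : ∀ᶠ z in l, r z ∈ I) (ha : a ∈ I) :
    Tendsto (fun z => g (r z)) l (𝓝 (g a)) := by
  obtain ⟨⟨K, hK, h⟩, -⟩ := hg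
  rw [tendsto_iff_dist_tendsto_zero] at hr ⊢
  refine squeeze_zero' (Eventually.of_forall fun _ => dist_nonneg) ?_
    (by simpa using hr.const_mul K)
  filter_upwards [hI] with z hz
  simpa [Real.dist_eq] using h _ hz _ ha

theorem tendsto_stress {A : Type*} {l : Filter A} {m v p : A → ℝ} {S : A → Plane →L[ℝ] Plane}
    {m' v' p' : ℝ} {S' : Plane →L[ℝ] Plane} (hm : Tendsto m l (𝓝 m')) (hv : Tendsto v l (𝓝 v'))
    (hp : Tendsto p l (𝓝 p')) (hS : Tendsto S l (𝓝 S')) (e : Plane) :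
    Tendsto (fun z => stress (m z) (v z) (p z) (S z) e) l (𝓝 (stress m' v' p' S' e)) := by
  simp only [stress_apply]
  exact (((hm.const_mul 2).smul (((symOfL e).continuous.tendsto _).comp hS)).add
    ((hv.mul ((divOfL.continuous.tendsto _).comp hS)).smul_const e)).sub (hp.smul_const e)

theorem norm_stress_le {m v p M L : ℝ} {S : Plane →L[ℝ] Plane} (hm : |m| ≤ M) (hv : |v| ≤ M)
    (hp : |p| ≤ M) (hS : ‖S‖ ≤ L) (e : Plane) :
    ‖stress m v p S e‖ ≤ 2 * M * (‖symOfL e‖ * L) + M * (‖divOfL‖ * L) * ‖e‖ + M * ‖e‖ := by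
  have hM : 0 ≤ M := (abs_nonneg _).trans hm
  have hL : 0 ≤ L := (norm_nonneg _).trans hS
  rw [stress_apply]
  refine (norm_sub_le _ _).trans (add_le_add ((norm_add_le _ _).trans (add_le_add ?_ ?_)) ?_)
  · rw [norm_smul, norm_mul, Real.norm_two, Real.norm_eq_abs]
    gcongr
    exact ((symOfL e).le_opNorm _).trans (by gcongr)
  · rw [norm_smul, norm_mul, Real.norm_eq_abs]
    gcongr
    exact (divOfL.le_opNorm _).trans (by gcongr)
  · rw [norm_smul, Real.norm_eq_abs]
    gcongr

section Traces

variable {P μ lam : ℝ → ℝ} {α : ℝ≥0} {ρt T : ℝ} {D₀ : Set Plane} {ρ : ℝ → Plane → ℝ}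
  {u : ℝ → Plane → Plane} {G : ℝ → Plane → Plane →L[ℝ] Plane} {V X : ℝ → Plane → Plane}
  {φ : ℝ → Plane → ℝ} {I : Set ℝ} {νmin νmax K : ℝ}

/-- The piecewise Hölder hypothesis concerns the pressure; the density is a Lipschitz function of it
and inherits continuity on each side and the traces. -/
theorem density_tendsto (hα : 0 < α) (hb : LawBounds P μ lam I νmin νmax K)
    (hI : LawLip I fun r => r) {r : Plane → ℝ} (hr : ∀ x, r x ∈ I) {S : Set Plane}
    (hS : eHolderNorm α (S.domRestrict fun x => P (r x) - P ρt) < ∞) :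
    ContinuousOn r S ∧ ∀ σ ∈ closure S, ∃ l, Tendsto r (𝓝[S] σ) (𝓝 l) := by
  obtain ⟨C, f, hf, he⟩ := hb.exists_factor hI (P ρt)
  have e : ∀ x, r x = f (P (r x) - P ρt) := fun x => (he _ (hr x)).symm
  constructor
  · refine ContinuousOn.congr (hf.continuous.comp_continuousOn
      (continuousOn_of_eHolderNorm_lt_top hα hS).continuousOn) fun x _ => e x
  · intro σ hσ
    obtain ⟨l, hl⟩ := exists_tendsto_of_eHolderNorm_lt_top hα hS hσ
    exact ⟨f l, ((hf.continuous.tendsto l).comp hl).congr fun x => (e x).symm⟩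

/-- The jump conditions: continuity of the tangential derivative of the velocity, and of the
normal stress. -/
theorem IsLocalSolution.jump_conditions (h : IsLocalSolution P μ lam α ρt T D₀ ρ u G V X φ)
    (hT : 0 < T) (hb : LawBounds P μ lam I νmin νmax K)
    (hI : LawLip I fun r => r) (hρ : ∀ t ∈ Icc 0 T, ∀ x, ρ t x ∈ I)
    {t : ℝ} (ht : t ∈ Icc 0 T) (hG : eLpNorm (G t) ∞ volume < ∞) {σ : Plane}
    (hσ : σ ∈ frontier (X t '' D₀)) (b : OrthonormalBasis (Fin 2) ℝ Plane)
    (hb0 : b 0 = outwardNormal (φ t) σ) {r s : ℝ} {A B : Plane →L[ℝ] Plane} (hr : r ∈ I)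
    (hs : s ∈ I)
    (tr : Tendsto (ρ t) (𝓝[X t '' D₀] σ) (𝓝 r))
    (ts : Tendsto (ρ t) (𝓝[(closure (X t '' D₀))ᶜ] σ) (𝓝 s))
    (tA : Tendsto (G t) (𝓝[X t '' D₀] σ) (𝓝 A))
    (tB : Tendsto (G t) (𝓝[(closure (X t '' D₀))ᶜ] σ) (𝓝 B)) :
    B (b 1) = A (b 1) ∧ ∀ e, inner ℝ (b 0) (stress (μ s) (lam s) (P s) B e)
      = inner ℝ (b 0) (stress (μ r) (lam r) (P r) A e) := by
  have lP : LawLip I P := hb.lawLip (by simp)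
  have lμ : LawLip I μ := hb.lawLip (by simp)
  have ll : LawLip I lam := hb.lawLip (by simp)
  have hL := ae_norm_le_supNorm hG
  have hin : ∀ y, inner ℝ (b 0) y < (0 : ℝ) → ∀ᶠ r in 𝓝[>] (0 : ℝ), σ + r • y ∈ X t '' D₀ :=
    fun y hy => (h.domain t ht).eventually_mem hσ (hb0 ▸ hy)
  have hout : ∀ y, (0 : ℝ) < inner ℝ (b 0) y →
      ∀ᶠ r in 𝓝[>] (0 : ℝ), σ + r • y ∈ (closure (X t '' D₀))ᶜ :=
    fun y hy => (h.domain t ht).eventually_mem_compl_closure hσ (hb0 ▸ hy)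
  have hGm : AEStronglyMeasurable (G t) volume := (h.gradient_cont t ht).1.1
  refine ⟨(h.gradient t ht).traces_tangential b hGm hL hin hout tA tB, fun e => ?_⟩
  have hlaw : ∀ {g : ℝ → ℝ}, LawLip I g → AEStronglyMeasurable (fun x => g (ρ t x)) volume :=
    fun hg => let ⟨_, hM⟩ := h.bddContL2 hb hρ hg; (hM t ht).1
  have hev : ∀ {l : Filter Plane}, ∀ᶠ x in l, ρ t x ∈ I := Eventually.of_forall (hρ t ht)
  -- The divergence of the stress is square integrable because ρ is bounded and V(t) lies in L²;
  -- this excludes a jump of the normal stress.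
  have hq : MemLp (fun x => -(ρ t x * inner ℝ e (V t x))) 2 volume := by
    obtain ⟨M, hM⟩ := hI.2
    refine ((h.material_cont t ht).1.of_le_mul (c := M * ‖e‖) ?_ ?_)
    · exact ((hlaw hI).mul ((innerSL ℝ e).continuous.comp_aestronglyMeasurable
        (h.material_cont t ht).1.1)).neg
    · refine Eventually.of_forall fun x => ?_
      rw [norm_neg, norm_mul, mul_assoc]
      have h1 := hM _ (hρ t ht x)
      have h2 := norm_inner_le_norm (𝕜 := ℝ) e (V t x)
      exact mul_le_mul h1 h2 (norm_nonneg _) ((abs_nonneg _).trans h1)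
  refine inner_traces_eq b (D := X t '' D₀) (σ := σ)
    (Sg := fun x => stress (μ (ρ t x)) (lam (ρ t x)) (P (ρ t x)) (G t x) e)
    (C := 2 * K * (‖symOfL e‖ * supNorm (G t)) + K * (‖divOfL‖ * supNorm (G t)) * ‖e‖ + K * ‖e‖)
    ?_ ?_ hq ?_ hin hout ?_ ?_
  · simp only [stress_apply]
    exact ((((hlaw lμ).const_mul 2).smul ((symOfL e).continuous.comp_aestronglyMeasurable hGm)).add
      (((hlaw ll).mul (divOfL.continuous.comp_aestronglyMeasurable hGm)).smul_const e)).sub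
      ((hlaw lP).smul_const e)
  · filter_upwards [hL] with x hx
    have hbd : ∀ g ∈ ({P, μ, lam} : Set (ℝ → ℝ)), |g (ρ t x)| ≤ K :=
      hb.bounded _ (hρ t ht x)
    exact norm_stress_le (hbd _ (by simp)) (hbd _ (by simp)) (hbd _ (by simp)) hx e
  · intro η hη hηc
    exact h.integral_stress hT hb hI hρ ht e hη hηc
  · exact tendsto_stress (lμ.tendsto tr hev hr) (ll.tendsto tr hev hr) (lP.tendsto tr hev hr) tA e
  · exact tendsto_stress (lμ.tendsto ts hev hs) (ll.tendsto ts hev hs) (lP.tendsto ts hev hs) tB e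

end Traces

/-! ### Measurability in time of the spatial `L^∞` norm -/

/-- The essential supremum of a slice is at most c exactly when the slice of {|f| > c} is null, and
the measure of slices is a measurable function of t. -/
theorem aemeasurable_eLpNorm_top {F : Type*} [NormedAddCommGroup F] {ν : Measure ℝ} [SFinite ν]
    {g : ℝ × Plane → F} (hg : AEStronglyMeasurable g (ν.prod volume)) :
    AEMeasurable (fun t => eLpNorm (fun x => g (t, x)) ∞ volume) ν := by
  set f := hg.mk g with hf
  have hfm : StronglyMeasurable f := hg.stronglyMeasurable_mk
  refine ⟨fun t => eLpNorm (fun x => f (t, x)) ∞ volume, ?_, ?_⟩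
  · refine measurable_of_Iic fun c => ?_
    have hs : MeasurableSet {z : ℝ × Plane | c < ‖f z‖ₑ} :=
      measurableSet_lt measurable_const hfm.enorm
    have hm := measurable_measure_prodMk_left (ν := (volume : Measure Plane)) hs
    have e : (fun t => eLpNorm (fun x => f (t, x)) ∞ volume) ⁻¹' Iic c
        = (fun t => volume (Prod.mk t ⁻¹' {z : ℝ × Plane | c < ‖f z‖ₑ})) ⁻¹' {0} := by
      ext t
      simp only [mem_preimage, mem_Iic, mem_singleton_iff]
      have h1 : volume (Prod.mk t ⁻¹' {z : ℝ × Plane | c < ‖f z‖ₑ}) = 0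
          ↔ ∀ᵐ x, ‖f (t, x)‖ₑ ≤ c := by
        rw [ae_iff]
        simp only [not_le]
        rfl
      rw [h1, eLpNorm_exponent_top]
      constructor
      · intro h
        filter_upwards [enorm_ae_le_eLpNormEssSup (fun x => f (t, x)) volume] with x hx
        exact hx.trans h
      · intro h
        exact essSup_le_of_ae_le _ h
    rw [e]
    exact hm (measurableSet_singleton 0)
  · filter_upwards [Measure.ae_ae_of_ae_prod hg.ae_eq_mk] with t ht
    exact eLpNorm_congr_ae ht

section Solution

variable {P μ lam : ℝ → ℝ} {α : ℝ≥0} {ρt T : ℝ} {D₀ : Set Plane} {ρ : ℝ → Plane → ℝ}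
  {u : ℝ → Plane → Plane} {G : ℝ → Plane → Plane →L[ℝ] Plane} {V X : ℝ → Plane → Plane}
  {φ : ℝ → Plane → ℝ} {I : Set ℝ} {νmin νmax K : ℝ}

theorem IsLocalSolution.ae_pwHolderNorm_lt_top
    (h : IsLocalSolution P μ lam α ρt T D₀ ρ u G V X φ) :
    ∀ᵐ t, t ∈ Ioo 0 T → pwHolderNorm α (X t '' D₀) (G t) < ∞ :=
  (ae_restrict_iff' measurableSet_Ioo).1 (ae_lt_top' h.gradient_pw_measurable h.gradient_pw.ne)

theorem IsLocalSolution.intervalIntegrable_supNorm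
    (h : IsLocalSolution P μ lam α ρt T D₀ ρ u G V X φ) (hT : 0 ≤ T) :
    IntervalIntegrable (fun τ => supNorm (G τ)) volume 0 T := by
  have hm : AEMeasurable (fun t => eLpNorm (G t) ∞ volume) (volume.restrict (Ioo 0 T)) := by
    have hG : AEStronglyMeasurable (Function.uncurry G)
        (((volume : Measure ℝ).restrict (Ioo 0 T)).prod (volume : Measure Plane)) := by
      rw [← restrict_slab_eq]
      exact h.measurable_G
    have h1 := aemeasurable_eLpNorm_top hG
    simp only [Function.uncurry_apply_pair] at h1
    exact h1
  rw [intervalIntegrable_iff_integrableOn_Ioo_of_le hT]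
  refine integrable_toReal_of_lintegral_ne_top hm (ne_of_lt ?_)
  exact (lintegral_mono fun t => le_self_add).trans_lt h.gradient_pw

end Solution

/-! ### Gronwall's inequality, forwards and backwards -/

theorem exists_lipschitzOnWith_of_hasDerivWithinAt {F : Type*} [NormedAddCommGroup F]
    [NormedSpace ℝ F] {g g' : ℝ → F} {t : ℝ}
    (hg : ∀ s ∈ Icc 0 t, HasDerivWithinAt g (g' s) (Icc 0 t) s)
    (hc : ContinuousOn g' (Icc 0 t)) :
    ∃ C, LipschitzOnWith C g (Icc 0 t) := by
  obtain ⟨C, hC⟩ := isCompact_Icc.exists_bound_of_continuousOn hc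
  refine ⟨C.toNNReal, (convex_Icc 0 t).lipschitzOnWith_of_nnnorm_hasDerivWithin_le hg
    fun s hs => ?_⟩
  rw [← NNReal.coe_le_coe, coe_nnnorm]
  exact (hC s hs).trans (Real.le_coe_toNNReal C)

/-- The hypothesis bounds |g'|, so it is invariant under the time reversal s ↦ t - s; the reversed
inequality is what makes the flow injective. -/
theorem gronwall_two_sided {g g' L : ℝ → ℝ} {t : ℝ} (ht : 0 ≤ t)
    (hg : ∀ s ∈ Icc 0 t, HasDerivWithinAt g (g' s) (Icc 0 t) s)
    (hc : ContinuousOn g' (Icc 0 t)) (hL : IntervalIntegrable L volume 0 t)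
    (h : ∀ᵐ s, s ∈ Ioo 0 t → |g' s| ≤ L s * g s) :
    g t ≤ g 0 * Real.exp (∫ s in (0 : ℝ)..t, L s) ∧
      g 0 ≤ g t * Real.exp (∫ s in (0 : ℝ)..t, L s) := by
  obtain ⟨C, hC⟩ := exists_lipschitzOnWith_of_hasDerivWithinAt hg hc
  have hd : ∀ s ∈ Ioo 0 t, HasDerivAt g (g' s) s := fun s hs =>
    (hg s (Ioo_subset_Icc_self hs)).hasDerivAt (Icc_mem_nhds hs.1 hs.2)
  have hsub : MapsTo (fun s => t - s) (Icc 0 t) (Icc 0 t) := fun s hs =>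
    ⟨by linarith [hs.2], by linarith [hs.1]⟩
  constructor
  · refine le_mul_exp_of_deriv_le ht ?_ hL ?_
    · refine LipschitzOnWith.absolutelyContinuousOnInterval (K := C) ?_
      rwa [uIcc_of_le ht]
    · filter_upwards [h] with s hs hst
      rw [(hd s hst).deriv]
      exact (le_abs_self _).trans (hs hst)
  · have hCr : LipschitzOnWith C (fun s => g (t - s)) (Icc 0 t) := by
      have h1 : LipschitzOnWith 1 (fun s : ℝ => t - s) (Icc 0 t) :=
        LipschitzOnWith.of_dist_le_mul fun x _ y _ => by
          rw [NNReal.coe_one, one_mul, dist_sub_left]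
      have h2 := hC.comp h1 hsub
      rwa [mul_one] at h2
    have hLr : IntervalIntegrable (fun s => L (t - s)) volume 0 t := by
      simpa using (hL.comp_sub_left t).symm
    have key := le_mul_exp_of_deriv_le (g := fun s => g (t - s)) (a := fun s => L (t - s)) ht
      (LipschitzOnWith.absolutelyContinuousOnInterval (by rwa [uIcc_of_le ht])) hLr ?_
    · simpa [intervalIntegral.integral_comp_sub_left (fun s => L s) t] using key
    · have h2 := (Measure.measurePreserving_sub_left volume t).quasiMeasurePreserving.ae h
      filter_upwards [h2] with s hs hst
      have hst' : t - s ∈ Ioo 0 t := ⟨by linarith [hst.2], by linarith [hst.1]⟩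
      have h3 : HasDerivAt (fun s => g (t - s)) (-g' (t - s)) s := by
        have h4 := (hd _ hst').scomp s ((hasDerivAt_id s).const_sub t)
        rwa [neg_one_smul] at h4
      rw [h3.deriv]
      exact (neg_le_abs _).trans (hs hst')

/-- Distances along the flow of a vector field with integrable Lipschitz constants. -/
theorem flow_dist_le {u X : ℝ → Plane → Plane} {L : ℝ → ℝ} {T : ℝ}
    (hu : ContinuousOn (Function.uncurry u) (Icc 0 T ×ˢ univ))
    (hX : ∀ x, ∀ t ∈ Icc 0 T, HasDerivWithinAt (fun τ => X τ x) (u t (X t x)) (Icc 0 T) t)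
    (hL : IntervalIntegrable L volume 0 T)
    (h : ∀ᵐ t, t ∈ Ioo 0 T → ∀ x y, ‖u t x - u t y‖ ≤ L t * ‖x - y‖) {t : ℝ} (ht : t ∈ Icc 0 T)
    (x y : Plane) :
    ‖X t x - X t y‖ ≤ ‖X 0 x - X 0 y‖ * Real.exp (∫ s in (0 : ℝ)..t, L s) ∧
      ‖X 0 x - X 0 y‖ ≤ ‖X t x - X t y‖ * Real.exp (∫ s in (0 : ℝ)..t, L s) := by
  have hsub : Icc 0 t ⊆ Icc 0 T := Icc_subset_Icc_right ht.2
  have hXc : ∀ x, ContinuousOn (fun s => X s x) (Icc 0 t) := fun x s hs =>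
    ((hX x s (hsub hs)).continuousWithinAt).mono hsub
  have huX : ∀ x, ContinuousOn (fun s => u s (X s x)) (Icc 0 t) := fun x =>
    hu.comp (continuousOn_id.prodMk (hXc x)) fun s hs => ⟨hsub hs, mem_univ _⟩
  have hd : ∀ s ∈ Icc 0 t, HasDerivWithinAt (fun s => X s x - X s y)
      (u s (X s x) - u s (X s y)) (Icc 0 t) s := fun s hs =>
    ((hX x s (hsub hs)).sub (hX y s (hsub hs))).mono hsub
  have hLt : IntervalIntegrable L volume 0 t :=
    hL.mono_set (by rw [uIcc_of_le ht.1, uIcc_of_le (ht.1.trans ht.2)]; exact hsub)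
  -- The squared distance is differentiable even where the distance vanishes; the doubled rate is
  -- undone by the square root at the end.
  have key := gronwall_two_sided (g := fun s => ‖X s x - X s y‖ ^ 2)
    (g' := fun s => 2 * inner ℝ (X s x - X s y) (u s (X s x) - u s (X s y)))
    (L := fun s => 2 * L s) ht.1 (fun s hs => (hd s hs).norm_sq)
    ((((hXc x).sub (hXc y)).inner ((huX x).sub (huX y)) (𝕜 := ℝ)).const_smul (2 : ℝ)) (hLt.const_mul 2)
    ?_
  · have e : Real.exp (∫ s in (0 : ℝ)..t, 2 * L s) = Real.exp (∫ s in (0 : ℝ)..t, L s) ^ 2 := by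
      rw [intervalIntegral.integral_const_mul, ← Real.exp_nat_mul]
      norm_num
    simp only [e, ← mul_pow] at key
    exact ⟨le_of_sq_le_sq key.1 (by positivity), le_of_sq_le_sq key.2 (by positivity)⟩
  · filter_upwards [h] with s hs hst
    have h1 := hs ⟨hst.1, hst.2.trans_le ht.2⟩ (X s x) (X s y)
    rw [abs_mul, abs_two, mul_assoc]
    gcongr
    calc |inner ℝ (X s x - X s y) (u s (X s x) - u s (X s y))|
        ≤ ‖X s x - X s y‖ * ‖u s (X s x) - u s (X s y)‖ := abs_real_inner_le_norm _ _
      _ ≤ ‖X s x - X s y‖ * (L s * ‖X s x - X s y‖) := by gcongr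
      _ = _ := by ring

/-! ### Images of domains under continuous injective maps -/

theorem closure_image_of_isBounded {f : Plane → Plane} (hf : Continuous f) {D : Set Plane}
    (hD : Bornology.IsBounded D) : closure (f '' D) = f '' closure D :=
  (closure_minimal (image_mono subset_closure)
    (hD.isCompact_closure.image hf).isClosed).antisymm (image_closure_subset_closure_image hf)

theorem frontier_image_of_isBounded {f : Plane → Plane} (hf : Continuous f)
    (hi : Function.Injective f) {D : Set Plane} (hD : Bornology.IsBounded D) (hDo : IsOpen D)
    (hfD : IsOpen (f '' D)) : frontier (f '' D) = f '' frontier D := by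
  rw [hfD.frontier_eq, hDo.frontier_eq, closure_image_of_isBounded hf hD, image_sdiff hi]

/-! ### Moving test functions -/

/-- The velocity is frozen outside `[0, T]` and integrated, which makes a particle path a C¹ curve
on the whole line. -/
theorem exists_contDiff_extension {γ γ' : ℝ → Plane} {T : ℝ} (hT : 0 ≤ T)
    (h : ∀ t ∈ Icc 0 T, HasDerivWithinAt γ (γ' t) (Icc 0 T) t)
    (hc : ContinuousOn γ' (Icc 0 T)) :
    ∃ ξ : ℝ → Plane, ContDiff ℝ 1 ξ ∧ ∀ t ∈ Icc 0 T, ξ t = γ t ∧ deriv ξ t = γ' t := by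
  set v : ℝ → Plane := fun s => γ' (projIcc 0 T hT s) with hv
  have hvc : Continuous v :=
    hc.domRestrict.comp continuous_projIcc
  have hve : ∀ t ∈ Icc 0 T, v t = γ' t := fun t ht => by
    simp only [hv, projIcc_of_mem hT ht]
  have hd : ∀ t, HasDerivAt (fun t => γ 0 + ∫ s in (0 : ℝ)..t, v s) (v t) t := fun t =>
    (hvc.integral_hasStrictDerivAt 0 t).hasDerivAt.const_add _
  have hd' : deriv (fun t => γ 0 + ∫ s in (0 : ℝ)..t, v s) = v := funext fun t => (hd t).deriv
  refine ⟨fun t => γ 0 + ∫ s in (0 : ℝ)..t, v s, ?_, fun t ht => ⟨?_, ?_⟩⟩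
  · rw [contDiff_one_iff_deriv]
    exact ⟨fun t => (hd t).differentiableAt, by rw [hd']; exact hvc⟩
  · have hsub : Icc 0 t ⊆ Icc 0 T := Icc_subset_Icc_right ht.2
    show γ 0 + ∫ s in (0 : ℝ)..t, v s = γ t
    rw [intervalIntegral.integral_eq_sub_of_hasDerivAt_of_le (f := γ) ht.1
      (fun s hs => (h s (hsub hs)).continuousWithinAt.mono hsub) (fun s hs => ?_)
      (hvc.intervalIntegrable _ _)]
    · abel
    · have hs' := hsub (Ioo_subset_Icc_self hs)
      rw [hve s hs']
      exact (h s hs').hasDerivAt (Icc_mem_nhds hs.1 (hs.2.trans_le ht.2))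
  · rw [hd', hve t ht]

section Moving

variable {T δ C : ℝ} {r : ℝ → Plane → ℝ} {u : ℝ → Plane → Plane} {ξ : ℝ → Plane} {η : Plane → ℝ}

/-- The mass equation is tested with θ(t) η((x - ξ(t))/δ). As θ is arbitrary, the mass seen by the
moving bump has a primitive in time, and only the velocity relative to ξ enters its rate. -/
theorem sub_eq_integral_moving (hT : 0 < T) (hu : Continuous (Function.uncurry u))
    (hr : AEStronglyMeasurable (Function.uncurry r) (volume.restrict (slab T)))
    (hrC : ∀ z ∈ slab T, ‖r z.1 z.2‖ ≤ C) (hrL : ContL1Loc T r)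
    (hmass : ∀ ψ, IsTest T ψ → ∫ z : ℝ × Plane, r z.1 z.2 * (dt ψ z + dx ψ z (u z.1 z.2)) = 0)
    (hξ : ContDiff ℝ 1 ξ) (hη : ContDiff ℝ ((⊤ : ℕ∞) : WithTop ℕ∞) η) (hηc : HasCompactSupport η)
    (hδ : 0 < δ) :
    ContinuousOn (fun τ => ∫ x, (δ⁻¹ * fderiv ℝ η (δ⁻¹ • (x - ξ τ)) (u τ x - deriv ξ τ)) * r τ x)
      (Icc 0 T) ∧
    ∀ t ∈ Icc 0 T, (∫ x, η (δ⁻¹ • (x - ξ t)) * r t x) - ∫ x, η (δ⁻¹ • (x - ξ 0)) * r 0 x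
      = ∫ τ in (0 : ℝ)..t,
        ∫ x, (δ⁻¹ * fderiv ℝ η (δ⁻¹ • (x - ξ τ)) (u τ x - deriv ξ τ)) * r τ x := by
  set a : ℝ → Plane → ℝ := fun t x => η (δ⁻¹ • (x - ξ t)) with ha
  set c : ℝ → Plane → ℝ := fun τ x =>
    δ⁻¹ * fderiv ℝ η (δ⁻¹ • (x - ξ τ)) (u τ x - deriv ξ τ) with hc
  have hξc := hξ.continuous
  have hξd : Continuous (deriv ξ) := hξ.continuous_deriv_one
  have hηd : Continuous (fderiv ℝ η) := hη.continuous_fderiv (by simp)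
  have hac : Continuous (Function.uncurry a) := hη.continuous.comp
    ((continuous_snd.sub (hξc.comp continuous_fst)).const_smul δ⁻¹)
  have hcc : Continuous (Function.uncurry c) := by
    refine continuous_const.mul (Continuous.clm_apply (hηd.comp
      ((continuous_snd.sub (hξc.comp continuous_fst)).const_smul δ⁻¹)) ?_)
    exact hu.sub (hξd.comp continuous_fst)
  -- compact supports
  have hKS : ∀ {S : Set ℝ}, IsCompact S →
      IsCompact ((fun z : ℝ × Plane => (z.1, ξ z.1 + δ • z.2)) '' (S ×ˢ tsupport η)) := fun hS =>
    (hS.prod hηc.isCompact).image (by fun_prop)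
  have hzero : ∀ (S : Set ℝ) (t : ℝ) (x : Plane), t ∈ S →
      (t, x) ∉ (fun z : ℝ × Plane => (z.1, ξ z.1 + δ • z.2)) '' (S ×ˢ tsupport η) →
      a t x = 0 ∧ c t x = 0 := by
    intro S t x ht hx
    have hn : δ⁻¹ • (x - ξ t) ∉ tsupport η := fun hm => hx ⟨(t, δ⁻¹ • (x - ξ t)), ⟨ht, hm⟩, by
      simp [smul_smul, hδ.ne']⟩
    have h0 : η (δ⁻¹ • (x - ξ t)) = 0 := image_eq_zero_of_notMem_tsupport hn
    refine ⟨h0, ?_⟩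
    have : fderiv ℝ η (δ⁻¹ • (x - ξ t)) = 0 :=
      image_eq_zero_of_notMem_tsupport fun hm => hn (tsupport_fderiv_subset ℝ hm)
    simp [hc, this]
  set K : Set Plane := Prod.snd ''
    ((fun z : ℝ × Plane => (z.1, ξ z.1 + δ • z.2)) '' (Icc 0 T ×ˢ tsupport η)) with hK
  have hKc : IsCompact K := (hKS isCompact_Icc).image continuous_snd
  have hz : ∀ t ∈ Icc 0 T, ∀ x, x ∉ K → a t x = 0 ∧ c t x = 0 := fun t ht x hx =>
    hzero _ t x ht fun hm => hx ⟨_, hm, rfl⟩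
  have hR : ContinuousOn (fun t => ∫ x, a t x * r t x) (Icc 0 T) :=
    hrL.continuousOn_integral hac hKc fun t ht x hx => (hz t ht x hx).1
  have hQ : ContinuousOn (fun t => ∫ x, c t x * r t x) (Icc 0 T) :=
    hrL.continuousOn_integral hcc hKc fun t ht x hx => (hz t ht x hx).2
  refine ⟨hQ, sub_eq_integral_of_forall_test hT hR ?_ ?_⟩
  · exact ContinuousOn.intervalIntegrable (by rwa [uIcc_of_le hT.le])
  intro θ hθ hθc hθT
  set ψ : ℝ × Plane → ℝ := fun z => θ z.1 * a z.1 z.2 with hψ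
  set K' := (fun z : ℝ × Plane => (z.1, ξ z.1 + δ • z.2)) '' (tsupport θ ×ˢ tsupport η) with hK'
  have hK'c : IsCompact K' := hKS hθc.isCompact
  have hK's : K' ⊆ slab T := by
    rintro _ ⟨z, hz, rfl⟩
    exact ⟨hθT hz.1, mem_univ _⟩
  have hoff : ∀ z, z ∉ K' → θ z.1 * a z.1 z.2 = 0 ∧
      deriv θ z.1 * a z.1 z.2 + θ z.1 * c z.1 z.2 = 0 := by
    intro z hz
    by_cases ht : z.1 ∈ tsupport θ
    · obtain ⟨h1, h2⟩ := hzero _ z.1 z.2 ht hz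
      simp [h1, h2]
    · have h1 : θ z.1 = 0 := image_eq_zero_of_notMem_tsupport ht
      have h2 : deriv θ z.1 = 0 :=
        image_eq_zero_of_notMem_tsupport fun hm => ht (tsupport_deriv_subset hm)
      simp [h1, h2]
  have hsupp : ∀ f : ℝ × Plane → ℝ, (∀ z, z ∉ K' → f z = 0) → tsupport f ⊆ K' := fun f hf =>
    closure_minimal (fun z hz => by
      by_contra hne
      exact hz (hf z hne)) hK'c.isClosed
  have hψs := hsupp ψ fun z hz => (hoff z hz).1
  have hψ1 : ContDiff ℝ 1 ψ :=
    ((hθ.of_le (by simp)).comp contDiff_fst).mul ((hη.of_le (by simp)).comp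
      ((contDiff_snd.sub (hξ.comp contDiff_fst)).const_smul δ⁻¹))
  -- The transport derivative of the bump involves only u - ξ'; if ξ is a path of u, this difference
  -- vanishes at the centre and offsets the factor 1/δ.
  have hder : ∀ z : ℝ × Plane, dt ψ z + dx ψ z (u z.1 z.2)
      = deriv θ z.1 * a z.1 z.2 + θ z.1 * c z.1 z.2 := by
    intro z
    have h1 : HasFDerivAt (fun z : ℝ × Plane => θ z.1) _ z :=
      ((hθ.differentiable (by simp)) z.1).hasDerivAt.hasFDerivAt.comp z hasFDerivAt_fst
    have h2 : HasFDerivAt (fun z : ℝ × Plane => ξ z.1) _ z :=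
      ((hξ.differentiable one_ne_zero) z.1).hasDerivAt.hasFDerivAt.comp z hasFDerivAt_fst
    have h3 : HasFDerivAt (fun z : ℝ × Plane => δ⁻¹ • (z.2 - ξ z.1)) _ z :=
      (hasFDerivAt_snd.sub h2).const_smul δ⁻¹
    have h4 : HasFDerivAt (fun z : ℝ × Plane => η (δ⁻¹ • (z.2 - ξ z.1))) _ z :=
      ((hη.differentiable (by simp)) _).hasFDerivAt.comp z h3
    have h5 : fderiv ℝ ψ z = _ := (h1.mul h4).fderiv
    rw [dt, dx, h5]
    simp only [ha, hc, add_apply, smul_apply, ContinuousLinearMap.coe_comp, Function.comp_apply,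
      ContinuousLinearMap.coe_fst', ContinuousLinearMap.coe_snd',
      ContinuousLinearMap.toSpanSingleton_apply, smul_eq_mul, map_sub, map_smul, one_smul,
      map_zero, sub_apply, zero_sub, sub_zero, map_neg]
    ring
  have hm := integral_mass_of_contDiff_one (r := Function.uncurry r) (u := Function.uncurry u)
    hr hrC hu.continuousOn hmass hψ1 (hK'c.of_isClosed_subset (isClosed_tsupport _) hψs)
    (hψs.trans hK's)
  have hwc : Continuous fun z : ℝ × Plane => deriv θ z.1 * a z.1 z.2 + θ z.1 * c z.1 z.2 :=
    (((hθ.continuous_deriv (by simp)).comp continuous_fst).mul hac).add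
      ((hθ.continuous.comp continuous_fst).mul hcc)
  have hws := hsupp _ fun z hz => (hoff z hz).2
  have hi : Integrable fun z : ℝ × Plane =>
      (deriv θ z.1 * a z.1 z.2 + θ z.1 * c z.1 z.2) * r z.1 z.2 :=
    (locallyIntegrableOn_of_bounded (isOpen_slab T).measurableSet hr
      hrC).integrable_smul_of_tsupport_subset hwc
      (hK'c.of_isClosed_subset (isClosed_tsupport _) hws) (hws.trans hK's)
  have hm' : ∫ z : ℝ × Plane, (deriv θ z.1 * a z.1 z.2 + θ z.1 * c z.1 z.2) * r z.1 z.2 = 0 := by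
    rw [← hm]
    congr 1
    ext1 z
    have := hder z
    simp only [Function.uncurry] at this ⊢
    rw [this, mul_comm]
  rw [Measure.volume_eq_prod] at hm' hi
  rw [integral_prod _ hi] at hm'
  rw [← setIntegral_eq_integral_of_forall_compl_eq_zero (s := Ioo 0 T)] at hm'
  · refine Eq.trans ?_ hm'
    refine setIntegral_congr_fun measurableSet_Ioo fun t ht => ?_
    have ht' := Ioo_subset_Icc_self ht
    have hint : ∀ f : ℝ → Plane → ℝ, Continuous (Function.uncurry f) →
        (∀ x, x ∉ K → f t x = 0) → Integrable fun x => f t x * r t x := by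
      intro f hf hf0
      have hs : tsupport (f t) ⊆ K := closure_minimal (fun x hx => by
        by_contra hne
        exact hx (hf0 x hne)) hKc.isClosed
      exact hrL.integrable_mul ht' (hf.comp (Continuous.prodMk_right t))
        (hKc.of_isClosed_subset (isClosed_tsupport _) hs)
    have i1 := hint a hac fun x hx => (hz t ht' x hx).1
    have i2 := hint c hcc fun x hx => (hz t ht' x hx).2
    simp only
    rw [← integral_const_mul, ← integral_const_mul, ← integral_add (i1.const_mul _)
      (i2.const_mul _)]
    congr 1
    ext1 x
    ring
  · intro t ht
    have h2 : ∀ x, (t, x) ∉ K' := fun x hx => ht (hK's hx).1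
    have h3 : ∀ x, deriv θ t * a t x + θ t * c t x = 0 := fun x => (hoff (t, x) (h2 x)).2
    simp only [h3, zero_mul, integral_zero]

/-- In the variable z = (x - ξ)/δ both sides carry the Jacobian δ², which cancels, so the limit δ →
0 can be taken over a fixed support. -/
theorem sub_eq_integral_moving_rescaled (hT : 0 < T) (hu : Continuous (Function.uncurry u))
    (hr : AEStronglyMeasurable (Function.uncurry r) (volume.restrict (slab T)))
    (hrC : ∀ z ∈ slab T, ‖r z.1 z.2‖ ≤ C) (hrL : ContL1Loc T r)
    (hmass : ∀ ψ, IsTest T ψ → ∫ z : ℝ × Plane, r z.1 z.2 * (dt ψ z + dx ψ z (u z.1 z.2)) = 0)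
    (hξ : ContDiff ℝ 1 ξ) (hη : ContDiff ℝ ((⊤ : ℕ∞) : WithTop ℕ∞) η) (hηc : HasCompactSupport η)
    (hδ : 0 < δ) :
    ContinuousOn (fun τ => ∫ z, (δ⁻¹ * fderiv ℝ η z (u τ (ξ τ + δ • z) - deriv ξ τ))
      * r τ (ξ τ + δ • z)) (Icc 0 T) ∧
    ∀ t ∈ Icc 0 T, (∫ z, η z * r t (ξ t + δ • z)) - ∫ z, η z * r 0 (ξ 0 + δ • z)
      = ∫ τ in (0 : ℝ)..t,
        ∫ z, (δ⁻¹ * fderiv ℝ η z (u τ (ξ τ + δ • z) - deriv ξ τ)) * r τ (ξ τ + δ • z) := by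
  obtain ⟨h1, h2⟩ := sub_eq_integral_moving hT hu hr hrC hrL hmass hξ hη hηc hδ
  have e1 : ∀ t, ∫ x, η (δ⁻¹ • (x - ξ t)) * r t x
      = δ ^ 2 • ∫ z, η z * r t (ξ t + δ • z) := fun t => by
    rw [smul_integral_comp _ (ξ t) hδ]
    simp only [inv_smul_add_smul_sub _ _ hδ]
  have e2 : ∀ τ, ∫ x, (δ⁻¹ * fderiv ℝ η (δ⁻¹ • (x - ξ τ)) (u τ x - deriv ξ τ)) * r τ x
      = δ ^ 2 • ∫ z, (δ⁻¹ * fderiv ℝ η z (u τ (ξ τ + δ • z) - deriv ξ τ)) * r τ (ξ τ + δ • z) :=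
    fun τ => by
      rw [smul_integral_comp _ (ξ τ) hδ]
      simp only [inv_smul_add_smul_sub _ _ hδ]
  have hδ2 : δ ^ 2 ≠ 0 := by positivity
  simp only [e1, e2, smul_eq_mul] at h1 h2
  refine ⟨?_, fun t ht => ?_⟩
  · refine (h1.const_smul (δ ^ 2)⁻¹).congr fun τ _ => ?_
    simp [hδ2]
  · have h3 := h2 t ht
    rw [intervalIntegral.integral_const_mul, ← mul_sub] at h3
    exact mul_left_cancel₀ hδ2 h3

end Moving

/-! ### Blow-up at a point of continuity -/

section Blowup

theorem integral_fderiv_eq_zero {η : Plane → ℝ} (hη : ContDiff ℝ ((⊤ : ℕ∞) : WithTop ℕ∞) η)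
    (hηc : HasCompactSupport η) (v : Plane) : ∫ z, fderiv ℝ η z v = 0 := by
  have hi : Integrable fun z => fderiv ℝ η z v :=
    ((hη.continuous_fderiv (by simp)).clm_apply continuous_const).integrable_of_hasCompactSupport
      (hηc.fderiv_apply ℝ v)
  have := integral_mul_fderiv_eq_neg_fderiv_mul_of_integrable (μ := (volume : Measure Plane))
    (f := fun _ => (1 : ℝ)) (g := η) (v := v) (by simp) (by simpa using hi)
    (by simpa using hη.continuous.integrable_of_hasCompactSupport hηc)
    (fun x _ => differentiableAt_const _) (fun x _ => hη.differentiable (by simp) x)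
  simpa using this

variable {η : Plane → ℝ} {c : Plane}

theorem tendsto_integral_blowup_of_continuousAt {f : Plane → ℝ} {C : ℝ}
    (hf : AEStronglyMeasurable f volume) (hC : ∀ᵐ x, ‖f x‖ ≤ C) (hc : ContinuousAt f c)
    (hη : Continuous η) (hηc : HasCompactSupport η) :
    Tendsto (fun r : ℝ => ∫ z, η z * f (c + r • z)) (𝓝[>] 0) (𝓝 ((∫ z, η z) * f c)) := by
  rw [← integral_mul_const]
  have hq : ∀ r : ℝ, r ∈ Ioi 0 → Measure.QuasiMeasurePreserving
      (fun y : Plane => c + r • y) volume volume := fun r hr =>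
    quasiMeasurePreserving_add_smul c (ne_of_gt hr)
  refine tendsto_integral_filter_of_dominated_convergence (fun z => ‖η z‖ * C) ?_ ?_ ?_ ?_
  · filter_upwards [self_mem_nhdsWithin] with r hr
    exact hη.aestronglyMeasurable.mul (hf.comp_quasiMeasurePreserving (hq r hr))
  · filter_upwards [self_mem_nhdsWithin] with r hr
    filter_upwards [(hq r hr).ae hC] with z hz
    rw [norm_mul]
    gcongr
  · exact ((hη.integrable_of_hasCompactSupport hηc).norm).mul_const C
  · refine Eventually.of_forall fun z => ?_
    refine Tendsto.const_mul _ (hc.tendsto.comp ?_)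
    have h1 : Tendsto (fun r : ℝ => c + r • z) (𝓝 0) (𝓝 (c + (0 : ℝ) • z)) :=
      (Continuous.tendsto (by fun_prop) 0)
    rw [zero_smul, add_zero] at h1
    exact h1.mono_left nhdsWithin_le_nhds

/-- The difference quotient is bounded by L|z|, so r may be frozen at c by dominated convergence.
With r frozen, integration by parts moves the derivative from η to w and leaves an average of div w
around c. -/
theorem tendsto_integral_difference_quotient {w : Plane → Plane} {G : Plane → Plane →L[ℝ] Plane}
    {r : Plane → ℝ} {L C : ℝ} (h : IsWeakGradient w G) (hw : Continuous w)
    (hG : AEStronglyMeasurable G volume) (hL : ∀ᵐ x, ‖G x‖ ≤ L)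
    (hr : AEStronglyMeasurable r volume) (hC : ∀ x, ‖r x‖ ≤ C) (hGc : ContinuousAt G c)
    (hrc : ContinuousAt r c) (hη : ContDiff ℝ ((⊤ : ℕ∞) : WithTop ℕ∞) η)
    (hηc : HasCompactSupport η) (hη1 : ∫ z, η z = 1) :
    Tendsto (fun δ : ℝ => ∫ z, (δ⁻¹ * fderiv ℝ η z (w (c + δ • z) - w c)) * r (c + δ • z))
      (𝓝[>] 0) (𝓝 (-(r c * divOf (G c)))) := by
  have hηd : ∀ v, Continuous fun z => fderiv ℝ η z v := fun v =>
    (hη.continuous_fderiv (by simp)).clm_apply continuous_const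
  have hηdc : ∀ v, HasCompactSupport fun z => fderiv ℝ η z v := fun v => hηc.fderiv_apply ℝ v
  have hlip := h.norm_sub_le hw hL
  have hpt : ∀ δ : ℝ, 0 < δ → ∀ z, ‖δ⁻¹ * fderiv ℝ η z (w (c + δ • z) - w c)‖
      ≤ ‖fderiv ℝ η z‖ * (L * ‖z‖) := by
    intro δ hδ z
    rw [norm_mul, norm_inv, Real.norm_of_nonneg hδ.le]
    calc δ⁻¹ * ‖fderiv ℝ η z (w (c + δ • z) - w c)‖
        ≤ δ⁻¹ * (‖fderiv ℝ η z‖ * (L * (δ * ‖z‖))) := by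
          gcongr
          refine ((fderiv ℝ η z).le_opNorm _).trans ?_
          gcongr
          refine (hlip _ _).trans_eq ?_
          rw [add_sub_cancel_left, norm_smul, Real.norm_of_nonneg hδ.le]
      _ = _ := by field_simp
  have hcont : ∀ δ : ℝ, Continuous fun z => δ⁻¹ * fderiv ℝ η z (w (c + δ • z) - w c) := fun δ =>
    continuous_const.mul (Continuous.clm_apply (hη.continuous_fderiv (by simp)) (by fun_prop))
  have hsupp : ∀ δ : ℝ, HasCompactSupport fun z => δ⁻¹ * fderiv ℝ η z (w (c + δ • z) - w c) :=
    fun δ => (hηc.fderiv ℝ).mono fun z hz => by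
      contrapose! hz
      simp only [Function.mem_support, not_not] at hz ⊢
      simp [hz]
  have hq : ∀ r : ℝ, r ∈ Ioi 0 → Measure.QuasiMeasurePreserving
      (fun y : Plane => c + r • y) volume volume := fun r hr =>
    quasiMeasurePreserving_add_smul c (ne_of_gt hr)
  have hdom : Integrable fun z => ‖fderiv ℝ η z‖ * (L * ‖z‖) := by
    refine Continuous.integrable_of_hasCompactSupport ?_ ?_
    · exact (hη.continuous_fderiv (by simp)).norm.mul (by fun_prop)
    · exact (hηc.fderiv ℝ).norm.mul_right
  -- the error from freezing the density
  have t2 : Tendsto (fun δ : ℝ => ∫ z, (δ⁻¹ * fderiv ℝ η z (w (c + δ • z) - w c))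
      * (r (c + δ • z) - r c)) (𝓝[>] 0) (𝓝 (∫ _ : Plane, (0 : ℝ))) := by
    refine tendsto_integral_filter_of_dominated_convergence
      (fun z => ‖fderiv ℝ η z‖ * (L * ‖z‖) * (C + C)) ?_ ?_ (hdom.mul_const _) ?_
    · filter_upwards [self_mem_nhdsWithin] with δ hδ
      exact (hcont δ).aestronglyMeasurable.mul
        ((hr.comp_quasiMeasurePreserving (hq δ hδ)).sub aestronglyMeasurable_const)
    · filter_upwards [self_mem_nhdsWithin] with δ hδ
      refine Eventually.of_forall fun z => ?_
      rw [norm_mul]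
      exact mul_le_mul (hpt δ hδ z) ((norm_sub_le _ _).trans (add_le_add (hC _) (hC _)))
        (norm_nonneg _) ((norm_nonneg _).trans (hpt δ hδ z))
    · refine Eventually.of_forall fun z => ?_
      have h1 : Tendsto (fun δ : ℝ => c + δ • z) (𝓝 0) (𝓝 (c + (0 : ℝ) • z)) :=
        (Continuous.tendsto (by fun_prop) 0)
      rw [zero_smul, add_zero] at h1
      have h2 : Tendsto (fun δ : ℝ => r (c + δ • z) - r c) (𝓝[>] 0) (𝓝 0) := by
        have := (hrc.tendsto.comp (h1.mono_left
          (nhdsWithin_le_nhds (s := Ioi (0 : ℝ))))).sub_const (r c)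
        rwa [sub_self] at this
      rw [tendsto_zero_iff_norm_tendsto_zero] at h2 ⊢
      refine squeeze_zero' (Eventually.of_forall fun _ => norm_nonneg _) ?_
        (by simpa using h2.const_mul (‖fderiv ℝ η z‖ * (L * ‖z‖)))
      filter_upwards [self_mem_nhdsWithin] with δ hδ
      rw [norm_mul]
      exact mul_le_mul_of_nonneg_right (hpt δ hδ z) (norm_nonneg _)
  rw [integral_zero] at t2
  -- the main term
  have hdivm : AEStronglyMeasurable (fun x => divOf (G x)) volume :=
    divOfL.continuous.comp_aestronglyMeasurable hG
  have t1 : Tendsto (fun δ : ℝ => -(∫ z, η z * divOf (G (c + δ • z))) * r c) (𝓝[>] 0)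
      (𝓝 (-((∫ z, η z) * divOf (G c)) * r c)) := by
    refine ((tendsto_integral_blowup_of_continuousAt (C := ‖divOfL‖ * L) hdivm ?_ ?_
      hη.continuous hηc).neg).mul_const _
    · filter_upwards [hL] with x hx
      exact (divOfL.le_opNorm _).trans (by gcongr)
    · exact divOfL.continuous.continuousAt.comp hGc
  have hmain : ∀ δ : ℝ, 0 < δ → ∫ z, δ⁻¹ * fderiv ℝ η z (w (c + δ • z) - w c)
      = -∫ z, η z * divOf (G (c + δ • z)) := by
    intro δ hδ
    let e : Fin 2 → Plane := fun j => EuclideanSpace.single j 1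
    have hGi : ∀ j, Integrable fun z => η z • G (c + δ • z) (e j) := fun j => by
      refine Integrable.mono' (g := fun z => ‖η z‖ * (L * ‖e j‖))
        ((hη.continuous.integrable_of_hasCompactSupport hηc).norm.mul_const _) ?_ ?_
      · exact hη.continuous.aestronglyMeasurable.smul
          (((ContinuousLinearMap.apply ℝ Plane (e j)).continuous.comp_aestronglyMeasurable
            hG).comp_quasiMeasurePreserving (hq δ hδ))
      · filter_upwards [(hq δ hδ).ae hL] with z hz
        rw [norm_smul]
        gcongr
        exact ((G (c + δ • z)).le_opNorm _).trans (by gcongr)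
    have hwi : ∀ j, Integrable fun z => fderiv ℝ η z (e j) • w (c + δ • z) := fun j =>
      Continuous.integrable_of_hasCompactSupport ((hηd _).smul (by fun_prop))
        ((hηdc (e j)).smul_right)
    have hcomp : ∀ j, ∫ z, η z * (G (c + δ • z) (e j)) j
        = -(δ⁻¹ * ∫ z, fderiv ℝ η z (e j) * w (c + δ • z) j) := by
      intro j
      have h1 := congrArg (EuclideanSpace.proj (𝕜 := ℝ) j)
        (h.integral_comp_add_smul hη hηc c (e j) hδ)
      rw [map_neg, map_smul, ← ContinuousLinearMap.integral_comp_comm _ (hGi j),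
        ← ContinuousLinearMap.integral_comp_comm _ (hwi j)] at h1
      simpa using h1
    have hGi' : ∀ j, Integrable fun z => η z * (G (c + δ • z) (e j)) j := fun j => by
      simpa using (EuclideanSpace.proj (𝕜 := ℝ) j).integrable_comp (hGi j)
    have hwi' : ∀ j, Integrable fun z => fderiv ℝ η z (e j) * w (c + δ • z) j := fun j => by
      simpa using (EuclideanSpace.proj (𝕜 := ℝ) j).integrable_comp (hwi j)
    -- The constant w(c) is invisible to ∇η, so subtracting it is free.
    have hz : ∀ v, ∫ z, fderiv ℝ η z v = 0 := fun v =>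
      integral_fderiv_eq_zero hη hηc v
    have e1 : ∫ z, η z * divOf (G (c + δ • z))
        = (∫ z, η z * (G (c + δ • z) (e 0)) 0) + ∫ z, η z * (G (c + δ • z) (e 1)) 1 := by
      rw [← integral_add (hGi' 0) (hGi' 1)]
      congr 1
      ext1 z
      simp only [divOf, Fin.sum_univ_two, e]
      ring
    have e2 : ∫ z, fderiv ℝ η z (w (c + δ • z) - w c)
        = (∫ z, fderiv ℝ η z (e 0) * w (c + δ • z) 0)
          + ∫ z, fderiv ℝ η z (e 1) * w (c + δ • z) 1 := by
      have i0 : Integrable fun z => fderiv ℝ η z (e 0) * w (c + δ • z) 0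
        + fderiv ℝ η z (e 1) * w (c + δ • z) 1 := (hwi' 0).add (hwi' 1)
      have i1 : Integrable fun z => fderiv ℝ η z (w c) :=
        (hηd _).integrable_of_hasCompactSupport (hηdc _)
      rw [← integral_add (hwi' 0) (hwi' 1), ← sub_zero (∫ z, _ + _), ← hz (w c),
        ← integral_sub i0 i1]
      congr 1
      ext1 z
      rw [map_sub, fderiv_eq_sum η z (w (c + δ • z))]
    rw [integral_const_mul, e1, e2, hcomp, hcomp]
    ring
  have t3 := t1.add t2
  rw [hη1, one_mul, add_zero] at t3
  have e3 : -divOf (G c) * r c = -(r c * divOf (G c)) := by ring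
  rw [e3] at t3
  refine t3.congr' ?_
  filter_upwards [self_mem_nhdsWithin] with δ hδ
  have i1 : Integrable fun z => δ⁻¹ * fderiv ℝ η z (w (c + δ • z) - w c) :=
    (hcont δ).integrable_of_hasCompactSupport (hsupp δ)
  have i2 : Integrable fun z => (δ⁻¹ * fderiv ℝ η z (w (c + δ • z) - w c))
      * (r (c + δ • z) - r c) :=
    i1.mul_bdd (c := C + C) ((hr.comp_quasiMeasurePreserving (hq δ hδ)).sub
      aestronglyMeasurable_const) (Eventually.of_forall fun z =>
        (norm_sub_le _ _).trans (add_le_add (hC _) (hC _)))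
  rw [← hmain δ hδ, ← integral_mul_const, ← integral_add (i1.mul_const _) i2]
  congr 1
  ext1 z
  ring

end Blowup

theorem tendsto_intervalIntegral_of_dominated {F : ℕ → ℝ → ℝ} {f bound : ℝ → ℝ} {T : ℝ}
    (hT : 0 ≤ T) (hF : ∀ n, IntervalIntegrable (F n) volume 0 T)
    (hb : IntervalIntegrable bound volume 0 T)
    (hle : ∀ n, ∀ᵐ τ, τ ∈ Ioo 0 T → ‖F n τ‖ ≤ bound τ)
    (hlim : ∀ᵐ τ, τ ∈ Ioo 0 T → Tendsto (fun n => F n τ) atTop (𝓝 (f τ))) :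
    IntervalIntegrable f volume 0 T ∧ ∀ t ∈ Icc 0 T,
      Tendsto (fun n => ∫ τ in (0 : ℝ)..t, F n τ) atTop (𝓝 (∫ τ in (0 : ℝ)..t, f τ)) := by
  have hIoo : ∀ᵐ τ ∂(volume : Measure ℝ).restrict (Ioo 0 T), τ ∈ Ioo 0 T :=
    ae_restrict_mem measurableSet_Ioo
  have hle' : ∀ n, ∀ᵐ τ ∂(volume : Measure ℝ).restrict (Ioo 0 T), ‖F n τ‖ ≤ bound τ := fun n =>
    (ae_restrict_iff' measurableSet_Ioo).2 (hle n)
  have hlim' : ∀ᵐ τ ∂(volume : Measure ℝ).restrict (Ioo 0 T),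
      Tendsto (fun n => F n τ) atTop (𝓝 (f τ)) := (ae_restrict_iff' measurableSet_Ioo).2 hlim
  constructor
  · rw [intervalIntegrable_iff_integrableOn_Ioo_of_le hT] at hb ⊢
    refine Integrable.mono' hb (aestronglyMeasurable_of_tendsto_ae atTop (fun n =>
      ((intervalIntegrable_iff_integrableOn_Ioo_of_le hT).1 (hF n)).1) hlim') ?_
    filter_upwards [hlim', ae_all_iff.2 hle'] with τ h1 h2
    exact le_of_tendsto' h1.norm h2
  · intro t ht
    have hsub : Icc 0 t ⊆ Icc 0 T := Icc_subset_Icc_right ht.2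
    have hmono : ∀ {g : ℝ → ℝ}, IntervalIntegrable g volume 0 T →
        IntervalIntegrable g volume 0 t := fun hg =>
      hg.mono_set (by rw [uIcc_of_le ht.1, uIcc_of_le hT]; exact hsub)
    have hne : ∀ᵐ τ : ℝ, τ ≠ T := by simp [ae_iff]
    have hio : ∀ τ, τ ≠ T → τ ∈ uIoc 0 t → τ ∈ Ioo 0 T := fun τ h1 h2 => by
      rw [uIoc_of_le ht.1] at h2
      exact ⟨h2.1, lt_of_le_of_ne (h2.2.trans ht.2) h1⟩
    refine intervalIntegral.tendsto_integral_filter_of_dominated_convergence bound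
      (Eventually.of_forall fun n => ?_) (Eventually.of_forall fun n => ?_) (hmono hb) ?_
    · have := hmono (hF n)
      rw [intervalIntegrable_iff] at this
      exact this.1
    · filter_upwards [hle n, hne] with τ h1 h2 h3
      exact h1 (hio τ h2 h3)
    · filter_upwards [hlim, hne] with τ h1 h2 h3
      exact h1 (hio τ h2 h3)

/-! ### Density along particle paths, off the interface and on each of its sides. -/

section Lagrangian

variable {P μ lam : ℝ → ℝ} {α : ℝ≥0} {ρt T : ℝ} {D₀ : Set Plane} {ρ : ℝ → Plane → ℝ}
  {u : ℝ → Plane → Plane} {G : ℝ → Plane → Plane →L[ℝ] Plane} {V X : ℝ → Plane → Plane}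
  {φ : ℝ → Plane → ℝ} {I : Set ℝ} {νmin νmax K : ℝ}

theorem IsLocalSolution.continuous_velocity (h : IsLocalSolution P μ lam α ρt T D₀ ρ u G V X φ)
    {t : ℝ} (ht : t ∈ Icc 0 T) : Continuous (u t) := by
  rw [← continuousOn_univ]
  exact h.u_continuous.comp (f := fun x => (t, x)) (Continuous.prodMk_right t).continuousOn
    fun x _ => ⟨ht, mem_univ x⟩

theorem IsLocalSolution.ae_lipschitz (h : IsLocalSolution P μ lam α ρt T D₀ ρ u G V X φ) :
    ∀ᵐ t, t ∈ Ioo 0 T → ∀ x y, ‖u t x - u t y‖ ≤ supNorm (G t) * ‖x - y‖ := by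
  filter_upwards [h.ae_pwHolderNorm_lt_top] with t ht htT x y
  have ht' := Ioo_subset_Icc_self htT
  exact (h.gradient t ht').norm_sub_le (h.continuous_velocity ht')
    (ae_norm_le_supNorm (pwHolderNorm_lt_top_iff.1 (ht htT)).1) x y

theorem IsLocalSolution.flow_dist_le (h : IsLocalSolution P μ lam α ρt T D₀ ρ u G V X φ)
    (hT : 0 ≤ T) {t : ℝ} (ht : t ∈ Icc 0 T) (x y : Plane) :
    ‖X t x - X t y‖ ≤ ‖x - y‖ * Real.exp (∫ s in (0 : ℝ)..t, supNorm (G s)) ∧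
      ‖x - y‖ ≤ ‖X t x - X t y‖ * Real.exp (∫ s in (0 : ℝ)..t, supNorm (G s)) := by
  have := CompressibleNS.flow_dist_le h.u_continuous h.flow (h.intervalIntegrable_supNorm hT)
    h.ae_lipschitz ht x y
  simpa only [h.flow_zero] using this

theorem IsLocalSolution.lipschitz_flow (h : IsLocalSolution P μ lam α ρt T D₀ ρ u G V X φ)
    (hT : 0 ≤ T) {t : ℝ} (ht : t ∈ Icc 0 T) :
    LipschitzWith (Real.exp (∫ s in (0 : ℝ)..t, supNorm (G s))).toNNReal (X t) :=
  LipschitzWith.of_dist_le_mul fun x y => by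
    rw [dist_eq_norm, dist_eq_norm, Real.coe_toNNReal _ (Real.exp_nonneg _), mul_comm]
    exact (h.flow_dist_le hT ht x y).1

theorem IsLocalSolution.injective_flow (h : IsLocalSolution P μ lam α ρt T D₀ ρ u G V X φ)
    (hT : 0 ≤ T) {t : ℝ} (ht : t ∈ Icc 0 T) : Function.Injective (X t) := fun x y hxy => by
  have := (h.flow_dist_le hT ht x y).2
  rw [hxy, sub_self, norm_zero, zero_mul] at this
  exact sub_eq_zero.1 (norm_le_zero_iff.1 this)

theorem IsLocalSolution.initial_domain (h : IsLocalSolution P μ lam α ρt T D₀ ρ u G V X φ)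
    (hT : 0 ≤ T) : IsHolderDomain α D₀ (φ 0) := by
  have := h.domain 0 ⟨le_rfl, hT⟩
  rwa [show X 0 = id from funext h.flow_zero, image_id] at this

theorem IsLocalSolution.closure_image (h : IsLocalSolution P μ lam α ρt T D₀ ρ u G V X φ)
    (hT : 0 ≤ T) {t : ℝ} (ht : t ∈ Icc 0 T) : closure (X t '' D₀) = X t '' closure D₀ :=
  closure_image_of_isBounded (h.lipschitz_flow hT ht).continuous (h.initial_domain hT).isBounded

theorem IsLocalSolution.frontier_image (h : IsLocalSolution P μ lam α ρt T D₀ ρ u G V X φ)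
    (hT : 0 ≤ T) {t : ℝ} (ht : t ∈ Icc 0 T) : frontier (X t '' D₀) = X t '' frontier D₀ :=
  frontier_image_of_isBounded (h.lipschitz_flow hT ht).continuous (h.injective_flow hT ht)
    (h.initial_domain hT).isBounded (h.initial_domain hT).isOpen (h.domain t ht).isOpen

theorem IsLocalSolution.flow_mem_compl_closure
    (h : IsLocalSolution P μ lam α ρt T D₀ ρ u G V X φ) (hT : 0 ≤ T) {t : ℝ} (ht : t ∈ Icc 0 T)
    {y : Plane} (hy : y ∈ (closure D₀)ᶜ) : X t y ∈ (closure (X t '' D₀))ᶜ := by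
  rw [h.closure_image hT ht]
  rintro ⟨x, hx, hxy⟩
  exact hy (h.injective_flow hT ht hxy ▸ hx)

/-- Off the interface, a point stays on its side. -/
theorem IsLocalSolution.exists_side (h : IsLocalSolution P μ lam α ρt T D₀ ρ u G V X φ)
    (hT : 0 ≤ T) {y : Plane} (hy : y ∉ frontier D₀) {t : ℝ} (ht : t ∈ Icc 0 T) :
    ∃ S : Set Plane, IsOpen S ∧ X t y ∈ S ∧
      (S = X t '' D₀ ∨ S = (closure (X t '' D₀))ᶜ) := by
  by_cases hyD : y ∈ D₀
  · exact ⟨_, (h.domain t ht).isOpen, mem_image_of_mem _ hyD, Or.inl rfl⟩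
  · refine ⟨_, isClosed_closure.isOpen_compl, h.flow_mem_compl_closure hT ht fun hc => ?_,
      Or.inr rfl⟩
    rw [(h.initial_domain hT).isOpen.frontier_eq] at hy
    exact hy ⟨hc, hyD⟩

theorem IsLocalSolution.continuousAt_density (h : IsLocalSolution P μ lam α ρt T D₀ ρ u G V X φ)
    (hα : 0 < α) (hT : 0 ≤ T) (hb : LawBounds P μ lam I νmin νmax K) (hI : LawLip I fun r => r)
    (hρ : ∀ t ∈ Icc 0 T, ∀ x, ρ t x ∈ I) {y : Plane} (hy : y ∉ frontier D₀) {t : ℝ}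
    (ht : t ∈ Icc 0 T) : ContinuousAt (ρ t) (X t y) := by
  obtain ⟨S, hS, hyS, hS'⟩ := h.exists_side hT hy ht
  have hp := pwHolderNorm_lt_top_iff.1 (h.pressure_pw t ht)
  have hp' : eHolderNorm α (S.domRestrict fun x => P (ρ t x) - P ρt) < ∞ := by
    rcases hS' with rfl | rfl
    exacts [hp.2.1, hp.2.2]
  exact (density_tendsto hα hb hI (hρ t ht) hp').1.continuousAt (hS.mem_nhds hyS)

theorem IsLocalSolution.continuousAt_gradient (h : IsLocalSolution P μ lam α ρt T D₀ ρ u G V X φ)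
    (hα : 0 < α) (hT : 0 ≤ T) {y : Plane} (hy : y ∉ frontier D₀) {t : ℝ}
    (ht : t ∈ Icc 0 T) (hG : pwHolderNorm α (X t '' D₀) (G t) < ∞) :
    ContinuousAt (G t) (X t y) ∧ ‖G t (X t y)‖ ≤ supNorm (G t) := by
  obtain ⟨S, hS, hyS, hS'⟩ := h.exists_side hT hy ht
  have hp := pwHolderNorm_lt_top_iff.1 hG
  have hp' : eHolderNorm α (S.domRestrict (G t)) < ∞ := by
    rcases hS' with rfl | rfl
    exacts [hp.2.1, hp.2.2]
  have hc := (continuousOn_of_eHolderNorm_lt_top hα hp').continuousOn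
  exact ⟨hc.continuousAt (hS.mem_nhds hyS),
    norm_le_of_continuousOn_of_ae hS hc (ae_norm_le_supNorm hp.1) hyS⟩

/-- The mass equation along particle paths off the interface. -/
theorem IsLocalSolution.density_along_flow (h : IsLocalSolution P μ lam α ρt T D₀ ρ u G V X φ)
    (hα : 0 < α) (hT : 0 < T) (hb : LawBounds P μ lam I νmin νmax K) (hI : LawLip I fun r => r)
    (hρ : ∀ t ∈ Icc 0 T, ∀ x, ρ t x ∈ I) {y : Plane} (hy : y ∉ frontier D₀) :
    IntervalIntegrable (fun τ => ρ τ (X τ y) * divOf (G τ (X τ y))) volume 0 T ∧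
      ∀ t ∈ Icc 0 T, ρ t (X t y)
        = ρ 0 y - ∫ τ in (0 : ℝ)..t, ρ τ (X τ y) * divOf (G τ (X τ y)) := by
  obtain ⟨M, bρ⟩ := h.bddContL2 hb hρ hI
  have hXc : ContinuousOn (fun s => X s y) (Icc 0 T) := fun s hs =>
    (h.flow y s hs).continuousWithinAt
  have huX : ContinuousOn (fun s => u s (X s y)) (Icc 0 T) :=
    h.u_continuous.comp (continuousOn_id.prodMk hXc) fun s hs => ⟨hs, mem_univ _⟩
  obtain ⟨ξ, hξ, hξe⟩ := exists_contDiff_extension hT.le (h.flow y) huX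
  -- Freezing u outside `[0, T]` gives a field continuous on all of space-time; test functions
  -- supported in the open slab do not see the change.
  set v : ℝ → Plane → Plane := fun s => u (projIcc 0 T hT.le s) with hv
  have hve : ∀ t ∈ Icc 0 T, v t = u t := fun t ht => by simp only [hv, projIcc_of_mem hT.le ht]
  have hvc : Continuous (Function.uncurry v) :=
    h.u_continuous.comp_continuous (f := fun z : ℝ × Plane => ((projIcc 0 T hT.le z.1 : ℝ), z.2))
      ((continuous_subtype_val.comp (continuous_projIcc.comp continuous_fst)).prodMk
        continuous_snd) fun z => ⟨(projIcc 0 T hT.le z.1).2, mem_univ _⟩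
  have hmass : ∀ ψ, IsTest T ψ →
      ∫ z : ℝ × Plane, ρ z.1 z.2 * (dt ψ z + dx ψ z (v z.1 z.2)) = 0 := by
    intro ψ hψ
    rw [← h.mass ψ hψ]
    congr 1
    ext1 z
    by_cases hz : z.1 ∈ Ioo 0 T
    · rw [hve _ (Ioo_subset_Icc_self hz)]
    · have := (hψ.eq_zero_of_notMem hz z.2).2
      simp [dt, dx, this]
  let k := stdBump Plane 1 one_pos
  set η : Plane → ℝ := k.normed volume with hηdef
  have hη : ContDiff ℝ ((⊤ : ℕ∞) : WithTop ℕ∞) η := k.contDiff_normed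
  have hηc : HasCompactSupport η := k.hasCompactSupport_normed
  have hη1 : ∫ z, η z = 1 := k.integral_normed
  set δ : ℕ → ℝ := fun n => 1 / ((n : ℝ) + 1) with hδdef
  have hδ : ∀ n, 0 < δ n := fun n => by positivity
  have hδ0 : Tendsto δ atTop (𝓝[>] 0) := tendsto_nhdsWithin_iff.2
    ⟨tendsto_one_div_add_atTop_nhds_zero_nat, Eventually.of_forall hδ⟩
  set F : ℕ → ℝ → ℝ := fun n τ => ∫ z, ((δ n)⁻¹ * fderiv ℝ η z (v τ (ξ τ + δ n • z) - deriv ξ τ))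
    * ρ τ (ξ τ + δ n • z) with hF
  have hmov := fun n => sub_eq_integral_moving_rescaled hT hvc h.measurable_ρ
    (fun z hz => (bρ z.1 (Ioo_subset_Icc_self hz.1)).2.1 z.2) bρ.contL1Loc hmass hξ hη hηc (hδ n)
  have hdom : Integrable fun z => ‖fderiv ℝ η z‖ * ‖z‖ := by
    refine Continuous.integrable_of_hasCompactSupport ?_ ?_
    · exact (hη.continuous_fderiv (by simp)).norm.mul (by fun_prop)
    · exact (hηc.fderiv ℝ).norm.mul_right
  have hSi := h.intervalIntegrable_supNorm hT.le
  have hFint : ∀ n, IntervalIntegrable (F n) volume 0 T := fun n =>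
    ContinuousOn.intervalIntegrable (by rw [uIcc_of_le hT.le]; exact (hmov n).1)
  -- The bump shrinks to the particle. The Lipschitz bound on u cancels the factor 1/δ, so the rates
  -- are dominated by a multiple of ‖∇u(τ)‖_∞, which is integrable in time.
  have key := tendsto_intervalIntegral_of_dominated (F := F)
    (f := fun τ => -(ρ τ (X τ y) * divOf (G τ (X τ y))))
    (bound := fun τ => (∫ z, ‖fderiv ℝ η z‖ * ‖z‖) * M * supNorm (G τ)) hT.le hFint
    (hSi.const_mul _) ?_ ?_
  · obtain ⟨hint, hconv⟩ := key
    have hneg := hint.neg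
    simp only [Pi.neg_def, neg_neg] at hneg
    refine ⟨hneg, fun t ht => ?_⟩
    have hR : ∀ s ∈ Icc 0 T, Tendsto (fun n => ∫ z, η z * ρ s (ξ s + δ n • z)) atTop
        (𝓝 (ρ s (X s y))) := by
      intro s hs
      have := (tendsto_integral_blowup_of_continuousAt (bρ s hs).1
        (Eventually.of_forall (bρ s hs).2.1)
        (h.continuousAt_density hα hT.le hb hI hρ hy hs) hη.continuous hηc).comp hδ0
      rw [hη1, one_mul] at this
      rw [(hξe s hs).1]
      exact this
    have h0 : (0 : ℝ) ∈ Icc 0 T := ⟨le_rfl, hT.le⟩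
    have l1 := (hR t ht).sub (hR 0 h0)
    simp only [fun n => (hmov n).2 t ht] at l1
    have l2 := tendsto_nhds_unique l1 (hconv t ht)
    rw [h.flow_zero, intervalIntegral.integral_neg] at l2
    linarith
  · intro n
    filter_upwards [h.ae_lipschitz] with τ hτ hτT
    have hτ' := Ioo_subset_Icc_self hτT
    rw [hF, mul_assoc, mul_comm, ← integral_const_mul]
    refine norm_integral_le_of_norm_le (hdom.const_mul _) (Eventually.of_forall fun z => ?_)
    rw [hve τ hτ', (hξe τ hτ').2, (hξe τ hτ').1, norm_mul, norm_mul, norm_inv,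
      Real.norm_of_nonneg (hδ n).le]
    have hl := hτ hτT (X τ y + δ n • z) (X τ y)
    rw [add_sub_cancel_left, norm_smul, Real.norm_of_nonneg (hδ n).le] at hl
    have hM := (bρ τ hτ').2.1 (X τ y + δ n • z)
    have hδn := hδ n
    calc (δ n)⁻¹ * ‖fderiv ℝ η z (u τ (X τ y + δ n • z) - u τ (X τ y))‖
          * ‖ρ τ (X τ y + δ n • z)‖
        ≤ (δ n)⁻¹ * (‖fderiv ℝ η z‖ * (supNorm (G τ) * (δ n * ‖z‖))) * M := by
          have hs := supNorm_nonneg (G τ)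
          gcongr
          · exact ((fderiv ℝ η z).le_opNorm _).trans (by gcongr)
          · exact hM
      _ = M * supNorm (G τ) * (‖fderiv ℝ η z‖ * ‖z‖) := by field_simp
  · filter_upwards [h.ae_pwHolderNorm_lt_top] with τ hτ hτT
    have hτ' := Ioo_subset_Icc_self hτT
    have hp := pwHolderNorm_lt_top_iff.1 (hτ hτT)
    have := (tendsto_integral_difference_quotient (h.gradient τ hτ') (h.continuous_velocity hτ')
      (h.gradient_cont τ hτ').1.1 (ae_norm_le_supNorm hp.1) (bρ τ hτ').1 (bρ τ hτ').2.1
      (h.continuousAt_gradient hα hT.le hy hτ' (hτ hτT)).1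
      (h.continuousAt_density hα hT.le hb hI hρ hy hτ') hη hηc hη1).comp hδ0
    simp only [hF, hve τ hτ', (hξe τ hτ').2, (hξe τ hτ').1]
    exact this

/-- The mass equation for the traces of the density on one side `S D(t)` of the interface. -/
theorem IsLocalSolution.trace_along_flow (h : IsLocalSolution P μ lam α ρt T D₀ ρ u G V X φ)
    (hα : 0 < α) (hT : 0 < T) (hb : LawBounds P μ lam I νmin νmax K) (hI : LawLip I fun r => r)
    (hρ : ∀ t ∈ Icc 0 T, ∀ x, ρ t x ∈ I) {σ : Plane} {S : ℝ → Set Plane} {S₀ : Set Plane}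
    (hS₀ : ∀ y ∈ S₀, y ∉ frontier D₀) (hS : ∀ t ∈ Icc 0 T, ∀ y ∈ S₀, X t y ∈ S t)
    (hσ : σ ∈ closure S₀) {r : ℝ → ℝ} {A : ℝ → Plane →L[ℝ] Plane}
    (hr : ∀ t ∈ Icc 0 T, Tendsto (ρ t) (𝓝[S t] (X t σ)) (𝓝 (r t)))
    (hA : ∀ᵐ t, t ∈ Ioo 0 T → Tendsto (G t) (𝓝[S t] (X t σ)) (𝓝 (A t))) :
    IntervalIntegrable (fun τ => r τ * divOf (A τ)) volume 0 T ∧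
      ∀ t ∈ Icc 0 T, r t = r 0 - ∫ τ in (0 : ℝ)..t, r τ * divOf (A τ) := by
  obtain ⟨M, bρ⟩ := h.bddContL2 hb hρ hI
  -- Particles off the interface converge to σ from one side and the flow keeps them on it, so
  -- density and gradient along their paths tend to the traces.
  obtain ⟨y, hyS, hy⟩ := mem_closure_iff_seq_limit.1 hσ
  have hlag := fun n => h.density_along_flow hα hT hb hI hρ (hS₀ _ (hyS n))
  have hXy : ∀ t ∈ Icc 0 T, Tendsto (fun n => X t (y n)) atTop (𝓝[S t] (X t σ)) := fun t ht =>
    tendsto_nhdsWithin_iff.2 ⟨((h.lipschitz_flow hT.le ht).continuous.tendsto σ).comp hy,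
      Eventually.of_forall fun n => hS t ht _ (hyS n)⟩
  have key := tendsto_intervalIntegral_of_dominated
    (F := fun n τ => ρ τ (X τ (y n)) * divOf (G τ (X τ (y n))))
    (f := fun τ => r τ * divOf (A τ))
    (bound := fun τ => M * ‖divOfL‖ * supNorm (G τ)) hT.le (fun n => (hlag n).1)
    ((h.intervalIntegrable_supNorm hT.le).const_mul _) ?_ ?_
  · obtain ⟨hint, hconv⟩ := key
    refine ⟨hint, fun t ht => ?_⟩
    have h0 : (0 : ℝ) ∈ Icc 0 T := ⟨le_rfl, hT.le⟩
    have l0 := (hr 0 h0).comp (hXy 0 h0)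
    have lt := (hr t ht).comp (hXy t ht)
    have l1 := l0.sub (hconv t ht)
    refine tendsto_nhds_unique lt (l1.congr fun n => ?_)
    simp only [Function.comp_apply, h.flow_zero]
    exact ((hlag n).2 t ht).symm
  · intro n
    filter_upwards [h.ae_pwHolderNorm_lt_top] with τ hτ hτT
    have hτ' := Ioo_subset_Icc_self hτT
    have hM := (bρ τ hτ').2.1 (X τ (y n))
    have h2 := (h.continuousAt_gradient hα hT.le (hS₀ _ (hyS n)) hτ' (hτ hτT)).2
    rw [norm_mul, mul_assoc]
    refine mul_le_mul hM ((divOfL.le_opNorm _).trans (by gcongr)) (norm_nonneg _)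
      ((abs_nonneg _).trans hM)
  · filter_upwards [hA] with τ hτ hτT
    have hτ' := Ioo_subset_Icc_self hτT
    exact ((hr τ hτ').comp (hXy τ hτ')).mul
      (((divOfL.continuous.tendsto _).comp (hτ hτT)).comp (hXy τ hτ'))

end Lagrangian

theorem _root_.AbsolutelyContinuousOnInterval.congr_on {X : Type*} [PseudoMetricSpace X]
    {f g : ℝ → X} {a b : ℝ} (hf : AbsolutelyContinuousOnInterval f a b)
    (h : EqOn f g (uIcc a b)) : AbsolutelyContinuousOnInterval g a b := by
  rw [absolutelyContinuousOnInterval_iff] at hf ⊢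
  intro ε hε
  obtain ⟨δ, hδ, h'⟩ := hf ε hε
  refine ⟨δ, hδ, fun E hE hlt => ?_⟩
  refine lt_of_eq_of_lt (Finset.sum_congr rfl fun i hi => ?_) (h' E hE hlt)
  have := hE.1 i hi
  rw [h this.1, h this.2]

/-! ### Evolution of the jump along the interface -/

section Interface

variable {P μ lam : ℝ → ℝ} {α : ℝ≥0} {ρt T : ℝ} {D₀ : Set Plane} {ρ : ℝ → Plane → ℝ}
  {u : ℝ → Plane → Plane} {G : ℝ → Plane → Plane →L[ℝ] Plane} {V X : ℝ → Plane → Plane}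
  {φ : ℝ → Plane → ℝ} {I : Set ℝ} {νmin νmax K : ℝ}

theorem IsLocalSolution.exists_density_traces
    (h : IsLocalSolution P μ lam α ρt T D₀ ρ u G V X φ)
    (hα : 0 < α) (hb : LawBounds P μ lam I νmin νmax K) (hI : LawLip I fun r => r)
    (hIc : IsClosed I) (hρ : ∀ t ∈ Icc 0 T, ∀ x, ρ t x ∈ I) {t : ℝ} (ht : t ∈ Icc 0 T)
    {σ : Plane} (hσ : σ ∈ frontier (X t '' D₀)) :
    ∃ r ∈ I, ∃ s ∈ I, Tendsto (ρ t) (𝓝[X t '' D₀] σ) (𝓝 r) ∧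
      Tendsto (ρ t) (𝓝[(closure (X t '' D₀))ᶜ] σ) (𝓝 s) := by
  have hp := pwHolderNorm_lt_top_iff.1 (h.pressure_pw t ht)
  have c1 : σ ∈ closure (X t '' D₀) := frontier_subset_closure hσ
  have c2 : σ ∈ closure (closure (X t '' D₀))ᶜ := (h.domain t ht).mem_closure_compl_closure hσ
  obtain ⟨r, hr⟩ := (density_tendsto hα hb hI (hρ t ht) hp.2.1).2 σ c1
  obtain ⟨s, hs⟩ := (density_tendsto hα hb hI (hρ t ht) hp.2.2).2 σ c2
  have n1 := mem_closure_iff_nhdsWithin_neBot.1 c1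
  have n2 := mem_closure_iff_nhdsWithin_neBot.1 c2
  exact ⟨r, hIc.mem_of_tendsto hr (Eventually.of_forall (hρ t ht)), s,
    hIc.mem_of_tendsto hs (Eventually.of_forall (hρ t ht)), hr, hs⟩

theorem IsLocalSolution.exists_gradient_traces
    (h : IsLocalSolution P μ lam α ρt T D₀ ρ u G V X φ)
    (hα : 0 < α) {t : ℝ} (ht : t ∈ Icc 0 T) (hG : pwHolderNorm α (X t '' D₀) (G t) < ∞)
    {σ : Plane} (hσ : σ ∈ frontier (X t '' D₀)) :
    ∃ A B : Plane →L[ℝ] Plane, ‖A‖ ≤ supNorm (G t) ∧ Tendsto (G t) (𝓝[X t '' D₀] σ) (𝓝 A) ∧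
      Tendsto (G t) (𝓝[(closure (X t '' D₀))ᶜ] σ) (𝓝 B) := by
  have hp := pwHolderNorm_lt_top_iff.1 hG
  have c1 : σ ∈ closure (X t '' D₀) := frontier_subset_closure hσ
  obtain ⟨A, hA⟩ := exists_tendsto_of_eHolderNorm_lt_top hα hp.2.1 c1
  obtain ⟨B, hB⟩ := exists_tendsto_of_eHolderNorm_lt_top hα hp.2.2
    ((h.domain t ht).mem_closure_compl_closure hσ)
  have n1 := mem_closure_iff_nhdsWithin_neBot.1 c1
  refine ⟨A, B, le_of_tendsto hA.norm ?_, hA, hB⟩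
  filter_upwards [self_mem_nhdsWithin] with x hx
  exact norm_le_of_continuousOn_of_ae (h.domain t ht).isOpen
    (continuousOn_of_eHolderNorm_lt_top hα hp.2.1).continuousOn (ae_norm_le_supNorm hp.1) hx

/-- Decay of the difference of two solutions of `r' = - r d`, measured by `f`, when the jump of
the effective flux is balanced by the pressure and a controlled viscous term. -/
theorem abs_fLaw_sub_le {m M : ℝ} (hm : 0 < m) (hb : LawBounds P μ lam (Icc m M) νmin νmax K)
    (hμ : ContinuousOn μ (Ioi 0)) (hlam : ContinuousOn lam (Ioi 0)) (hρt : 0 < ρt) (hT : 0 ≤ T)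
    {r s d e κ L : ℝ → ℝ} (hr : ∀ t ∈ Icc 0 T, r t ∈ Icc m M) (hs : ∀ t ∈ Icc 0 T, s t ∈ Icc m M)
    (hd : IntervalIntegrable (fun τ => r τ * d τ) volume 0 T)
    (he : IntervalIntegrable (fun τ => s τ * e τ) volume 0 T)
    (hL : IntervalIntegrable L volume 0 T)
    (hre : ∀ t ∈ Icc 0 T, r t = r 0 - ∫ τ in (0 : ℝ)..t, r τ * d τ)
    (hse : ∀ t ∈ Icc 0 T, s t = s 0 - ∫ τ in (0 : ℝ)..t, s τ * e τ)
    (hκ : ∀ᵐ τ, τ ∈ Ioo 0 T → |κ τ| ≤ L τ ∧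
      (2 * μ (s τ) + lam (s τ)) * e τ - (2 * μ (r τ) + lam (r τ)) * d τ
        = (P (s τ) - P (r τ)) + 2 * (μ (s τ) - μ (r τ)) * κ τ) :
    |fLaw μ lam ρt (s T) - fLaw μ lam ρt (r T)|
      ≤ Real.exp (-νmin * T + 2 * νmax * ∫ τ in (0 : ℝ)..T, L τ)
        * |fLaw μ lam ρt (s 0) - fLaw μ lam ρt (r 0)| := by
  set f := fLaw μ lam ρt with hf
  have hsub : Icc m M ⊆ Ioi 0 := fun x hx => lt_of_lt_of_le hm hx.1
  have hfd : ∀ x ∈ Icc m M, HasDerivAt f ((2 * μ x + lam x) / x) x := fun x hx =>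
    hasDerivAt_fLaw hμ hlam hρt (hsub hx)
  obtain ⟨C, hC0, hC⟩ := exists_abs_le_of_continuousOn (g := fun x => (2 * μ x + lam x) / x)
    (m := m) (M := M) ((((hμ.mono hsub).const_smul (2 : ℝ)).add (hlam.mono hsub)).div
      continuousOn_id fun x hx => ne_of_gt (hsub hx))
  have hfl : LipschitzOnWith C.toNNReal f (Icc m M) := LipschitzOnWith.of_dist_le_mul
    fun x hx y hy => by
      rw [Real.dist_eq, Real.dist_eq, Real.coe_toNNReal _ hC0.le]
      exact abs_sub_le_of_hasDerivAt hfd hC hx hy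
  -- for one trace
  have hone : ∀ {r d : ℝ → ℝ}, (∀ t ∈ Icc 0 T, r t ∈ Icc m M) →
      IntervalIntegrable (fun τ => r τ * d τ) volume 0 T →
      (∀ t ∈ Icc 0 T, r t = r 0 - ∫ τ in (0 : ℝ)..t, r τ * d τ) →
      AbsolutelyContinuousOnInterval (fun t => f (r t)) 0 T ∧
      ∀ᵐ τ, τ ∈ Ioo 0 T → HasDerivAt (fun t => f (r t)) (-((2 * μ (r τ) + lam (r τ)) * d τ)) τ := by
    intro r d hr hd hre
    have hac : AbsolutelyContinuousOnInterval r 0 T := by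
      have h1 := hd.absolutelyContinuousOnInterval_intervalIntegral (c := 0) left_mem_uIcc
      have h2 : AbsolutelyContinuousOnInterval (fun t => r 0 - ∫ τ in (0 : ℝ)..t, r τ * d τ) 0 T :=
        LipschitzOnWith.comp_absolutelyContinuousOnInterval (K := 1) (φ := fun x => r 0 - x)
          (LipschitzOnWith.of_dist_le_mul fun x _ y _ => by
            rw [NNReal.coe_one, one_mul, dist_sub_left]) h1
      exact h2.congr_on fun t ht => (hre t (by rwa [uIcc_of_le hT] at ht)).symm
    refine ⟨LipschitzOnWith.comp_absolutelyContinuousOnInterval (hfl.mono ?_) hac, ?_⟩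
    · rintro _ ⟨t, ht, rfl⟩
      exact hr t (by rwa [uIcc_of_le hT] at ht)
    · filter_upwards [hd.ae_hasDerivAt_integral] with τ hτ hτT
      have hτ' := Ioo_subset_Icc_self hτT
      have h1 := (hτ (by rwa [uIcc_of_le hT]) 0 left_mem_uIcc).const_sub (r 0)
      have h2 : HasDerivAt r (-(r τ * d τ)) τ := h1.congr_of_eventuallyEq (by
        filter_upwards [Icc_mem_nhds hτT.1 hτT.2] with t ht using hre t ht)
      have h3 := (hfd (r τ) (hr τ hτ')).comp τ h2
      have hne : r τ ≠ 0 := ne_of_gt (hsub (hr τ hτ'))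
      -- Here the choice of f matters: the factor r of the mass equation cancels the denominator of
      -- f', leaving the viscous part of the effective flux.
      have e1 : (2 * μ (r τ) + lam (r τ)) / r τ * -(r τ * d τ)
          = -((2 * μ (r τ) + lam (r τ)) * d τ) := by field_simp
      rwa [e1] at h3
  obtain ⟨ra, rd⟩ := hone hr hd hre
  obtain ⟨sa, sd⟩ := hone hs he hse
  set w : ℝ → ℝ := fun t => f (s t) - f (r t) with hw
  have hwa : AbsolutelyContinuousOnInterval w 0 T := sa.fun_sub ra
  -- The square avoids differentiating |w| at its zeros and matches the form of the monotonicity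
  -- bound on the pressure.
  have hw2 : AbsolutelyContinuousOnInterval (fun t => w t ^ 2) 0 T :=
    ContDiff.comp_absolutelyContinuousOnInterval (φ := fun x => x ^ 2) (by fun_prop) hwa
  have key := le_mul_exp_of_deriv_le (g := fun t => w t ^ 2)
    (a := fun τ => 2 * (-νmin + 2 * νmax * L τ)) hT hw2
    (((intervalIntegrable_const).add (hL.const_mul _)).const_mul 2) ?_
  · have e1 : Real.exp (∫ τ in (0 : ℝ)..T, 2 * (-νmin + 2 * νmax * L τ))
        = Real.exp (-νmin * T + 2 * νmax * ∫ τ in (0 : ℝ)..T, L τ) ^ 2 := by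
      rw [intervalIntegral.integral_const_mul, intervalIntegral.integral_add
        intervalIntegrable_const (hL.const_mul _), intervalIntegral.integral_const_mul,
        intervalIntegral.integral_const, ← Real.exp_nat_mul]
      congr 1
      simp only [sub_zero, smul_eq_mul]
      push_cast
      ring
    rw [e1, ← mul_pow, sq_le_sq, abs_mul, Real.abs_exp, mul_comm] at key
    exact key
  · filter_upwards [rd, sd, hκ] with τ h1 h2 h3 hτ
    have hτ' := Ioo_subset_Icc_self hτ
    obtain ⟨h4, h5⟩ := h3 hτ
    have h6 : HasDerivAt w _ τ := (h2 hτ).sub (h1 hτ)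
    have h7 : HasDerivAt (fun t => w t ^ 2) _ τ := h6.pow 2
    rw [h7.deriv]
    have h8 := hb.pressure ρt hρt _ (hs τ hτ') _ (hr τ hτ')
    have h9 := hb.viscosity ρt hρt _ (hs τ hτ') _ (hr τ hτ')
    rw [← hf] at h8 h9
    -- The viscous term has no sign and is estimated by its absolute value; the pressure term in
    -- `h11` supplies the damping.
    have h10 : -((μ (s τ) - μ (r τ)) * κ τ * w τ) ≤ νmax * L τ * w τ ^ 2 := by
      refine (neg_le_abs _).trans ?_
      rw [abs_mul, abs_mul]
      have hL0 : 0 ≤ L τ := (abs_nonneg _).trans h4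
      have hν : 0 ≤ νmax := (hb.pos.trans hb.lt).le
      calc |μ (s τ) - μ (r τ)| * |κ τ| * |w τ|
          ≤ (νmax * |w τ|) * L τ * |w τ| := by gcongr
        _ = νmax * L τ * w τ ^ 2 := by rw [← sq_abs (w τ)]; ring
    have h11 : νmin * w τ ^ 2 ≤ (P (s τ) - P (r τ)) * w τ := h8
    have e2 : -((2 * μ (s τ) + lam (s τ)) * e τ) - -((2 * μ (r τ) + lam (r τ)) * d τ)
        = -((P (s τ) - P (r τ)) + 2 * (μ (s τ) - μ (r τ)) * κ τ) := by linarith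
    rw [e2]
    simp only [Nat.cast_ofNat, Nat.add_one_sub_one, pow_one]
    nlinarith [h10, h11]

/-- The interface moves with the flow, so `X t σ` follows one interface particle, and the jump there
is a difference of two traces that obey scalar equations. The decay holds for each particle and is
independent of p. -/
theorem IsLocalSolution.norm_jump_le (h : IsLocalSolution P μ lam α ρt T D₀ ρ u G V X φ)
    (hα : 0 < α) (hT : 0 < T) (hρt : 0 < ρt) {m M c : ℝ} (hm : 0 < m)
    (hb : LawBounds P μ lam (Icc m M) νmin νmax K) (hμ : ContinuousOn μ (Ioi 0))
    (hlam : ContinuousOn lam (Ioi 0)) (hc : 0 < c) (hμc : ∀ r ∈ Icc m M, c ≤ μ r)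
    (hlam0 : ∀ r ∈ Icc m M, 0 ≤ lam r) (hρ : ∀ t ∈ Icc 0 T, ∀ x, ρ t x ∈ Icc m M) {σ : Plane}
    (hσ : σ ∈ frontier D₀) {t : ℝ} (ht : t ∈ Icc 0 T) :
    ‖jump (outwardNormal (φ t)) (fun x => fLaw μ lam ρt (ρ t x)) (X t σ)‖
      ≤ Real.exp (-νmin * t + 2 * νmax * ∫ τ in (0 : ℝ)..t, supNorm (G τ))
        * ‖jump (outwardNormal (φ 0)) (fun x => fLaw μ lam ρt (ρ 0 x)) σ‖ ∧
    (pwHolderNorm α (X t '' D₀) (G t) < ∞ →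
      ‖jump (outwardNormal (φ t)) (G t) (X t σ)‖
        ≤ 5 * K / c * ‖jump (outwardNormal (φ t)) (fun x => fLaw μ lam ρt (ρ t x)) (X t σ)‖
          * (1 + supNorm (G t))) := by
  have hI : LawLip (Icc m M) fun r => r := LawLip.id
  have hfr : ∀ s ∈ Icc 0 T, X s σ ∈ frontier (X s '' D₀) := fun s hs => by
    rw [h.frontier_image hT.le hs]
    exact mem_image_of_mem _ hσ
  have htr : ∀ s, ∃ r q, s ∈ Icc 0 T → r ∈ Icc m M ∧ q ∈ Icc m M ∧
      Tendsto (ρ s) (𝓝[X s '' D₀] (X s σ)) (𝓝 r) ∧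
      Tendsto (ρ s) (𝓝[(closure (X s '' D₀))ᶜ] (X s σ)) (𝓝 q) := fun s => by
    by_cases hs : s ∈ Icc 0 T
    · obtain ⟨r, hr, q, hq, h1, h2⟩ :=
        h.exists_density_traces hα hb hI isClosed_Icc hρ hs (hfr s hs)
      exact ⟨r, q, fun _ => ⟨hr, hq, h1, h2⟩⟩
    · exact ⟨0, 0, fun hs' => absurd hs' hs⟩
  choose r q hrq using htr
  have hgr : ∀ s, ∃ A B : Plane →L[ℝ] Plane, s ∈ Icc 0 T →
      pwHolderNorm α (X s '' D₀) (G s) < ∞ → ‖A‖ ≤ supNorm (G s) ∧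
      Tendsto (G s) (𝓝[X s '' D₀] (X s σ)) (𝓝 A) ∧
      Tendsto (G s) (𝓝[(closure (X s '' D₀))ᶜ] (X s σ)) (𝓝 B) := fun s => by
    by_cases hs : s ∈ Icc 0 T ∧ pwHolderNorm α (X s '' D₀) (G s) < ∞
    · obtain ⟨A, B, hAB⟩ := h.exists_gradient_traces hα hs.1 hs.2 (hfr s hs.1)
      exact ⟨A, B, fun _ _ => hAB⟩
    · exact ⟨0, 0, fun h1 h2 => absurd ⟨h1, h2⟩ hs⟩
  choose A B hAB using hgr
  -- the jumps in terms of the traces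
  have hfc : ∀ x ∈ Icc m M, ContinuousAt (fLaw μ lam ρt) x := fun x hx =>
    (hasDerivAt_fLaw hμ hlam hρt (lt_of_lt_of_le hm hx.1)).continuousAt
  have hjf : ∀ s ∈ Icc 0 T, jump (outwardNormal (φ s)) (fun x => fLaw μ lam ρt (ρ s x)) (X s σ)
      = fLaw μ lam ρt (q s) - fLaw μ lam ρt (r s) := fun s hs => by
    obtain ⟨hr, hq, h1, h2⟩ := hrq s hs
    exact (h.domain s hs).jump_eq (hfr s hs) ((hfc _ hr).tendsto.comp h1)
      ((hfc _ hq).tendsto.comp h2)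
  have hbasis : ∀ s ∈ Icc 0 T, pwHolderNorm α (X s '' D₀) (G s) < ∞ →
      ∃ b : OrthonormalBasis (Fin 2) ℝ Plane, B s (b 1) = A s (b 1) ∧
        ∀ e, inner ℝ (b 0) (stress (μ (q s)) (lam (q s)) (P (q s)) (B s) e)
          = inner ℝ (b 0) (stress (μ (r s)) (lam (r s)) (P (r s)) (A s) e) := by
    intro s hs hG
    obtain ⟨b, hb0⟩ := exists_orthonormalBasis_of_norm_eq_one
      ((h.domain s hs).norm_outwardNormal (hfr s hs))
    obtain ⟨hr, hq, h1, h2⟩ := hrq s hs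
    obtain ⟨-, h3, h4⟩ := hAB s hs hG
    exact ⟨b, h.jump_conditions hT hb hI hρ hs (pwHolderNorm_lt_top_iff.1 hG).1 (hfr s hs) b hb0
      hr hq h1 h2 h3 h4⟩
  have h0 : (0 : ℝ) ∈ Icc 0 T := ⟨le_rfl, hT.le⟩
  constructor
  · have hj0 := hjf 0 h0
    rw [h.flow_zero] at hj0
    rw [hjf t ht, hj0, Real.norm_eq_abs, Real.norm_eq_abs]
    have hsub : Icc 0 t ⊆ Icc 0 T := Icc_subset_Icc_right ht.2
    have hmono : ∀ {g : ℝ → ℝ}, IntervalIntegrable g volume 0 T →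
        IntervalIntegrable g volume 0 t := fun hg =>
      hg.mono_set (by rw [uIcc_of_le ht.1, uIcc_of_le hT.le]; exact hsub)
    have hin := h.trace_along_flow hα hT hb hI hρ (σ := σ) (S := fun s => X s '' D₀) (S₀ := D₀)
      (fun y hy hyf => ((h.initial_domain hT.le).isOpen.frontier_eq ▸ hyf).2 hy)
      (fun s hs y hy => mem_image_of_mem _ hy) (frontier_subset_closure hσ)
      (r := r) (A := A) (fun s hs => (hrq s hs).2.2.1) (by
        filter_upwards [h.ae_pwHolderNorm_lt_top] with s hs hsT
        exact (hAB s (Ioo_subset_Icc_self hsT) (hs hsT)).2.1)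
    have hout := h.trace_along_flow hα hT hb hI hρ (σ := σ)
      (S := fun s => (closure (X s '' D₀))ᶜ) (S₀ := (closure D₀)ᶜ)
      (fun y hy hyf => hy (frontier_subset_closure hyf))
      (fun s hs y hy => h.flow_mem_compl_closure hT.le hs hy)
      ((h.initial_domain hT.le).mem_closure_compl_closure hσ)
      (r := q) (A := B) (fun s hs => (hrq s hs).2.2.2) (by
        filter_upwards [h.ae_pwHolderNorm_lt_top] with s hs hsT
        exact (hAB s (Ioo_subset_Icc_self hsT) (hs hsT)).2.2)
    -- κ is the stretching rate ⟨b 1, A (b 1)⟩ of the curve. It is the same from both sides, and the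
    -- inner trace serves for the bound.
    have hκ : ∀ s, ∃ κ : ℝ, s ∈ Icc 0 T → pwHolderNorm α (X s '' D₀) (G s) < ∞ →
        |κ| ≤ supNorm (G s) ∧
        (2 * μ (q s) + lam (q s)) * divOf (B s) - (2 * μ (r s) + lam (r s)) * divOf (A s)
          = (P (q s) - P (r s)) + 2 * (μ (q s) - μ (r s)) * κ := by
      intro s
      by_cases hs : s ∈ Icc 0 T ∧ pwHolderNorm α (X s '' D₀) (G s) < ∞
      · obtain ⟨b, hb1, hb2⟩ := hbasis s hs.1 hs.2
        refine ⟨inner ℝ (b 1) (A s (b 1)), fun _ _ => ⟨?_, jump_effective_flux b hb1 hb2⟩⟩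
        refine (abs_real_inner_le_norm _ _).trans ?_
        have h1 := (A s).le_opNorm (b 1)
        simp only [OrthonormalBasis.norm_eq_one, mul_one, one_mul] at h1 ⊢
        exact h1.trans (hAB s hs.1 hs.2).1
      · exact ⟨0, fun h1 h2 => absurd ⟨h1, h2⟩ hs⟩
    choose κ hκ using hκ
    -- The decay estimate compares the ends of an interval, so it is applied on `[0, t]`.
    refine abs_fLaw_sub_le hm hb hμ hlam hρt ht.1 (r := r) (s := q) (κ := κ)
      (d := fun s => divOf (A s)) (e := fun s => divOf (B s))
      (fun s hs => (hrq s (hsub hs)).1) (fun s hs => (hrq s (hsub hs)).2.1)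
      (hmono hin.1) (hmono hout.1) (hmono (h.intervalIntegrable_supNorm hT.le))
      (fun s hs => hin.2 s (hsub hs)) (fun s hs => hout.2 s (hsub hs)) ?_
    filter_upwards [h.ae_pwHolderNorm_lt_top] with s hs hst
    have hsT : s ∈ Ioo 0 T := ⟨hst.1, hst.2.trans_le ht.2⟩
    exact hκ s (Ioo_subset_Icc_self hsT) (hs hsT)
  · intro hG
    obtain ⟨b, hb1, hb2⟩ := hbasis t ht hG
    obtain ⟨hr, hq, -, -⟩ := hrq t ht
    obtain ⟨h2, h3, h4⟩ := hAB t ht hG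
    rw [(h.domain t ht).jump_eq (hfr t ht) h3 h4, hjf t ht, Real.norm_eq_abs]
    have hl := hb.lip ρt hρt _ hq _ hr
    exact norm_jump_gradient_le b hb1 hb2 hc (hμc _ hq) (hlam0 _ hq) h2 (hl P (by simp))
      (hl μ (by simp)) (hl lam (by simp))

end Interface

/-! ### Norms on transported curves -/

/-- A k-Lipschitz map multiplies length by at most k, so ∫ |g|^p grows by a factor k and the norm by
k^(1/p). For p = ∞ the exponent is 0 and it suffices that null sets have null images. -/
theorem curveNorm_image_le {F F' : Type*} [NormedAddCommGroup F] [NormedAddCommGroup F']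
    {f : Plane → Plane} {k : ℝ≥0} (hf : LipschitzWith k f) {C : Set Plane}
    (hC : MeasurableSet C) (hfC : MeasurableSet (f '' C)) {g : Plane → F} {g₀ : Plane → F'} {E : ℝ}
    (h : ∀ σ ∈ C, ‖g (f σ)‖ ≤ E * ‖g₀ σ‖) (p : ℝ≥0∞) (hp : 1 ≤ p) :
    curveNorm p (f '' C) g
      ≤ (k : ℝ≥0∞) ^ (p⁻¹).toReal * (ENNReal.ofReal E * curveNorm p C g₀) := by
  set H : Measure Plane := Measure.hausdorffMeasure 1 with hH
  have him : ∀ A : Set Plane, H (f '' A) ≤ k * H A := fun A => by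
    simpa using hf.hausdorffMeasure_image_le zero_le_one A
  have he : ∀ σ ∈ C, ‖g (f σ)‖ₑ ≤ ENNReal.ofReal E * ‖g₀ σ‖ₑ := fun σ hσ => by
    have h1 := h σ hσ
    rw [← ofReal_norm, ← ofReal_norm, ← ENNReal.ofReal_mul' (norm_nonneg _)]
    exact ENNReal.ofReal_le_ofReal h1
  rcases eq_or_ne p ∞ with rfl | hp'
  · simp only [curveNorm, ENNReal.inv_top, ENNReal.toReal_zero, ENNReal.rpow_zero, one_mul,
      eLpNorm_exponent_top, ← hH]
    refine essSup_le_of_ae_le _ ?_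
    have h1 := enorm_ae_le_eLpNormEssSup g₀ (H.restrict C)
    rw [ae_restrict_iff' hC, ae_iff] at h1
    set N := {σ | ¬(σ ∈ C → ‖g₀ σ‖ₑ ≤ eLpNormEssSup g₀ (H.restrict C))} with hN
    have h2 : H (f '' N) = 0 := by
      have := him N
      rwa [h1, mul_zero, nonpos_iff_eq_zero] at this
    refine (ae_restrict_iff' hfC).2 ?_
    filter_upwards [measure_eq_zero_iff_ae_notMem.1 h2] with x hx hxC
    obtain ⟨σ, hσ, rfl⟩ := hxC
    have h3 : ‖g₀ σ‖ₑ ≤ eLpNormEssSup g₀ (H.restrict C) := by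
      by_contra hne
      exact hx ⟨σ, fun hh => hne (hh hσ), rfl⟩
    exact (he σ hσ).trans (by gcongr)
  · have hp0 : p ≠ 0 := (lt_of_lt_of_le one_pos hp).ne'
    -- Comparing measures, instead of changing variables, requires neither injectivity nor an
    -- arc-length parametrization.
    have hle : H.restrict (f '' C) ≤ (k : ℝ≥0∞) • (H.restrict C).map f := by
      refine Measure.le_iff.2 fun A hA => ?_
      rw [Measure.restrict_apply hA, Measure.smul_apply, smul_eq_mul,
        Measure.map_apply hf.continuous.measurable hA,
        Measure.restrict_apply (hf.continuous.measurable hA)]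
      refine (measure_mono ?_).trans (him (f ⁻¹' A ∩ C))
      rintro _ ⟨hx, σ, hσ, rfl⟩
      exact ⟨σ, ⟨hx, hσ⟩, rfl⟩
    have hmap : eLpNorm g p ((H.restrict C).map f)
        ≤ ENNReal.ofReal E * eLpNorm g₀ p (H.restrict C) := by
      have h1 : eLpNorm g p ((H.restrict C).map f) ≤ eLpNorm (g ∘ f) p (H.restrict C) := by
        rw [eLpNorm_eq_lintegral_rpow_enorm_toReal hp0 hp',
          eLpNorm_eq_lintegral_rpow_enorm_toReal hp0 hp']
        exact ENNReal.rpow_le_rpow (lintegral_map_le (fun x => ‖g x‖ₑ ^ p.toReal) f)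
          (by positivity)
      refine h1.trans ?_
      refine eLpNorm_le_mul_eLpNorm_of_ae_le_mul ?_ p
      exact (ae_restrict_iff' hC).2 (Eventually.of_forall h)
    calc curveNorm p (f '' C) g ≤ eLpNorm g p ((k : ℝ≥0∞) • (H.restrict C).map f) :=
          eLpNorm_mono_measure _ hle
      _ = (k : ℝ≥0∞) ^ (p⁻¹).toReal * eLpNorm g p ((H.restrict C).map f) := by
          rw [eLpNorm_smul_measure_of_ne_top hp', smul_eq_mul, one_div]
      _ ≤ _ := by gcongr; exact hmap

end CompressibleNS

/-! ### Assembly of the estimates on the moving curve. -/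

theorem lemma2p4
    (P μ lam : ℝ → ℝ)
    (hP : ContDiffOn ℝ 2 P (Ioi 0)) (hμ : ContDiffOn ℝ 2 μ (Ioi 0))
    (hlam : ContDiffOn ℝ 2 lam (Ioi 0))
    (ρmin ρmax μmin μmax lamMax : ℝ) (hρmin : 0 < ρmin) (hμmin : 0 < μmin)
    (hlaw : ∀ r ∈ Icc ρmin ρmax, 0 < deriv P r ∧ 0 < μ r ∧ 0 ≤ lam r) :
    ∃ νmin νmax Cst : ℝ, 0 < νmin ∧ νmin < νmax ∧ 0 < Cst ∧
      ∀ (lamMin : ℝ) (α : ℝ≥0) (ρt T : ℝ) (D₀ : Set CompressibleNS.Plane)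
        (ρ : ℝ → CompressibleNS.Plane → ℝ)
        (u : ℝ → CompressibleNS.Plane → CompressibleNS.Plane)
        (G : ℝ → CompressibleNS.Plane → CompressibleNS.Plane →L[ℝ] CompressibleNS.Plane)
        (V X : ℝ → CompressibleNS.Plane → CompressibleNS.Plane)
        (φ : ℝ → CompressibleNS.Plane → ℝ),
        0 ≤ lamMin → 0 < α → α < 1 → 0 < ρt → 0 < T →
        CompressibleNS.IsLocalSolution P μ lam α ρt T D₀ ρ u G V X φ →
        (∀ t ∈ Icc 0 T, ∀ x,
          (ρmin ≤ ρ t x ∧ ρ t x ≤ ρmax) ∧ (μmin ≤ μ (ρ t x) ∧ μ (ρ t x) ≤ μmax) ∧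
            (lamMin ≤ lam (ρ t x) ∧ lam (ρ t x) ≤ lamMax)) →
        IntervalIntegrable (fun τ => CompressibleNS.supNorm (G τ)) volume 0 T ∧
        ∀ t ∈ Icc 0 T, ∀ p : ℝ≥0∞, 1 ≤ p →
          CompressibleNS.curveNorm p (X t '' frontier D₀)
              (CompressibleNS.jump (CompressibleNS.outwardNormal (φ t))
                (fun x => CompressibleNS.fLaw μ lam ρt (ρ t x)))
            ≤ CompressibleNS.curveNorm p (frontier D₀)
                (CompressibleNS.jump (CompressibleNS.outwardNormal (φ 0))
                  (fun x => CompressibleNS.fLaw μ lam ρt (ρ 0 x)))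
              * ENNReal.ofReal (Real.exp (-νmin * t + (6 * νmax + (p⁻¹).toReal)
                  * ∫ τ in (0 : ℝ)..t, CompressibleNS.supNorm (G τ))) ∧
          (CompressibleNS.pwHolderNorm α (X t '' D₀) (G t) < ∞ →
            CompressibleNS.curveNorm p (X t '' frontier D₀)
                (CompressibleNS.jump (CompressibleNS.outwardNormal (φ t)) (G t))
              ≤ ENNReal.ofReal Cst
                * CompressibleNS.curveNorm p (frontier D₀)
                  (CompressibleNS.jump (CompressibleNS.outwardNormal (φ 0))
                    (fun x => CompressibleNS.fLaw μ lam ρt (ρ 0 x)))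
                * ENNReal.ofReal (1 + CompressibleNS.supNorm (G t))
                * ENNReal.ofReal (Real.exp (-νmin * t + (6 * νmax + (p⁻¹).toReal)
                    * ∫ τ in (0 : ℝ)..t, CompressibleNS.supNorm (G τ)))) := by
  obtain ⟨νmin, νmax, K, hb⟩ := CompressibleNS.exists_lawBounds hP hμ hlam hρmin hlaw
  have hsub : Icc ρmin ρmax ⊆ Ioi 0 := fun x hx => lt_of_lt_of_le hρmin hx.1
  obtain ⟨c, hc, hμc⟩ := CompressibleNS.exists_pos_le_of_continuousOn
    (hμ.continuousOn.mono hsub) fun r hr => (hlaw r hr).2.1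
  have hK := hb.nonneg
  -- `5 * K / c` is the constant of the gradient jump, with c the minimum of μ; `+ 1` makes it
  -- strictly positive. All constants are fixed before the solution is introduced.
  refine ⟨νmin, νmax, 5 * K / c + 1, hb.pos, hb.lt, by positivity, ?_⟩
  intro lamMin α ρt T D₀ ρ u G V X φ _ hα _ hρt hT h hbd
  have hSi := h.intervalIntegrable_supNorm hT.le
  refine ⟨hSi, fun t ht p hp => ?_⟩
  have hj := fun σ hσ => h.norm_jump_le hα hT hρt hρmin hb hμ.continuousOn hlam.continuousOn hc hμc
    (fun r hr => (hlaw r hr).2.2) (fun t ht x => (hbd t ht x).1) (σ := σ) hσ ht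
  have hL : 0 ≤ ∫ τ in (0 : ℝ)..t, CompressibleNS.supNorm (G τ) :=
    intervalIntegral.integral_nonneg ht.1 fun τ _ => CompressibleNS.supNorm_nonneg _
  set Λ := ∫ τ in (0 : ℝ)..t, CompressibleNS.supNorm (G τ)
  have hfm : MeasurableSet (X t '' frontier D₀) := by
    rw [← h.frontier_image hT.le ht]
    exact isClosed_frontier.measurableSet
  have hνmax : 0 ≤ νmax := (hb.pos.trans hb.lt).le
  -- The stretching of the curve contributes Λ/p to the exponent. The pointwise decay has 2 νmax,
  -- and 6 νmax is larger because Λ ≥ 0.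
  have hexp : ENNReal.ofReal (Real.exp Λ) ^ (p⁻¹).toReal
        * ENNReal.ofReal (Real.exp (-νmin * t + 2 * νmax * Λ))
      ≤ ENNReal.ofReal (Real.exp (-νmin * t + (6 * νmax + (p⁻¹).toReal) * Λ)) := by
    rw [ENNReal.ofReal_rpow_of_pos (Real.exp_pos _), ← Real.exp_mul,
      ← ENNReal.ofReal_mul (Real.exp_nonneg _), ← Real.exp_add]
    refine ENNReal.ofReal_le_ofReal (Real.exp_le_exp.2 ?_)
    nlinarith [mul_nonneg hνmax hL]
  -- Both estimates share this passage from particles to L^p: E = 1 for f(ρ), and a multiple of 1 +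
  -- ‖∇u(t)‖_∞ for the gradient.
  have transfer : ∀ {F : Type} [NormedAddCommGroup F] {g : CompressibleNS.Plane → F} {E : ℝ},
      0 ≤ E → (∀ σ ∈ frontier D₀, ‖g (X t σ)‖ ≤ E * Real.exp (-νmin * t + 2 * νmax * Λ)
        * ‖CompressibleNS.jump (CompressibleNS.outwardNormal (φ 0))
          (fun x => CompressibleNS.fLaw μ lam ρt (ρ 0 x)) σ‖) →
      CompressibleNS.curveNorm p (X t '' frontier D₀) g
        ≤ ENNReal.ofReal E * (CompressibleNS.curveNorm p (frontier D₀)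
          (CompressibleNS.jump (CompressibleNS.outwardNormal (φ 0))
            (fun x => CompressibleNS.fLaw μ lam ρt (ρ 0 x)))
          * ENNReal.ofReal (Real.exp (-νmin * t + (6 * νmax + (p⁻¹).toReal) * Λ))) := by
    intro F _ g E hE hg
    refine (CompressibleNS.curveNorm_image_le (h.lipschitz_flow hT.le ht)
      isClosed_frontier.measurableSet hfm hg p hp).trans ?_
    rw [ENNReal.ofReal_mul hE]
    calc _ = ENNReal.ofReal E * (CompressibleNS.curveNorm p (frontier D₀)
          (CompressibleNS.jump (CompressibleNS.outwardNormal (φ 0))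
            (fun x => CompressibleNS.fLaw μ lam ρt (ρ 0 x)))
          * (ENNReal.ofReal (Real.exp Λ) ^ (p⁻¹).toReal
            * ENNReal.ofReal (Real.exp (-νmin * t + 2 * νmax * Λ)))) := by
          simp only [ENNReal.ofReal]
          ring
      _ ≤ _ := by gcongr
  constructor
  · have := transfer zero_le_one fun σ hσ => by
      rw [one_mul]
      exact (hj σ hσ).1
    rwa [ENNReal.ofReal_one, one_mul] at this
  · intro hG
    have hs := CompressibleNS.supNorm_nonneg (G t)
    have hC : 0 ≤ 5 * K / c := by positivity
    have := transfer (E := (5 * K / c + 1) * (1 + CompressibleNS.supNorm (G t))) (by positivity)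
      (g := CompressibleNS.jump (CompressibleNS.outwardNormal (φ t)) (G t)) fun σ hσ => by
        obtain ⟨h1, h2⟩ := hj σ hσ
        refine (h2 hG).trans ?_
        have h3 := mul_le_mul_of_nonneg_left h1 hC
        calc _ ≤ 5 * K / c * (Real.exp (-νmin * t + 2 * νmax * Λ)
              * ‖CompressibleNS.jump (CompressibleNS.outwardNormal (φ 0))
                (fun x => CompressibleNS.fLaw μ lam ρt (ρ 0 x)) σ‖)
              * (1 + CompressibleNS.supNorm (G t)) := by gcongr
          _ ≤ (5 * K / c + 1) * (Real.exp (-νmin * t + 2 * νmax * Λ)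
              * ‖CompressibleNS.jump (CompressibleNS.outwardNormal (φ 0))
                (fun x => CompressibleNS.fLaw μ lam ρt (ρ 0 x)) σ‖)
              * (1 + CompressibleNS.supNorm (G t)) := by
            gcongr
            linarith
          _ = _ := by ring
    rw [ENNReal.ofReal_mul (by positivity)] at this
    refine this.trans_eq ?_
    ring
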